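/- **Setting.** Let $\mathbb P$ be the set of primes and $s=\sigma+it$. For an open set $G\subseteq\mathbb C$ let $H(G)$ be the space of analytic functions on $G$ with the topology of uniform convergence on compact sets, and $\mathcal B(S)$ the Borel $\sigma$-algebra of a space $S$. *Matsumoto zeta-functions.* For each prime $p$ let $g(p)\in\mathbb N$, $a_p^{(j)}\in\mathbb C$, $f(j,p)\in\mathbb N$ $(1\le j\le g(p))$ be given, with $g(p)\le C_1p^{A}$ and $|a_p^{(j)}|\le p^{B}$ for some constants $C_1>0$, $A,B\ge 0$. The Euler product $$\widetilde\varphi(s)=\prod_{p}\prod_{j=1}^{g(p)}\bigl(1-a_p^{(j)}p^{-sf(j,p)}\bigr)^{-1}=\sum_{k\ge1}\frac{\widetilde c_k}{k^{s}}$$ converges absolutely for $\sigma>A+B+1$. Put $\varphi(s)=\widetilde\varphi(s+A+B)=\sum_{k\ge1}c_kk^{-s}$ for $\sigma>1$, where $c_k=k^{-A-B}\widetilde c_k$. Suppose that for some $\frac12\le\sigma_0<1$: (a) $\varphi$ continues meromorphically to $\sigma\ge\sigma_0$, and all its poles there lie in a compact set disjoint from the line $\sigma=\sigma_0$; (b)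 $\varphi(\sigma+it)=O(|t|^{C_2})$ as $|t|\to\infty$, uniformly for $\sigma\ge\sigma_0$, with a constant $C_2>0$; (c) $\int_0^T|\varphi(\sigma_0+it)|^2\,dt=O(T)$ as $T\to\infty$. Let $$D_\varphi=\{s:\sigma>\sigma_0,\ \sigma\ne\Re z\text{ for every pole } z \text{ of }\varphi\text{ in }\sigma\ge\sigma_0\}.$$ *Periodic Hurwitz zeta-functions.* Let $0<\alpha\le1$ and let $\mathfrak B=\{b_m\}_{m\ge0}$ be a periodic sequence of complex numbers, not all zero. Let $\zeta(s,\alpha;\mathfrak B)$ be the meromorphic continuation to $\mathbb C$ of $\sum_{m\ge0}b_m(m+\alpha)^{-s}$ $(\sigma>1)$; it is entire or has a single pole, simple, at $s=1$. Let $D_\zeta=\{\sigma>\frac12\}$ if it is entire and $D_\zeta=\{\sigma>\frac12,\ \sigma\neq1\}$ otherwise. *Random element.* Let $\gamma$ be the unit circle, $\Omega_1=\prod_{p\in\mathbb P}\gamma$, $\Omega_2=\prod_{m\ge0}\gamma$, $\Omega=\Omega_1\times\Omega_2$, and let $m_H$ be the product of the probability Haar measures of $\Omega_1$ and $\Omega_2$.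 Extend $\omega_1\in\Omega_1$ to $\mathbb N$ by $\omega_1(m)=\prod_{p^l\| m}\omega_1(p)^{l}$. Let $D_1\subseteq D_\varphi$ and $D_2\subseteq D_\zeta$ be open, $\underline H=H(D_1)\times H(D_2)$, and for $\omega=(\omega_1,\omega_2)\in\Omega$ $$\underline Z(\underline s,\omega)=\Bigl(\sum_{k\ge1}\frac{c_k\omega_1(k)}{k^{s_1}},\ \sum_{m\ge0}\frac{b_m\omega_2(m)}{(m+\alpha)^{s_2}}\Bigr),\qquad \underline s=(s_1,s_2)\in D_1\times D_2 .$$ **Theorem.** Let $h>0$, and suppose that the family $$L(\mathbb P,\alpha,h)=\Bigl\{(\log p:p\in\mathbb P),\ (\log(m+\alpha):m\in\mathbb N_0),\ \tfrac{2\pi}{h}\Bigr\}$$ is linearly independent over $\mathbb Q$. Then, for $m_H$-almost every $\omega$, the two series converge uniformly on compact subsets of $D_1$ and of $D_2$ respectively, so that $\underline Z(\cdot,\omega)$ is an $\underline H$-valued random element (defined almost surely and measurable up to a null set), and the probability measures $$P_N(A)=\frac1{N+1}\#\bigl\{0\le k\le N:\ (\varphi(s_1+ikh),\zeta(s_2+ikh,\alpha;\mathfrak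 B))\in A\bigr\},\qquad A\in\mathcal B(\underline H),$$ converge weakly, as $N\to\infty$, to the distribution $P_{\underline Z}(A)=m_H\{\omega:\underline Z(\cdot,\omega)\in A\}$ of $\underline Z$. -/

import Mathlib

open MeasureTheory Filter Topology TopologicalSpace
open scoped ENNReal

noncomputable section

namespace MixedZeta

/-! ### The space `H(G)` of analytic functions on an open set -/

/-- The space `H(G)` of analytic functions on the open set `G ⊆ ℂ`. -/
def Hol (G : Opens ℂ) : Type :=
  {f : C(G, ℂ) // ∃ F : ℂ → ℂ, DifferentiableOn ℂ F G ∧ ∀ z : G, f z = F z}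

/-- The topology of uniform convergence on compact sets: it is induced by the compact-open
topology of the space of continuous functions on `G`. -/
instance (G : Opens ℂ) : TopologicalSpace (Hol G) :=
  inferInstanceAs (TopologicalSpace
    {f : C(G, ℂ) // ∃ F : ℂ → ℂ, DifferentiableOn ℂ F G ∧ ∀ z : G, f z = F z})

instance (G : Opens ℂ) : SecondCountableTopology (Hol G) :=
  haveI : LocallyCompactSpace G := G.isOpen.locallyCompactSpace
  Topology.IsEmbedding.subtypeVal.secondCountableTopology

/-- The Borel `σ`-algebra of `H(G)`. -/
instance (G : Opens ℂ) : MeasurableSpace (Hol G) := borel _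

instance (G : Opens ℂ) : BorelSpace (Hol G) := ⟨rfl⟩

/-- The restriction to `G` of a function that is holomorphic on `G`, as an element of `H(G)`. -/
def Hol.ofFun {G : Opens ℂ} (F : ℂ → ℂ) (hF : DifferentiableOn ℂ F G) : Hol G :=
  ⟨⟨fun z : G => F z, hF.continuousOn.domRestrict⟩, F, hF, fun _ => rfl⟩

instance (G : Opens ℂ) : Nonempty (Hol G) :=
  ⟨Hol.ofFun (fun _ => 0) (differentiableOn_const 0)⟩

/-! ### The torus `Ω = Ω₁ × Ω₂` -/

instance : MeasurableSpace Circle := borel _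

instance : BorelSpace Circle := ⟨rfl⟩

/-- The torus `Ω₁`, the product of unit circles indexed by the primes. -/
abbrev Omega1 : Type := Nat.Primes → Circle

/-- The torus `Ω₂`, the product of unit circles indexed by the non-negative integers. -/
abbrev Omega2 : Type := ℕ → Circle

/-- The probability Haar measure on `Ω₁`. -/
def haar1 : Measure Omega1 := Measure.haarMeasure ⊤

/-- The probability Haar measure on `Ω₂`. -/
def haar2 : Measure Omega2 := Measure.haarMeasure ⊤

instance : IsProbabilityMeasure haar1 := ⟨Measure.haarMeasure_self⟩

instance : IsProbabilityMeasure haar2 := ⟨Measure.haarMeasure_self⟩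

/-- The probability Haar measure `m_H = m_{1H} × m_{2H}` on `Ω = Ω₁ × Ω₂`. -/
def haarOmega : Measure (Omega1 × Omega2) := haar1.prod haar2

instance : IsProbabilityMeasure haarOmega :=
  inferInstanceAs (IsProbabilityMeasure (haar1.prod haar2))

/-- A prime factor of `m`, as a prime. -/
def primeOf {m : ℕ} (p : m.primeFactors) : Nat.Primes :=
  ⟨p.1, Nat.prime_of_mem_primeFactors p.2⟩

/-- The completely multiplicative extension of `ω₁ ∈ Ω₁` to the positive integers:
`ω₁(m) = ∏ ω₁(p) ^ l`, over the prime powers `p ^ l` that exactly divide `m`. -/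
def omegaExt (ω : Omega1) (m : ℕ) : Circle :=
  ∏ p ∈ m.primeFactors.attach,
    ω (primeOf p) ^ m.factorization p.1

/-! ### Matsumoto zeta-functions -/

/-- The data of a polynomial Euler product
`∏_p ∏_{j ≤ g(p)} (1 - a_p^{(j)} p^{-s f(j,p)})⁻¹`, with the bounds
`g(p) ≤ C₁ p^A` and `|a_p^{(j)}| ≤ p^B`. -/
structure EulerData where
  g : Nat.Primes → ℕ
  g_pos : ∀ p, 0 < g p
  a : (p : Nat.Primes) → Fin (g p) → ℂ
  f : (p : Nat.Primes) → Fin (g p) → ℕ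
  f_pos : ∀ p j, 0 < f p j
  C₁ : ℝ
  C₁_pos : 0 < C₁
  A : ℝ
  A_nonneg : 0 ≤ A
  B : ℝ
  B_nonneg : 0 ≤ B
  g_le : ∀ p, (g p : ℝ) ≤ C₁ * (p : ℝ) ^ A
  a_le : ∀ p j, ‖a p j‖ ≤ (p : ℝ) ^ B

namespace EulerData

variable (E : EulerData)

/-- The polynomial Euler product `φ̃(s)`; it converges absolutely for `Re s > A + B + 1`. -/
def eulerProduct (s : ℂ) : ℂ :=
  ∏' p : Nat.Primes, ∏ j : Fin (E.g p), (1 - E.a p j * (p : ℂ) ^ (-(s * E.f p j)))⁻¹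

/-- The Euler factor at `p` as a formal power series in `X = p^{-s}`. -/
def localSeries (p : Nat.Primes) : PowerSeries ℂ :=
  (∏ j : Fin (E.g p), (1 - PowerSeries.C (E.a p j) * PowerSeries.X ^ E.f p j))⁻¹

/-- The coefficient `c̃_k` of the Dirichlet series obtained by multiplying out the Euler
product `φ̃`. -/
def cTilde (k : ℕ) : ℂ :=
  ∏ p ∈ k.primeFactors.attach,
    PowerSeries.coeff (k.factorization p.1)
      (E.localSeries (primeOf p))

/-- The coefficient `c_k = k^{-A-B} c̃_k` of the shifted function `φ(s) = φ̃(s + A + B)`. -/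
def c (k : ℕ) : ℂ := (((k : ℝ) ^ (-E.A - E.B) : ℝ) : ℂ) * E.cTilde k

end EulerData

/-- The poles of `F` in the closed half-plane `Re s ≥ σ₀`. -/
def polesIn (F : ℂ → ℂ) (σ₀ : ℝ) : Set ℂ :=
  {s | σ₀ ≤ s.re ∧ meromorphicOrderAt F s < 0}

/-- A general Matsumoto zeta-function `φ`: the meromorphic continuation to `Re s ≥ σ₀` of the
shifted Euler product `φ̃(s + A + B)`, subject to the three analytic conditions. -/
structure MatsumotoZeta extends EulerData where
  φ : ℂ → ℂ
  σ₀ : ℝ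
  half_le : 1 / 2 ≤ σ₀
  lt_one : σ₀ < 1
  eq_euler : ∀ s : ℂ, 1 < s.re → φ s = toEulerData.eulerProduct (s + A + B)
  meromorphic : MeromorphicOn φ {s | σ₀ ≤ s.re}
  -- removable singularities are removed
  analytic : ∀ s : ℂ, σ₀ ≤ s.re → s ∉ polesIn φ σ₀ → AnalyticAt ℂ φ s
  poles_compact : ∃ K : Set ℂ, IsCompact K ∧ (∀ s ∈ K, s.re ≠ σ₀) ∧ polesIn φ σ₀ ⊆ K
  growth : ∃ C₂ : ℝ, 0 < C₂ ∧ ∃ M t₀ : ℝ, ∀ s : ℂ, σ₀ ≤ s.re → t₀ ≤ |s.im| →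
    ‖φ s‖ ≤ M * |s.im| ^ C₂
  mean_square :
    (fun T : ℝ => ∫ t in (0 : ℝ)..T, ‖φ (σ₀ + t * Complex.I)‖ ^ 2) =O[atTop] (fun T : ℝ => T)

namespace MatsumotoZeta

variable (Φ : MatsumotoZeta)

/-- The set `D_φ`: the half-plane `Re s > σ₀` without the vertical lines through the poles. -/
def domain : Set ℂ :=
  {s | Φ.σ₀ < s.re ∧ ∀ z ∈ polesIn Φ.φ Φ.σ₀, s.re ≠ z.re}

lemma differentiableOn_shift {D : Opens ℂ} (hD : (D : Set ℂ) ⊆ Φ.domain) (t : ℝ) :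
    DifferentiableOn ℂ (fun s => Φ.φ (s + t * Complex.I)) D := by
  intro s hs
  have hre : (s + t * Complex.I).re = s.re := by simp
  have hs' := hD hs
  have h1 : AnalyticAt ℂ Φ.φ (s + t * Complex.I) :=
    Φ.analytic _ (by rw [hre]; exact hs'.1.le) fun hp => hs'.2 _ hp hre.symm
  have h2 : DifferentiableAt ℂ (fun s : ℂ => s + t * Complex.I) s := by fun_prop
  exact (DifferentiableAt.comp s h1.differentiableAt h2).differentiableWithinAt

/-- The shift `s ↦ φ(s + it)` as an element of `H(D)`. -/
def shift {D : Opens ℂ} (hD : (D : Set ℂ) ⊆ Φ.domain) (t : ℝ) : Hol D :=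
  Hol.ofFun (fun s => Φ.φ (s + t * Complex.I)) (Φ.differentiableOn_shift hD t)

lemma differentiableOn_partialSum (D : Opens ℂ) (ω : Omega1) (n : ℕ) :
    DifferentiableOn ℂ
      (fun s : ℂ => ∑ k ∈ Finset.Icc 1 n, Φ.c k * (omegaExt ω k : ℂ) / (k : ℂ) ^ s) D := by
  refine DifferentiableOn.fun_sum fun k hk => ?_
  have hk0 : (k : ℂ) ≠ 0 := by
    have := (Finset.mem_Icc.mp hk).1
    exact_mod_cast (by omega : k ≠ 0)
  refine DifferentiableOn.div (differentiableOn_const _) ?_ fun s _ => ?_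
  · exact (differentiable_id.const_cpow (Or.inl hk0)).differentiableOn
  · simp [Complex.cpow_eq_zero_iff, hk0]

/-- The partial sums of the series `φ(s, ω₁) = ∑_{k ≥ 1} c_k ω₁(k) / k^s`. -/
def partialSum (D : Opens ℂ) (ω : Omega1) (n : ℕ) : Hol D :=
  Hol.ofFun (fun s : ℂ => ∑ k ∈ Finset.Icc 1 n, Φ.c k * (omegaExt ω k : ℂ) / (k : ℂ) ^ s)
    (Φ.differentiableOn_partialSum D ω n)

/-- `φ(s, ω₁) = ∑_{k ≥ 1} c_k ω₁(k) / k^s` as an element of `H(D)`: the limit of the partial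
sums, uniformly on compact sets. -/
def random (D : Opens ℂ) (ω : Omega1) : Hol D := limUnder atTop (Φ.partialSum D ω)

end MatsumotoZeta

/-! ### Periodic Hurwitz zeta-functions -/

/-- The periodic Hurwitz zeta-function `ζ(s, α; 𝔅)` of a sequence `b` with period `q ≥ 1`,
continued to `ℂ` through `q^{-s} ∑_{l < q} b_l ζ(s, (l + α) / q)`. -/
def periodicHurwitz (α : ℝ) (q : ℕ) (b : ℕ → ℂ) (s : ℂ) : ℂ :=
  1 / (q : ℂ) ^ s *
    ∑ l ∈ Finset.range q, b l * HurwitzZeta.hurwitzZeta (((l + α) / q : ℝ) : UnitAddCircle) s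

/-- For `Re s > 1`, `ζ(s, α; 𝔅)` is the sum of its Dirichlet series. -/
lemma hasSum_periodicHurwitz {α : ℝ} (hα₀ : 0 < α) (hα₁ : α ≤ 1) {q : ℕ} (hq : 0 < q)
    {b : ℕ → ℂ} (hb : Function.Periodic b q) {s : ℂ} (hs : 1 < s.re) :
    HasSum (fun m : ℕ => b m / ((m + α : ℝ) : ℂ) ^ s) (periodicHurwitz α q b s) := by
  have hq0 : (0 : ℝ) < q := by exact_mod_cast hq
  have key : ∀ l ∈ Finset.range q,
      HasSum (fun m : ℕ => if m % q = l then b m / ((m + α : ℝ) : ℂ) ^ s else 0)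
        (1 / (q : ℂ) ^ s *
          (b l * HurwitzZeta.hurwitzZeta (((l + α) / q : ℝ) : UnitAddCircle) s)) := by
    intro l hl
    have hlq : l < q := Finset.mem_range.mp hl
    have hlq' : (l : ℝ) + 1 ≤ q := by exact_mod_cast hlq
    have hmem : (l + α) / q ∈ Set.Icc (0 : ℝ) 1 :=
      ⟨by positivity, (div_le_one hq0).mpr (by linarith)⟩
    have h1 := ((HurwitzZeta.hasSum_hurwitzZeta_of_one_lt_re hmem hs).mul_left (b l)).mul_left
      (1 / (q : ℂ) ^ s)
    have hinj : Function.Injective (fun n : ℕ => l + q * n) := fun x y hxy =>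
      Nat.eq_of_mul_eq_mul_left hq (Nat.add_left_cancel hxy)
    rw [← hinj.hasSum_iff]
    · refine Eq.subst (motive := fun F => HasSum F _) (funext fun n => ?_) h1
      symm
      have hbn : b (l + q * n) = b l := by
        have := hb.nat_mul n l
        simpa [mul_comm] using this
      have hx : ((l + q * n : ℕ) : ℝ) + α = q * (n + (l + α) / q) := by
        push_cast
        field_simp
        ring
      have hmod : (l + q * n) % q = l := by
        rw [Nat.add_mul_mod_self_left, Nat.mod_eq_of_lt hlq]
      have hcp : ((((l + q * n : ℕ) : ℝ) + α : ℝ) : ℂ) ^ s =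
          (q : ℂ) ^ s * ((n : ℂ) + (((l + α) / q : ℝ) : ℂ)) ^ s := by
        rw [hx, Complex.ofReal_mul, Complex.mul_cpow_ofReal_nonneg hq0.le (by positivity)]
        push_cast
        rfl
      simp only [Function.comp_apply, hmod, if_true, hbn]
      rw [hcp]
      ring
    · intro m hm
      rw [if_neg]
      intro hml
      exact hm ⟨m / q, by simp only [← hml]; exact Nat.mod_add_div m q⟩
  have h2 := hasSum_sum key
  rw [← Finset.mul_sum] at h2
  refine Eq.subst (motive := fun F => HasSum F _) (funext fun m => ?_) h2
  rw [Finset.sum_ite_eq, if_pos (Finset.mem_range.mpr (Nat.mod_lt m hq))]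

open Classical in
/-- The set `D_ζ`: the half-plane `Re s > 1/2`, without the line `Re s = 1` unless
`ζ(s, α; 𝔅)` is entire. -/
def hurwitzDomain (α : ℝ) (q : ℕ) (b : ℕ → ℂ) : Set ℂ :=
  if Differentiable ℂ (periodicHurwitz α q b) then {s | 1 / 2 < s.re}
  else {s | 1 / 2 < s.re ∧ s.re ≠ 1}

lemma differentiableAt_periodicHurwitz (α : ℝ) {q : ℕ} (hq : 0 < q) (b : ℕ → ℂ) {s : ℂ}
    (hs : s ≠ 1) : DifferentiableAt ℂ (periodicHurwitz α q b) s := by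
  have hq0 : (q : ℂ) ≠ 0 := by exact_mod_cast hq.ne'
  refine DifferentiableAt.mul ?_ ?_
  · refine DifferentiableAt.div (differentiableAt_const _) ?_ ?_
    · exact differentiableAt_id.const_cpow (Or.inl hq0)
    · simp [Complex.cpow_eq_zero_iff, hq0]
  · exact DifferentiableAt.fun_sum fun l _ =>
      (HurwitzZeta.differentiableAt_hurwitzZeta _ hs).const_mul _

lemma differentiableOn_hurwitzShift {α : ℝ} {q : ℕ} (hq : 0 < q) {b : ℕ → ℂ} {D : Opens ℂ}
    (hD : (D : Set ℂ) ⊆ hurwitzDomain α q b) (t : ℝ) :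
    DifferentiableOn ℂ (fun s => periodicHurwitz α q b (s + t * Complex.I)) D := by
  intro s hs
  have h2 : DifferentiableAt ℂ (fun s : ℂ => s + t * Complex.I) s := by fun_prop
  have hs' := hD hs
  have h1 : DifferentiableAt ℂ (periodicHurwitz α q b) (s + t * Complex.I) := by
    unfold hurwitzDomain at hs'
    split_ifs at hs' with hE
    · exact hE _
    · refine differentiableAt_periodicHurwitz α hq b fun h1 => hs'.2 ?_
      have := congrArg Complex.re h1
      simpa using this
  exact (DifferentiableAt.comp s h1 h2).differentiableWithinAt

/-- The shift `s ↦ ζ(s + it, α; 𝔅)` as an element of `H(D)`. -/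
def hurwitzShift {α : ℝ} {q : ℕ} (hq : 0 < q) {b : ℕ → ℂ} {D : Opens ℂ}
    (hD : (D : Set ℂ) ⊆ hurwitzDomain α q b) (t : ℝ) : Hol D :=
  Hol.ofFun (fun s => periodicHurwitz α q b (s + t * Complex.I))
    (differentiableOn_hurwitzShift hq hD t)

lemma differentiableOn_hurwitzPartialSum {α : ℝ} (hα : 0 < α) (b : ℕ → ℂ) (D : Opens ℂ)
    (ω : Omega2) (n : ℕ) :
    DifferentiableOn ℂ
      (fun s : ℂ => ∑ m ∈ Finset.range n, b m * (ω m : ℂ) / ((m + α : ℝ) : ℂ) ^ s) D := by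
  refine DifferentiableOn.fun_sum fun m _ => ?_
  have hm0 : ((m + α : ℝ) : ℂ) ≠ 0 := by
    have : (0 : ℝ) < m + α := by positivity
    exact_mod_cast this.ne'
  refine DifferentiableOn.div (differentiableOn_const _) ?_ fun s _ => ?_
  · exact (differentiable_id.const_cpow (Or.inl hm0)).differentiableOn
  · simp only [ne_eq, Complex.cpow_eq_zero_iff, hm0, false_and, not_false_eq_true]

/-- The partial sums of the series `ζ(s, α, ω₂; 𝔅) = ∑_{m ≥ 0} b_m ω₂(m) / (m + α)^s`. -/
def hurwitzPartialSum {α : ℝ} (hα : 0 < α) (b : ℕ → ℂ) (D : Opens ℂ) (ω : Omega2) (n : ℕ) :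
    Hol D :=
  Hol.ofFun (fun s : ℂ => ∑ m ∈ Finset.range n, b m * (ω m : ℂ) / ((m + α : ℝ) : ℂ) ^ s)
    (differentiableOn_hurwitzPartialSum hα b D ω n)

/-- `ζ(s, α, ω₂; 𝔅) = ∑_{m ≥ 0} b_m ω₂(m) / (m + α)^s` as an element of `H(D)`: the limit of
the partial sums, uniformly on compact sets. -/
def hurwitzRandom {α : ℝ} (hα : 0 < α) (b : ℕ → ℂ) (D : Opens ℂ) (ω : Omega2) : Hol D :=
  limUnder atTop (hurwitzPartialSum hα b D ω)

/-! ### The independence condition and the measures -/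

/-- The family `L(ℙ, α, h)`: all `log p`, all `log (m + α)`, and `2π / h`. -/
def familyL (α h : ℝ) : Nat.Primes ⊕ ℕ ⊕ Unit → ℝ :=
  Sum.elim (fun p => Real.log p)
    (Sum.elim (fun m => Real.log (m + α)) (fun _ => 2 * Real.pi / h))

/-- The random element `Z(s, ω) = (φ(s₁, ω₁), ζ(s₂, α, ω₂; 𝔅))` of `H(D₁) × H(D₂)`. -/
def randomZ (Φ : MatsumotoZeta) {α : ℝ} (hα : 0 < α) (b : ℕ → ℂ) (D₁ D₂ : Opens ℂ)
    (ω : Omega1 × Omega2) : Hol D₁ × Hol D₂ :=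
  (Φ.random D₁ ω.1, hurwitzRandom hα b D₂ ω.2)

/-- The shift `Z(s + it) = (φ(s₁ + it), ζ(s₂ + it, α; 𝔅))` as an element of
`H(D₁) × H(D₂)`. -/
def shiftZ (Φ : MatsumotoZeta) {α : ℝ} {q : ℕ} (hq : 0 < q) {b : ℕ → ℂ} {D₁ D₂ : Opens ℂ}
    (hD₁ : (D₁ : Set ℂ) ⊆ Φ.domain) (hD₂ : (D₂ : Set ℂ) ⊆ hurwitzDomain α q b) (t : ℝ) :
    Hol D₁ × Hol D₂ :=
  (Φ.shift hD₁ t, hurwitzShift hq hD₂ t)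

/-- The empirical measure of the points `x 0, …, x N`. -/
def empirical {X : Type*} [MeasurableSpace X] (x : ℕ → X) (N : ℕ) : ProbabilityMeasure X :=
  ⟨((N + 1 : ℕ) : ℝ≥0∞)⁻¹ • ∑ k ∈ Finset.range (N + 1), Measure.dirac (x k), ⟨by
    simp only [Measure.smul_apply, Measure.finsetSum_apply, measure_univ, Finset.sum_const,
      Finset.card_range, smul_eq_mul, nsmul_eq_mul, mul_one]
    exact ENNReal.inv_mul_cancel (by simp) (ENNReal.natCast_ne_top _)⟩⟩

open Classical in
lemma empirical_apply {X : Type*} [MeasurableSpace X] (x : ℕ → X) (N : ℕ) {A : Set X}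
    (hA : MeasurableSet A) :
    (empirical x N : Measure X) A =
      ((N + 1 : ℕ) : ℝ≥0∞)⁻¹ * ((Finset.range (N + 1)).filter (fun k => x k ∈ A)).card := by
  simp [empirical, Measure.finsetSum_apply, Measure.dirac_apply' _ hA, Set.indicator_apply]

end MixedZeta

end

noncomputable section

namespace MixedZeta

/-! ### Mean values of exponential sums and of holomorphic functions -/

/-! Both functions are compared with the partial sums of their Dirichlet series. A vertical shift by
`t` multiplies the coefficients of the `n`-th partial sums by `k ^ (-it)` and `(m + α) ^ (-it)`
(`dirichletSum_twist`, `omegaExt_torusPoint`). For fixed `n` the pair of sums shifted by `kh` is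
therefore a continuous `H(D₁) × H(D₂)`-valued function on the torus `Ω`, evaluated at the `k`-th
power of one group element.

By the linear independence hypothesis no nontrivial character of `Ω` equals `1` at that element
(`torusChar_torusPoint_ne_one`), so Weyl's criterion gives equidistribution of its powers with
respect to Haar measure (`tendsto_empirical_torusPoint`). Hence the shifted partial sums converge in
distribution to the `n`-th partial sums of the random series. These converge almost surely in `H(D₁)
× H(D₂)`: the factors `ω₁(k)`, and likewise `ω₂(m)`, are orthonormal, the coefficients are `O(k ^
ε)`, and a Rademacher–Menshov maximal inequality applies to mean squares over small squares to the
right of `1/2` (`ae_exists_tendsto_hol`). So the limits for fixed `n` tend to the distribution of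
the random element.

The limits in `n` and `N` may be interchanged once the partial sums approximate the functions in
measure: for large `n`, all but a small proportion of the shifts `kh` are uniformly good on a given
compact set (`tendsto_empirical_of_approx`, `card_compact_le`). This comes from a continuous mean
square. The difference between function and partial sum, times a bounded factor that cancels the
poles, has mean square `O(T n ^ ε)` on the left edge, while far to the right it is a power of `n`
smaller than `T`. A three lines theorem for mean squares (`integral_norm_sq_le_interp`) makes it
`o(T)` at every abscissa in between (`mean_sq_sub_dirichletSum_le`). No discrete large sieve is
needed: the square of a holomorphic function at a point is bounded by its mean over a small square,
and squares of height at most `h`, shifted by multiples of `h`, do not overlap.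

It remains to verify the analytic input. For `φ`, multiplying out the Euler product gives `c_k = O(k
^ ε)` (`exists_norm_cTilde_le`); growth and mean square are assumed. The periodic Hurwitz function
is a combination of Hurwitz zeta-functions, for which Euler summation gives both
(`norm_hurwitzZeta_le`, `exists_integral_norm_sq_hurwitzZeta_le`). -/

lemma norm_integral_exp_le {x : ℝ} (hx : x ≠ 0) (A B : ℝ) :
    ‖∫ t in A..B, Complex.exp (x * Complex.I * t)‖ ≤ 2 / |x| := by
  have hc : (x : ℂ) * Complex.I ≠ 0 := mul_ne_zero (by exact_mod_cast hx) Complex.I_ne_zero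
  rw [integral_exp_mul_complex hc, norm_div]
  have h1 : ∀ t : ℝ, ‖Complex.exp (x * Complex.I * t)‖ = 1 := fun t => by
    rw [Complex.norm_exp]; simp
  have : ‖(x : ℂ) * Complex.I‖ = |x| := by simp
  rw [this]
  gcongr
  calc _ ≤ ‖Complex.exp (x * Complex.I * B)‖ + ‖Complex.exp (x * Complex.I * A)‖ := norm_sub_le _ _
    _ = 2 := by rw [h1, h1]; norm_num

/-- A mean value inequality for exponential sums with distinct real frequencies. -/
theorem integral_norm_sq_sum_exp_le {ι : Type*} [DecidableEq ι] (s : Finset ι) (u : ι → ℂ)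
    (θ : ι → ℝ) (hθ : Set.InjOn θ s) {A B : ℝ} (hAB : A ≤ B) :
    ∫ t in A..B, ‖∑ k ∈ s, u k * Complex.exp (θ k * Complex.I * t)‖ ^ 2 ≤
      (B - A) * ∑ k ∈ s, ‖u k‖ ^ 2 +
        ∑ k ∈ s, ∑ l ∈ s.erase k, ‖u k‖ * ‖u l‖ * (2 / |θ k - θ l|) := by
  have hpt : ∀ t : ℝ, ((‖∑ k ∈ s, u k * Complex.exp (θ k * Complex.I * t)‖ ^ 2 : ℝ) : ℂ) =
      ∑ k ∈ s, ∑ l ∈ s, u k * (starRingEnd ℂ) (u l) *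
        Complex.exp ((θ k - θ l : ℝ) * Complex.I * t) := by
    intro t
    rw [Complex.ofReal_pow, ← Complex.mul_conj', map_sum, Finset.sum_mul_sum]
    refine Finset.sum_congr rfl fun k _ => Finset.sum_congr rfl fun l _ => ?_
    rw [map_mul, ← Complex.exp_conj, mul_mul_mul_comm, ← Complex.exp_add]
    congr 2
    simp
    ring
  have hint : ∀ k l, IntervalIntegrable (fun t : ℝ => u k * (starRingEnd ℂ) (u l) *
        Complex.exp ((θ k - θ l : ℝ) * Complex.I * t)) volume A B := fun k l =>
    (by fun_prop : Continuous fun t : ℝ => u k * (starRingEnd ℂ) (u l) *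
        Complex.exp ((θ k - θ l : ℝ) * Complex.I * t)).intervalIntegrable _ _
  have heq : ((∫ t in A..B, ‖∑ k ∈ s, u k * Complex.exp (θ k * Complex.I * t)‖ ^ 2 : ℝ) : ℂ) =
      ∑ k ∈ s, ∑ l ∈ s, u k * (starRingEnd ℂ) (u l) *
        ∫ t in A..B, Complex.exp ((θ k - θ l : ℝ) * Complex.I * t) := by
    rw [← intervalIntegral.integral_ofReal]
    simp_rw [hpt]
    rw [intervalIntegral.integral_finsetSum fun k _ =>
      (by fun_prop : Continuous fun t : ℝ => ∑ l ∈ s, u k * (starRingEnd ℂ) (u l) *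
        Complex.exp ((θ k - θ l : ℝ) * Complex.I * t)).intervalIntegrable _ _]
    refine Finset.sum_congr rfl fun k _ => ?_
    rw [intervalIntegral.integral_finsetSum fun l _ => hint k l]
    refine Finset.sum_congr rfl fun l _ => ?_
    rw [intervalIntegral.integral_const_mul]
  have hnn : 0 ≤ ∫ t in A..B, ‖∑ k ∈ s, u k * Complex.exp (θ k * Complex.I * t)‖ ^ 2 :=
    intervalIntegral.integral_nonneg hAB fun t _ => by positivity
  rw [← abs_of_nonneg hnn, ← Real.norm_eq_abs, ← Complex.norm_real, heq, Finset.mul_sum,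
    ← Finset.sum_add_distrib]
  refine (norm_sum_le _ _).trans (Finset.sum_le_sum fun k hk => ?_)
  rw [← Finset.add_sum_erase s _ hk]
  refine (norm_add_le _ _).trans (add_le_add ?_ ?_)
  · simp only [sub_self, Complex.ofReal_zero, zero_mul, Complex.exp_zero]
    rw [intervalIntegral.integral_const, norm_mul, norm_mul, RCLike.norm_conj, norm_smul,
      Real.norm_eq_abs, abs_of_nonneg (sub_nonneg.mpr hAB)]
    simp only [norm_one, mul_one]
    exact le_of_eq (by ring)
  · refine (norm_sum_le _ _).trans (Finset.sum_le_sum fun l hl => ?_)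
    have hkl : θ k - θ l ≠ 0 := sub_ne_zero.mpr fun h =>
      (Finset.ne_of_mem_erase hl) (hθ hk (Finset.mem_of_mem_erase hl) h).symm
    rw [norm_mul, norm_mul, RCLike.norm_conj]
    gcongr
    exact norm_integral_exp_le hkl A B

/-- The mean value property and the triangle inequality. The angle runs over `(-π, π)` to agree with
the range of polar coordinates. -/
lemma enorm_mul_le_lintegral_circleMap {g : ℂ → ℂ} {z : ℂ} {ρ : ℝ} (hρ : 0 < ρ)
    (hg : DiffContOnCl ℂ g (Metric.ball z ρ)) :
    ENNReal.ofReal (2 * Real.pi) * ‖g z‖ₑ ≤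
      ∫⁻ θ in Set.Ioo (-Real.pi) Real.pi, ‖g (circleMap z ρ θ)‖ₑ := by
  have h1 := DiffContOnCl.circleAverage (f := g) (c := z) (R := ρ) (by rwa [abs_of_pos hρ])
  rw [Real.circleAverage_def] at h1
  have hper : Function.Periodic (fun θ => g (circleMap z ρ θ)) (2 * Real.pi) := fun θ => by
    simp only [periodic_circleMap z ρ θ]
  have h2 := hper.intervalIntegral_add_eq 0 (-Real.pi)
  rw [zero_add, show -Real.pi + 2 * Real.pi = Real.pi by ring] at h2
  rw [h2] at h1
  have hpi : (0 : ℝ) < 2 * Real.pi := by positivity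
  have h3 : (2 * Real.pi) • g z = ∫ θ in (-Real.pi)..Real.pi, g (circleMap z ρ θ) := by
    rw [← h1, smul_smul, mul_inv_cancel₀ hpi.ne', one_smul]
  have h4 : ENNReal.ofReal (2 * Real.pi) * ‖g z‖ₑ = ‖(2 * Real.pi) • g z‖ₑ := by
    rw [enorm_smul, Real.enorm_eq_ofReal hpi.le]
  rw [h4, h3, intervalIntegral.integral_of_le (by linarith [Real.pi_pos]),
    integral_Ioc_eq_integral_Ioo]
  exact enorm_integral_le_lintegral_enorm _

/-- The circle inequality integrated against `ρ dρ` over `0 < ρ < r`, which is an area integral in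
polar coordinates. -/
lemma enorm_mul_le_lintegral_ball {g : ℂ → ℂ} {z : ℂ} {r : ℝ} (hr : 0 < r)
    (hg : DifferentiableOn ℂ g (Metric.ball z r)) :
    ENNReal.ofReal (Real.pi * r ^ 2) * ‖g z‖ₑ ≤ ∫⁻ w in Metric.ball z r, ‖g w‖ₑ := by
  classical
  -- The change to polar coordinates is over the whole plane, so `g` is extended by zero to a
  -- globally measurable function.
  set G : ℂ → ℂ := (Metric.ball z r).piecewise g 0 with hG
  have hGm : Measurable G :=
    hg.continuousOn.measurable_piecewise continuousOn_const Metric.isOpen_ball.measurableSet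
  have hGeq : ∀ w ∈ Metric.ball z r, G w = g w := fun w hw => Set.piecewise_eq_of_mem _ _ _ hw
  have h1 : ∫⁻ w in Metric.ball z r, ‖g w‖ₑ = ∫⁻ w, ‖G w‖ₑ := by
    rw [← lintegral_indicator Metric.isOpen_ball.measurableSet]
    refine lintegral_congr fun w => ?_
    by_cases hw : w ∈ Metric.ball z r
    · rw [Set.indicator_of_mem hw, hGeq w hw]
    · rw [Set.indicator_of_notMem hw, hG, Set.piecewise_eq_of_notMem _ _ _ hw]; simp
  have h2 : ∫⁻ w, ‖G w‖ₑ = ∫⁻ w, ‖G (z + w)‖ₑ :=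
    (lintegral_add_left_eq_self (fun w => ‖G w‖ₑ) z).symm
  have hcm : ∀ p : ℝ × ℝ, z + Complex.polarCoord.symm p = circleMap z p.1 p.2 := fun p => by
    rw [Complex.polarCoord_symm_apply, circleMap, Complex.exp_mul_I, Complex.ofReal_cos,
      Complex.ofReal_sin]
  have hcont : Continuous fun p : ℝ × ℝ => circleMap z p.1 p.2 := by
    unfold circleMap; fun_prop
  rw [h1, h2, ← Complex.lintegral_comp_polarCoord_symm]
  simp only [hcm]
  rw [show polarCoord.target = Set.Ioi (0 : ℝ) ×ˢ Set.Ioo (-Real.pi) Real.pi from rfl,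
    Measure.volume_eq_prod, ← Measure.prod_restrict,
    lintegral_prod _ (by fun_prop)]
  have h3 : ∫⁻ ρ in Set.Ioo 0 r, ENNReal.ofReal ρ * (ENNReal.ofReal (2 * Real.pi) * ‖g z‖ₑ) ≤
      ∫⁻ ρ in Set.Ioi (0 : ℝ), ∫⁻ θ in Set.Ioo (-Real.pi) Real.pi,
        ENNReal.ofReal ρ • ‖G (circleMap z ρ θ)‖ₑ := by
    refine le_trans ?_ (lintegral_mono_set (Set.Ioo_subset_Ioi_self (a := r) (b := 0)))
    refine setLIntegral_mono' measurableSet_Ioo fun ρ hρ => ?_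
    simp only [smul_eq_mul]
    rw [lintegral_const_mul _ (by fun_prop)]
    gcongr
    have hsub : Metric.closedBall z ρ ⊆ Metric.ball z r := Metric.closedBall_subset_ball hρ.2
    have := enorm_mul_le_lintegral_circleMap hρ.1 (g := g) (z := z)
      ((hg.mono (closure_ball z hρ.1.ne' ▸ hsub)).diffContOnCl)
    refine this.trans (le_of_eq (lintegral_congr fun θ => ?_))
    rw [hGeq _ (hsub (circleMap_mem_closedBall z hρ.1.le θ))]
  refine le_trans (le_of_eq ?_) h3
  rw [lintegral_mul_const _ (by fun_prop), ← mul_assoc]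
  congr 1
  have h4 : ∫⁻ ρ in Set.Ioo 0 r, ENNReal.ofReal ρ = ENNReal.ofReal (r ^ 2 / 2) := by
    rw [← ofReal_integral_eq_lintegral_ofReal, ← integral_Ioc_eq_integral_Ioo,
      ← intervalIntegral.integral_of_le hr.le, integral_id]
    · simp
    · exact (continuous_id.integrableOn_Icc (a := 0) (b := r)).mono_set Set.Ioo_subset_Icc_self
    · exact (ae_restrict_mem measurableSet_Ioo).mono fun x hx => hx.1.le
  rw [h4, ← ENNReal.ofReal_mul (by positivity)]
  congr 1
  ring

/-- The value of a holomorphic function at a point of a disc of radius `r` is controlled by the mean of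
its square over the concentric square of side `4 r`. -/
lemma enorm_sq_mul_le_lintegral_square {g : ℂ → ℂ} {c z : ℂ} {r : ℝ} (hr : 0 < r)
    (hg : DifferentiableOn ℂ g {w | w.re ∈ Set.Ioo (c.re - 2 * r) (c.re + 2 * r)})
    (hz : z ∈ Metric.closedBall c r) :
    ENNReal.ofReal (Real.pi * r ^ 2) * ‖g z‖ₑ ^ 2 ≤
      ∫⁻ x in Set.Ioo (c.re - 2 * r) (c.re + 2 * r),
        ∫⁻ y in Set.Ioo (c.im - 2 * r) (c.im + 2 * r), ‖g (x + y * Complex.I)‖ₑ ^ 2 := by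
  set X := Set.Ioo (c.re - 2 * r) (c.re + 2 * r)
  set Y := Set.Ioo (c.im - 2 * r) (c.im + 2 * r)
  have hsub : Metric.ball z r ⊆ X ×ℂ Y := by
    intro w hw
    have hd : ‖w - c‖ < 2 * r := by
      rw [Metric.mem_ball, dist_eq_norm] at hw
      rw [Metric.mem_closedBall, dist_eq_norm] at hz
      calc ‖w - c‖ = ‖(w - z) + (z - c)‖ := by ring_nf
        _ ≤ ‖w - z‖ + ‖z - c‖ := norm_add_le _ _
        _ < 2 * r := by linarith
    have h1 := (Complex.abs_re_le_norm (w - c)).trans_lt hd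
    have h2 := (Complex.abs_im_le_norm (w - c)).trans_lt hd
    rw [abs_lt, Complex.sub_re] at h1
    rw [abs_lt, Complex.sub_im] at h2
    exact ⟨⟨by linarith, by linarith⟩, ⟨by linarith, by linarith⟩⟩
  have hXo : IsOpen {w : ℂ | w.re ∈ X} := isOpen_Ioo.preimage Complex.continuous_re
  have hm : MeasurableSet (X ×ℂ Y) :=
    (measurableSet_Ioo.preimage Complex.measurable_re).inter
      (measurableSet_Ioo.preimage Complex.measurable_im)
  -- The area mean inequality is applied to the holomorphic function `g ^ 2`, which gives mean
  -- squares without Cauchy–Schwarz.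
  have h1 := enorm_mul_le_lintegral_ball hr (g := fun w => g w ^ 2) (z := z)
    ((hg.mono fun w hw => (hsub hw).1).pow 2)
  simp only [enorm_pow] at h1
  refine h1.trans ((lintegral_mono_set hsub).trans (le_of_eq ?_))
  have hpre : X ×ℂ Y = Complex.measurableEquivRealProd ⁻¹' (X ×ˢ Y) := by
    ext w; simp [Complex.mem_reProdIm, Complex.measurableEquivRealProd]
  have h2 := (Complex.volume_preserving_equiv_real_prod.symm).setLIntegral_comp_preimage_emb
    (Complex.measurableEquivRealProd.symm.measurableEmbedding) (fun w => ‖g w‖ₑ ^ 2) (X ×ℂ Y)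
  rw [← h2, hpre]
  have h3 : ⇑Complex.measurableEquivRealProd.symm ⁻¹' (⇑Complex.measurableEquivRealProd ⁻¹' X ×ˢ Y)
      = X ×ˢ Y := by
    ext p; simp
  rw [h3, Measure.volume_eq_prod, ← Measure.prod_restrict]
  have h4 : ∀ p : ℝ × ℝ, Complex.measurableEquivRealProd.symm p = p.1 + p.2 * Complex.I := by
    intro p
    rw [Complex.measurableEquivRealProd_symm_apply]
    apply Complex.ext <;> simp
  simp only [h4]
  rw [lintegral_prod]
  have hc : ContinuousOn (fun p : ℝ × ℝ => ‖g (p.1 + p.2 * Complex.I)‖ₑ ^ 2) (X ×ˢ Y) := by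
    refine (ENNReal.continuous_pow 2).comp_continuousOn (continuous_enorm.comp_continuousOn
      (hg.continuousOn.comp (by fun_prop) fun p hp => ?_))
    simpa using hp.1
  rw [Measure.prod_restrict]
  exact hc.aemeasurable (measurableSet_Ioo.prod measurableSet_Ioo)

/-! ### Convexity of mean squares on vertical lines -/

lemma norm_intervalIntegral_mul_le {f g : ℝ → ℂ} {A B : ℝ} (hAB : A ≤ B)
    (hf : Continuous f) (hg : Continuous g) :
    ‖∫ t in A..B, f t * g t‖ ≤ √(∫ t in A..B, ‖f t‖ ^ 2) * √(∫ t in A..B, ‖g t‖ ^ 2) := by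
  have key : ∀ {f : ℝ → ℂ}, Continuous f → MemLp f (ENNReal.ofReal 2)
      (volume.restrict (Set.Ioc A B)) := fun {f} hf => by
    rw [show ENNReal.ofReal 2 = 2 by norm_num]
    rw [memLp_two_iff_integrable_sq_norm hf.aestronglyMeasurable]
    exact ((by fun_prop : Continuous fun t => ‖f t‖ ^ 2).integrableOn_Icc (a := A) (b := B)).mono_set
      Set.Ioc_subset_Icc_self
  have h := integral_mul_norm_le_Lp_mul_Lq (Real.HolderConjugate.two_two) (key hf) (key hg)
  rw [Real.sqrt_eq_rpow, Real.sqrt_eq_rpow, intervalIntegral.integral_of_le hAB,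
    intervalIntegral.integral_of_le hAB, intervalIntegral.integral_of_le hAB]
  simp only [Real.rpow_two] at h
  refine le_trans ?_ h
  refine (norm_integral_le_integral_norm _).trans (le_of_eq ?_)
  simp only [norm_mul]

/-- A Gaussian absorbs any polynomial: `(1 + |y|) ^ m ≤ m! exp (1 + |y|)` and `1 + |y| - y² ≤ 2`.
The dependence on `c` is kept explicit because `c` will contain the endpoints of the interval of
integration. -/
lemma exp_neg_sq_mul_pow_le (m : ℕ) (c y : ℝ) (hc : 1 ≤ c) :
    Real.exp (-y ^ 2) * (c + |y|) ^ m ≤ c ^ m * (m.factorial * Real.exp 2) := by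
  have h1 : (c + |y|) ^ m ≤ c ^ m * (1 + |y|) ^ m := by
    rw [← mul_pow]
    gcongr
    nlinarith [abs_nonneg y]
  have h2 : (1 + |y|) ^ m ≤ m.factorial * Real.exp (1 + |y|) := by
    have := Real.pow_div_factorial_le_exp (1 + |y|) (by positivity) m
    rwa [div_le_iff₀' (by positivity)] at this
  have h3 : Real.exp (-y ^ 2) * Real.exp (1 + |y|) ≤ Real.exp 2 := by
    rw [← Real.exp_add]
    gcongr
    rw [← sq_abs]
    nlinarith [sq_nonneg (|y| - 1 / 2)]
  calc Real.exp (-y ^ 2) * (c + |y|) ^ m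
      ≤ Real.exp (-y ^ 2) * (c ^ m * (m.factorial * Real.exp (1 + |y|))) := by
        gcongr; exact h1.trans (by gcongr)
    _ = c ^ m * (m.factorial * (Real.exp (-y ^ 2) * Real.exp (1 + |y|))) := by ring
    _ ≤ _ := by gcongr

lemma norm_exp_sq (w : ℂ) : ‖Complex.exp (w ^ 2)‖ = Real.exp (w.re ^ 2 - w.im ^ 2) := by
  rw [Complex.norm_exp]
  congr 1
  simp [sq]

lemma diffContOnCl_verticalStrip_integral {F : ℂ → ℂ} {l b : ℝ}
    (hF : ∀ s : ℂ, l ≤ s.re → DifferentiableAt ℂ F s) {ψ : ℝ → ℂ} (hψ : Continuous ψ) (A B : ℝ) :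
    DiffContOnCl ℂ (fun w : ℂ => ∫ t in A..B, F (w + t * Complex.I) * ψ t)
      (Complex.HadamardThreeLines.verticalStrip l b) := by
  have hFc : ContinuousOn F {s | l ≤ s.re} := fun s hs => (hF s hs).continuousAt.continuousWithinAt
  have hopen : IsOpen {s : ℂ | l < s.re} := isOpen_lt continuous_const Complex.continuous_re
  have hFd : DifferentiableOn ℂ F {s | l < s.re} := fun s hs =>
    (hF s (le_of_lt hs)).differentiableWithinAt
  have hF'c : ContinuousOn (deriv F) {s | l < s.re} := (hFd.deriv hopen).continuousOn
  refine ⟨fun w hw => DifferentiableAt.differentiableWithinAt ?_, ?_⟩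
  · have hw : l < w.re := hw.1
    set ρ := (w.re - l) / 2 with hρ
    have hρ0 : 0 < ρ := by rw [hρ]; linarith
    have hball : ∀ x ∈ Metric.closedBall w ρ, ∀ t : ℝ, l < (x + t * Complex.I).re := by
      intro x hx t
      have := (Complex.abs_re_le_norm (x - w)).trans
        (show ‖x - w‖ ≤ ρ by rw [← dist_eq_norm]; exact hx)
      rw [abs_le, Complex.sub_re] at this
      simp
      linarith [this.1]
    -- Differentiation under the integral sign needs a dominating function; a constant works, since
    -- the derivative is continuous on this compact set inside the open half-plane.
    have hcompact : IsCompact (Metric.closedBall w ρ ×ˢ Set.uIcc A B) :=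
      (isCompact_closedBall _ _).prod isCompact_uIcc
    have hcont : ContinuousOn (fun p : ℂ × ℝ => deriv F (p.1 + p.2 * Complex.I) * ψ p.2)
        (Metric.closedBall w ρ ×ˢ Set.uIcc A B) := by
      refine ContinuousOn.mul (hF'c.comp (by fun_prop) fun p hp => hball _ hp.1 _) ?_
      exact (hψ.comp continuous_snd).continuousOn
    obtain ⟨C, hC⟩ := hcompact.exists_bound_of_continuousOn hcont
    have hline : ∀ x ∈ Metric.closedBall w ρ, Continuous fun t : ℝ => F (x + t * Complex.I) * ψ t :=
      fun x hx => by
        refine Continuous.mul ?_ hψ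
        rw [← continuousOn_univ]
        exact hFc.comp (by fun_prop) fun t _ => (hball x hx t).le
    have hmem : Metric.ball w ρ ∈ 𝓝 w := Metric.ball_mem_nhds _ hρ0
    have hw0 : w ∈ Metric.closedBall w ρ := Metric.mem_closedBall_self hρ0.le
    refine (intervalIntegral.hasDerivAt_integral_of_dominated_loc_of_deriv_le
      (F' := fun x t => deriv F (x + t * Complex.I) * ψ t) (bound := fun _ => C) hmem ?_ ?_ ?_ ?_ ?_
      ?_).2.differentiableAt
    · filter_upwards [hmem] with x hx
      exact (hline x (Metric.ball_subset_closedBall hx)).aestronglyMeasurable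
    · exact (hline w hw0).intervalIntegrable _ _
    · refine Continuous.aestronglyMeasurable ?_
      refine Continuous.mul ?_ hψ
      rw [← continuousOn_univ]
      exact hF'c.comp (by fun_prop) fun t _ => hball w hw0 t
    · refine Eventually.of_forall fun t ht x hx => ?_
      exact hC (x, t) ⟨Metric.ball_subset_closedBall hx, Set.uIoc_subset_uIcc ht⟩
    · simp
    · refine Eventually.of_forall fun t _ x hx => ?_
      have h1 := (hF (x + t * Complex.I) (hball x (Metric.ball_subset_closedBall hx) t).le).hasDerivAt
      exact (h1.comp_add_const x (t * Complex.I)).mul_const _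
  · -- continuity up to the boundary, by a retraction onto the closed half-plane
    have hcl : closure (Complex.HadamardThreeLines.verticalStrip l b) ⊆ {s | l ≤ s.re} := by
      refine closure_minimal (fun s hs => ?_) (isClosed_le continuous_const Complex.continuous_re)
      exact hs.1.le
    let ret : ℂ → ℂ := fun s => (max s.re l : ℝ) + s.im * Complex.I
    have hretc : Continuous ret := by fun_prop
    have hret : ∀ s, l ≤ (ret s).re := fun s => by simp [ret]
    have hret' : ∀ s : ℂ, l ≤ s.re → ret s = s := fun s hs => by
      simp only [ret, max_eq_left hs, Complex.re_add_im]
    have hFr : Continuous fun s => F (ret s) := by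
      rw [← continuousOn_univ]
      exact hFc.comp hretc.continuousOn fun s _ => hret s
    have hc : Continuous fun w : ℂ => ∫ t in A..B, F (ret (w + t * Complex.I)) * ψ t := by
      refine intervalIntegral.continuous_parametric_intervalIntegral_of_continuous' ?_ A B
      exact (hFr.comp (by fun_prop : Continuous fun p : ℂ × ℝ => p.1 + p.2 * Complex.I)).mul
        (hψ.comp continuous_snd)
    refine hc.continuousOn.congr fun w hw => ?_
    refine intervalIntegral.integral_congr fun t _ => ?_
    rw [hret']
    simpa using hcl hw

/-- **Convexity of mean squares.** A three lines theorem for mean squares of a holomorphic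
function of polynomial growth over segments of vertical lines. -/
theorem integral_norm_sq_le_interp {F : ℂ → ℂ} {l b : ℝ} (hlb : l < b)
    (hF : ∀ s : ℂ, l ≤ s.re → DifferentiableAt ℂ F s) {M : ℝ} {m : ℕ}
    (hgrow : ∀ s : ℂ, l ≤ s.re → s.re ≤ b → ‖F s‖ ≤ M * (1 + |s.im|) ^ m)
    {A B : ℝ} (hAB : A ≤ B) {E₀ E₁ : ℝ}
    (h0 : ∀ y : ℝ, ∫ t in A..B, ‖F (l + (t + y : ℝ) * Complex.I)‖ ^ 2 ≤ E₀ * Real.exp (2 * y ^ 2))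
    (h1 : ∀ y : ℝ, ∫ t in A..B, ‖F (b + (t + y : ℝ) * Complex.I)‖ ^ 2 ≤ E₁ * Real.exp (2 * y ^ 2))
    {σ : ℝ} (hσ : σ ∈ Set.Icc l b) :
    ∫ t in A..B, ‖F (σ + t * Complex.I)‖ ^ 2 ≤
      Real.exp (2 * (l ^ 2 + b ^ 2)) *
        (E₀ ^ (1 - (σ - l) / (b - l)) * E₁ ^ ((σ - l) / (b - l))) := by
  set θ := (σ - l) / (b - l) with hθ
  set D := l ^ 2 + b ^ 2 with hD
  have hFc : ContinuousOn F {s | l ≤ s.re} := fun s hs => (hF s hs).continuousAt.continuousWithinAt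
  have hline : ∀ x y : ℝ, l ≤ x → Continuous fun t : ℝ => F (x + (t + y : ℝ) * Complex.I) :=
    fun x y hx => by
      rw [← continuousOn_univ]
      exact hFc.comp (by fun_prop) fun t _ => by simpa using hx
  have hline0 : ∀ x : ℝ, l ≤ x → Continuous fun t : ℝ => F (x + t * Complex.I) := fun x hx => by
    simpa using hline x 0 hx
  set I := ∫ t in A..B, ‖F (σ + t * Complex.I)‖ ^ 2 with hI
  have hI0 : 0 ≤ I := intervalIntegral.integral_nonneg hAB fun t _ => by positivity
  have hE₀ : 0 ≤ E₀ := by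
    have := h0 0
    simp only [add_zero, ne_eq, OfNat.ofNat_ne_zero, not_false_eq_true, zero_pow, mul_zero,
      Real.exp_zero, mul_one] at this
    exact (intervalIntegral.integral_nonneg hAB fun t _ => by positivity).trans this
  have hE₁ : 0 ≤ E₁ := by
    have := h1 0
    simp only [add_zero, ne_eq, OfNat.ofNat_ne_zero, not_false_eq_true, zero_pow, mul_zero,
      Real.exp_zero, mul_one] at this
    exact (intervalIntegral.integral_nonneg hAB fun t _ => by positivity).trans this
  -- The mean square is linearised by duality: pairing `F (w + it)` with this fixed `ψ` is
  -- holomorphic in `w` and equals the mean square `I` at `w = σ`. The factor `exp (w ^ 2)` provides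
  -- decay in the imaginary direction.
  set ψ : ℝ → ℂ := fun t => (starRingEnd ℂ) (F (σ + t * Complex.I)) with hψ
  have hψc : Continuous ψ := Complex.continuous_conj.comp (hline0 σ hσ.1)
  have hψI : ∫ t in A..B, ‖ψ t‖ ^ 2 = I := by
    simp only [hψ, RCLike.norm_conj, hI]
  set g : ℂ → ℂ := fun w => Complex.exp (w ^ 2) * ∫ t in A..B, F (w + t * Complex.I) * ψ t with hg
  have hgd : DiffContOnCl ℂ g (Complex.HadamardThreeLines.verticalStrip l b) := by
    have h2 : Differentiable ℂ fun w : ℂ => Complex.exp (w ^ 2) := by fun_prop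
    exact h2.diffContOnCl.smul (diffContOnCl_verticalStrip_integral hF hψc A B)
  have hgσ : ‖g σ‖ = Real.exp (σ ^ 2) * I := by
    rw [hg]
    simp only
    rw [norm_mul, norm_exp_sq]
    have : ∫ t in A..B, F (σ + t * Complex.I) * ψ t = (I : ℂ) := by
      rw [hI, ← intervalIntegral.integral_ofReal]
      refine intervalIntegral.integral_congr fun t _ => ?_
      simp only [hψ]
      rw [Complex.mul_conj']
      push_cast
      rfl
    rw [this, Complex.norm_real, Real.norm_of_nonneg hI0]
    simp
  -- By Cauchy–Schwarz the pairing on an edge is at most `√E exp (y²) √I` at height `y`. The factor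
  -- `exp (-y²)` from the Gaussian cancels exactly the growth that `h0` and `h1` allow.
  have hedge : ∀ (x : ℝ) (E : ℝ), 0 ≤ E → l ≤ x → x ^ 2 ≤ D →
      (∀ y : ℝ, ∫ t in A..B, ‖F (x + (t + y : ℝ) * Complex.I)‖ ^ 2 ≤ E * Real.exp (2 * y ^ 2)) →
      ∀ z ∈ Complex.re ⁻¹' {x}, ‖g z‖ ≤ (Real.exp D * √I) * √E := by
    intro x E hE hlx hxD hx z hz
    have hzre : z.re = x := hz
    have h2 : ∀ t : ℝ, z + t * Complex.I = x + (t + z.im : ℝ) * Complex.I := fun t => by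
      apply Complex.ext <;> simp [hzre, add_comm]
    simp only [hg, norm_mul, norm_exp_sq, h2]
    have h3 := norm_intervalIntegral_mul_le hAB (hline x z.im hlx) hψc
    rw [hψI] at h3
    have h4 : √(∫ t in A..B, ‖F (x + (t + z.im : ℝ) * Complex.I)‖ ^ 2) ≤
        √E * Real.exp (z.im ^ 2) := by
      refine (Real.sqrt_le_sqrt (hx z.im)).trans (le_of_eq ?_)
      rw [Real.sqrt_mul hE, Real.sqrt_eq_rpow (Real.exp _), ← Real.exp_mul]
      ring_nf
    rw [hzre]
    calc _ ≤ Real.exp (x ^ 2 - z.im ^ 2) * ((√E * Real.exp (z.im ^ 2)) * √I) := by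
          gcongr; exact h3.trans (by gcongr)
      _ = (Real.exp (x ^ 2 - z.im ^ 2) * Real.exp (z.im ^ 2)) * √I * √E := by ring
      _ = Real.exp (x ^ 2) * √I * √E := by rw [← Real.exp_add]; ring_nf
      _ ≤ _ := by gcongr
  -- The three lines theorem needs an a priori bound in the strip. It is only qualitative: the
  -- constants of the polynomial growth do not enter the conclusion.
  have hB : BddAbove ((norm ∘ g) '' Complex.HadamardThreeLines.verticalClosedStrip l b) := by
    have hM : 0 ≤ M := by
      have := (norm_nonneg _).trans (hgrow l (by simp) (by simpa using hlb.le))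
      simpa using this
    set T' := 1 + |A| + |B| with hT'
    have hT'1 : 1 ≤ T' := by rw [hT']; linarith [abs_nonneg A, abs_nonneg B]
    refine ⟨Real.exp D * (M * (T' ^ m * (m.factorial * Real.exp 2)) * ∫ t in A..B, ‖ψ t‖), ?_⟩
    rintro _ ⟨z, hz, rfl⟩
    simp only [Function.comp_apply, hg, norm_mul, norm_exp_sq]
    have h2 : ‖∫ t in A..B, F (z + t * Complex.I) * ψ t‖ ≤
        M * (T' + |z.im|) ^ m * ∫ t in A..B, ‖ψ t‖ := by
      rw [← intervalIntegral.integral_const_mul]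
      refine intervalIntegral.norm_integral_le_of_norm_le hAB ?_ ?_
      · refine Eventually.of_forall fun t ht => ?_
        rw [norm_mul]
        gcongr
        refine (hgrow _ (by simpa using hz.1) (by simpa using hz.2)).trans
          (mul_le_mul_of_nonneg_left (pow_le_pow_left₀ (by positivity) ?_ m) hM)
        simp only [Complex.add_im, Complex.mul_im, Complex.ofReal_re, Complex.I_im, mul_one,
          Complex.ofReal_im, Complex.I_re, mul_zero, add_zero]
        have h5 : |t| ≤ |A| + |B| := by
          rw [abs_le]
          constructor
          · linarith [neg_abs_le A, abs_nonneg B, ht.1]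
          · linarith [le_abs_self B, abs_nonneg A, ht.2]
        linarith [abs_add_le z.im t]
      · exact ((hψc.norm).const_mul _ |>.intervalIntegrable _ _)
    have h3 := exp_neg_sq_mul_pow_le m T' z.im hT'1
    have h4 : z.re ^ 2 ≤ D := by
      have ha := hz.1; have hb := hz.2
      rw [hD]
      rcases le_or_gt 0 z.re with h | h
      · nlinarith [sq_nonneg l]
      · nlinarith [sq_nonneg b]
    have hψ0 : 0 ≤ ∫ t in A..B, ‖ψ t‖ := intervalIntegral.integral_nonneg hAB fun t _ => by positivity
    calc _ ≤ Real.exp (z.re ^ 2 - z.im ^ 2) * (M * (T' + |z.im|) ^ m * ∫ t in A..B, ‖ψ t‖) := by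
          gcongr
      _ = Real.exp (z.re ^ 2) * (M * (Real.exp (-z.im ^ 2) * (T' + |z.im|) ^ m) *
            ∫ t in A..B, ‖ψ t‖) := by
          rw [sub_eq_add_neg, Real.exp_add]; ring
      _ ≤ _ := by gcongr
  have h3l := Complex.HadamardThreeLines.norm_le_interp_of_mem_verticalClosedStrip' hlb
    (z := (σ : ℂ)) (by exact hσ) hgd hB
    (hedge l E₀ hE₀ le_rfl (by rw [hD]; nlinarith [sq_nonneg b]) h0)
    (hedge b E₁ hE₁ hlb.le (by rw [hD]; nlinarith [sq_nonneg l]) h1)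
  rw [hgσ, Complex.ofReal_re, ← hθ] at h3l
  have hθ0 : 0 ≤ θ := div_nonneg (by linarith [hσ.1]) (by linarith)
  have hθ1 : θ ≤ 1 := by rw [hθ, div_le_one (by linarith)]; linarith [hσ.2]
  rcases hI0.eq_or_lt with hI00 | hIpos
  · rw [← hI00]; positivity
  set X := Real.exp D * √I
  have hX : 0 < X := by positivity
  rw [Real.mul_rpow hX.le (by positivity), Real.mul_rpow hX.le (by positivity)] at h3l
  have h5 : X ^ (1 - θ) * √E₀ ^ (1 - θ) * (X ^ θ * √E₁ ^ θ) =
      X * (√E₀ ^ (1 - θ) * √E₁ ^ θ) := by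
    have : X ^ (1 - θ) * X ^ θ = X := by
      rw [← Real.rpow_add hX]; simp
    calc _ = (X ^ (1 - θ) * X ^ θ) * (√E₀ ^ (1 - θ) * √E₁ ^ θ) := by ring
      _ = _ := by rw [this]
  rw [h5] at h3l
  -- The edge bounds contain `√I`, so the interpolated inequality bounds `I` by a multiple of `√I`,
  -- and one factor can be divided out.
  have h6 : √I ≤ Real.exp D * (√E₀ ^ (1 - θ) * √E₁ ^ θ) := by
    have h7 : I ≤ Real.exp (σ ^ 2) * I := by
      have := Real.one_le_exp (sq_nonneg σ)
      nlinarith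
    have h8 : √I * √I ≤ √I * (Real.exp D * (√E₀ ^ (1 - θ) * √E₁ ^ θ)) := by
      rw [Real.mul_self_sqrt hI0]
      refine (h7.trans h3l).trans (le_of_eq ?_)
      simp only [X]; ring
    exact le_of_mul_le_mul_left h8 (Real.sqrt_pos.mpr hIpos)
  have h9 : ∀ (E η : ℝ), 0 ≤ E → (√E ^ η) ^ 2 = E ^ η := fun E η hE => by
    rw [← Real.rpow_natCast, ← Real.rpow_mul (Real.sqrt_nonneg _), mul_comm η,
      Real.rpow_mul (Real.sqrt_nonneg _), Real.rpow_natCast, Real.sq_sqrt hE]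
  calc I = √I ^ 2 := (Real.sq_sqrt hI0).symm
    _ ≤ (Real.exp D * (√E₀ ^ (1 - θ) * √E₁ ^ θ)) ^ 2 := by gcongr
    _ = Real.exp D ^ 2 * ((√E₀ ^ (1 - θ)) ^ 2 * (√E₁ ^ θ) ^ 2) := by ring
    _ = _ := by rw [h9 _ _ hE₀, h9 _ _ hE₁, ← Real.exp_nat_mul]; norm_num

/-! ### Approximation of a continued Dirichlet series by its partial sums, in mean square -/

/-- The partial sum `∑_{k < n} a_k (k + β)^{-s}` of a Dirichlet series. -/
def dirichletSum (a : ℕ → ℂ) (β : ℝ) (n : ℕ) (s : ℂ) : ℂ :=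
  ∑ k ∈ Finset.range n, a k / ((k + β : ℝ) : ℂ) ^ s

lemma norm_div_ofReal_cpow (x : ℂ) {y : ℝ} (hy : 0 < y) (s : ℂ) :
    ‖x / (y : ℂ) ^ s‖ = ‖x‖ * y ^ (-s.re) := by
  rw [norm_div, Complex.norm_cpow_eq_rpow_re_of_pos hy, Real.rpow_neg hy.le, div_eq_mul_inv]

lemma differentiable_dirichletSum (a : ℕ → ℂ) {β : ℝ} (hβ : 0 < β) (n : ℕ) :
    Differentiable ℂ (dirichletSum a β n) := by
  unfold dirichletSum
  refine Differentiable.fun_sum fun k _ => ?_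
  have hk : ((k + β : ℝ) : ℂ) ≠ 0 := by
    have : (0 : ℝ) < k + β := by positivity
    exact_mod_cast this.ne'
  refine Differentiable.div (differentiable_const _) ?_ fun s => ?_
  · exact differentiable_id.const_cpow (Or.inl hk)
  · simp only [ne_eq, Complex.cpow_eq_zero_iff, hk, false_and, not_false_eq_true]

lemma shift_rpow_neg_le {β : ℝ} (hβ : 0 < β) (hβ1 : β ≤ 1) {x : ℝ} (hx : 0 ≤ x) (k : ℕ) :
    (k + β : ℝ) ^ (-x) ≤ β ^ (-x) * (k + 1 : ℝ) ^ (-x) := by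
  rw [← Real.mul_rpow hβ.le (by positivity)]
  refine Real.rpow_le_rpow_of_nonpos (by positivity) ?_ (by linarith)
  have : (0 : ℝ) ≤ k := by positivity
  nlinarith

lemma summable_nat_add_one_rpow {x : ℝ} (hx : 1 < x) :
    Summable fun k : ℕ => (k + 1 : ℝ) ^ (-x) := by
  have := (summable_nat_add_iff 1).mpr (Real.summable_nat_rpow.mpr (by linarith : -x < -1))
  refine this.congr fun k => ?_
  push_cast
  rfl

/-- A Dirichlet series `∑ a_k (k + β)^{-s}` with a meromorphic continuation `f` to `Re s ≥ l`,
of polynomial growth and bounded mean square on the line `Re s = l`, whose poles are cancelled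
by the bounded factor `R`. -/
structure DirichletContinuation (f : ℂ → ℂ) (a : ℕ → ℂ) (β l : ℝ) (R : ℂ → ℂ) : Prop where
  β_pos : 0 < β
  β_le : β ≤ 1
  half_le : 1 / 2 ≤ l
  lt_one : l < 1
  coeff_le : ∀ ε : ℝ, 0 < ε → ∃ C : ℝ, ∀ k : ℕ, ‖a k‖ ≤ C * (k + 1 : ℝ) ^ ε
  hasSum : ∀ s : ℂ, 1 < s.re → HasSum (fun k : ℕ => a k / ((k + β : ℝ) : ℂ) ^ s) (f s)
  factor_diff : ∀ s : ℂ, l ≤ s.re → DifferentiableAt ℂ R s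
  factor_le : ∃ C : ℝ, ∀ s : ℂ, l ≤ s.re → ‖R s‖ ≤ C
  diff : ∀ s : ℂ, l ≤ s.re → DifferentiableAt ℂ (fun s => R s * f s) s
  growth : ∀ b : ℝ, ∃ (M : ℝ) (m : ℕ), ∀ s : ℂ, l ≤ s.re → s.re ≤ b →
    ‖R s * f s‖ ≤ M * (1 + |s.im|) ^ m
  mean_sq : ∃ C : ℝ, ∀ T : ℝ, 1 ≤ T →
    ∫ t in (0 : ℝ)..T, ‖R (l + t * Complex.I) * f (l + t * Complex.I)‖ ^ 2 ≤ C * T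

/-! ### Tails to the right of `Re s = 1` and mean squares of coefficients. -/

namespace DirichletContinuation

variable {f : ℂ → ℂ} {a : ℕ → ℂ} {β l : ℝ} {R : ℂ → ℂ}

/-- With `κ = (b - 1) / 3` and coefficients `O(k ^ κ)` the terms are `O(k ^ (κ - b))`, and `κ - b =
-κ - (1 + κ)`. Beyond `n` the first summand of this exponent gives `n ^ (-κ)` and the second leaves
a convergent series. -/
lemma exists_norm_sub_dirichletSum_le (h : DirichletContinuation f a β l R) {b : ℝ} (hb : 1 < b) :
    ∃ C κ : ℝ, 0 ≤ C ∧ 0 < κ ∧ ∀ n : ℕ, 1 ≤ n → ∀ s : ℂ, s.re = b →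
      ‖f s - dirichletSum a β n s‖ ≤ C * (n : ℝ) ^ (-κ) := by
  set κ := (b - 1) / 3 with hκ
  have hκ0 : 0 < κ := by rw [hκ]; linarith
  obtain ⟨C, hC⟩ := h.coeff_le κ hκ0
  have hC0 : 0 ≤ C := by have := (norm_nonneg _).trans (hC 0); simpa using this
  have hZ := summable_nat_add_one_rpow (x := 1 + κ) (by linarith)
  set Z := ∑' k : ℕ, (k + 1 : ℝ) ^ (-(1 + κ)) with hZdef
  have hβb : (0 : ℝ) ≤ β ^ (-b) := Real.rpow_nonneg h.β_pos.le _
  refine ⟨C * β ^ (-b) * Z, κ, ?_, hκ0, fun n hn s hs => ?_⟩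
  · have : 0 ≤ Z := tsum_nonneg fun k => by positivity
    positivity
  have hterm : ∀ k : ℕ, ‖a (k + n) / (((k + n : ℕ) + β : ℝ) : ℂ) ^ s‖ ≤
      C * β ^ (-b) * (n : ℝ) ^ (-κ) * (k + 1 : ℝ) ^ (-(1 + κ)) := by
    intro k
    have hpos : (0 : ℝ) < ((k + n : ℕ) : ℝ) + β := by have := h.β_pos; positivity
    rw [norm_div_ofReal_cpow _ hpos, hs]
    have h1 := hC (k + n)
    have h2 := shift_rpow_neg_le h.β_pos h.β_le (x := b) (by linarith) (k + n)
    have hx : (0 : ℝ) < ((k + n : ℕ) : ℝ) + 1 := by positivity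
    have hn0 : (0 : ℝ) < n := by exact_mod_cast hn
    have h3 : (((k + n : ℕ) : ℝ) + 1) ^ κ * (((k + n : ℕ) : ℝ) + 1) ^ (-b) ≤
        (n : ℝ) ^ (-κ) * (k + 1 : ℝ) ^ (-(1 + κ)) := by
      rw [← Real.rpow_add hx]
      have : κ + -b = -κ + -(1 + κ) := by rw [hκ]; ring
      rw [this, Real.rpow_add hx]
      refine mul_le_mul ?_ ?_ (by positivity) (by positivity)
      · exact Real.rpow_le_rpow_of_nonpos hn0 (by push_cast; linarith) (by linarith)
      · exact Real.rpow_le_rpow_of_nonpos (by positivity) (by push_cast; linarith) (by linarith)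
    calc _ ≤ (C * (((k + n : ℕ) : ℝ) + 1) ^ κ) * (β ^ (-b) * (((k + n : ℕ) : ℝ) + 1) ^ (-b)) := by
          gcongr
      _ = C * β ^ (-b) * ((((k + n : ℕ) : ℝ) + 1) ^ κ * (((k + n : ℕ) : ℝ) + 1) ^ (-b)) := by ring
      _ ≤ C * β ^ (-b) * ((n : ℝ) ^ (-κ) * (k + 1 : ℝ) ^ (-(1 + κ))) := by gcongr
      _ = _ := by ring
  have hsum := h.hasSum s (by rw [hs]; exact hb)
  have htail := (hasSum_nat_add_iff' n).mpr hsum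
  have hbd := (hZ.hasSum).mul_left (C * β ^ (-b) * (n : ℝ) ^ (-κ))
  have := htail.norm_le_of_bounded hbd hterm
  refine this.trans (le_of_eq ?_)
  ring

/-- Coefficients `O(k ^ δ)` and `x ≥ 1/2` make the terms `O(k ^ (2δ - 1))`, and for `ε = 4δ` this is
`k ^ ε` times the general term of a convergent series. The case `x = 1/2` is allowed, whence the
loss of `n ^ ε`. -/
lemma exists_sum_norm_sq_le (h : DirichletContinuation f a β l R) {x : ℝ} (hx : l ≤ x) {ε : ℝ}
    (hε : 0 < ε) :
    ∃ C : ℝ, 0 ≤ C ∧ ∀ n : ℕ, 1 ≤ n →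
      ∑ k ∈ Finset.range n, (‖a k‖ * (k + β : ℝ) ^ (-x)) ^ 2 ≤ C * (n : ℝ) ^ ε := by
  set δ := ε / 4 with hδ
  have hδ0 : 0 < δ := by rw [hδ]; linarith
  have hx2 : 1 / 2 ≤ x := h.half_le.trans hx
  obtain ⟨C, hC⟩ := h.coeff_le δ hδ0
  have hC0 : 0 ≤ C := by have := (norm_nonneg _).trans (hC 0); simpa using this
  have hZ := summable_nat_add_one_rpow (x := 1 + 2 * δ) (by linarith)
  set Z := ∑' k : ℕ, (k + 1 : ℝ) ^ (-(1 + 2 * δ)) with hZdef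
  have hβb : (0 : ℝ) ≤ β ^ (-x) := Real.rpow_nonneg h.β_pos.le _
  have hZ0 : 0 ≤ Z := tsum_nonneg fun k => by positivity
  refine ⟨(C * β ^ (-x)) ^ 2 * Z, by positivity, fun n hn => ?_⟩
  have hterm : ∀ k ∈ Finset.range n, (‖a k‖ * (k + β : ℝ) ^ (-x)) ^ 2 ≤
      (C * β ^ (-x)) ^ 2 * (n : ℝ) ^ ε * (k + 1 : ℝ) ^ (-(1 + 2 * δ)) := by
    intro k hk
    have hkn : (k : ℝ) + 1 ≤ n := by exact_mod_cast Finset.mem_range.mp hk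
    have hk0 : (0 : ℝ) < k + 1 := by positivity
    have hkβ : (0 : ℝ) < k + β := by have := h.β_pos; positivity
    have h2 := shift_rpow_neg_le h.β_pos h.β_le (x := x) (by linarith) k
    have h3 : ((k + 1 : ℝ) ^ δ * (k + 1 : ℝ) ^ (-x)) ^ 2 ≤
        (n : ℝ) ^ ε * (k + 1 : ℝ) ^ (-(1 + 2 * δ)) := by
      rw [← Real.rpow_add hk0, ← Real.rpow_natCast, ← Real.rpow_mul hk0.le]
      calc (k + 1 : ℝ) ^ ((δ + -x) * (2 : ℕ)) ≤ (k + 1 : ℝ) ^ (ε + -(1 + 2 * δ)) := by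
            refine Real.rpow_le_rpow_of_exponent_le (by linarith [(Nat.cast_nonneg k : (0:ℝ) ≤ k)]) ?_
            push_cast; rw [hδ]; linarith
        _ = (k + 1 : ℝ) ^ ε * (k + 1 : ℝ) ^ (-(1 + 2 * δ)) := Real.rpow_add hk0 _ _
        _ ≤ _ := by gcongr
    calc _ ≤ ((C * (k + 1 : ℝ) ^ δ) * (β ^ (-x) * (k + 1 : ℝ) ^ (-x))) ^ 2 := by
          gcongr; exact hC k
      _ = (C * β ^ (-x)) ^ 2 * ((k + 1 : ℝ) ^ δ * (k + 1 : ℝ) ^ (-x)) ^ 2 := by ring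
      _ ≤ (C * β ^ (-x)) ^ 2 * ((n : ℝ) ^ ε * (k + 1 : ℝ) ^ (-(1 + 2 * δ))) := by gcongr
      _ = _ := by ring
  refine (Finset.sum_le_sum hterm).trans ?_
  rw [← Finset.mul_sum]
  calc _ ≤ (C * β ^ (-x)) ^ 2 * (n : ℝ) ^ ε * Z := by
        gcongr
        exact hZ.sum_le_tsum _ fun k _ => by positivity
    _ = _ := by ring

end DirichletContinuation

lemma dirichletSum_eq_sum_exp (a : ℕ → ℂ) {β : ℝ} (hβ : 0 < β) (n : ℕ) (x t : ℝ) :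
    dirichletSum a β n (x + t * Complex.I) = ∑ k ∈ Finset.range n,
      (a k / ((k + β : ℝ) : ℂ) ^ (x : ℂ)) *
        Complex.exp ((-Real.log (k + β) : ℝ) * Complex.I * t) := by
  refine Finset.sum_congr rfl fun k _ => ?_
  have hk : (0 : ℝ) < k + β := by positivity
  have hk0 : ((k + β : ℝ) : ℂ) ≠ 0 := by exact_mod_cast hk.ne'
  rw [Complex.cpow_add _ _ hk0, div_mul_eq_div_div, div_eq_mul_inv (a k / _), ← Complex.cpow_neg,
    Complex.cpow_def_of_ne_zero hk0 (-(t * Complex.I)), ← Complex.ofReal_log hk.le]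
  congr 2
  push_cast
  ring

lemma injOn_neg_log_add {β : ℝ} (hβ : 0 < β) (s : Set ℕ) :
    Set.InjOn (fun k : ℕ => -Real.log (k + β)) s := by
  intro i _ j _ hij
  have hi : (0 : ℝ) < i + β := by positivity
  have hj : (0 : ℝ) < j + β := by positivity
  have := Real.log_injOn_pos hi hj (neg_injective hij)
  exact_mod_cast add_right_cancel this

lemma norm_div_ofReal_cpow_ofReal (x : ℂ) {y : ℝ} (hy : 0 < y) (σ : ℝ) :
    ‖x / (y : ℂ) ^ (σ : ℂ)‖ = ‖x‖ * y ^ (-σ) := by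
  rw [norm_div_ofReal_cpow _ hy, Complex.ofReal_re]

/-- The mean square of a fixed Dirichlet polynomial over long segments. -/
lemma exists_integral_norm_sq_dirichletSum_le (a : ℕ → ℂ) {β : ℝ} (hβ : 0 < β) (n : ℕ) (x : ℝ) :
    ∃ C : ℝ, 0 ≤ C ∧ ∀ A B y : ℝ, A ≤ B →
      ∫ t in A..B, ‖dirichletSum a β n (x + (t + y : ℝ) * Complex.I)‖ ^ 2 ≤
        (B - A) * ∑ k ∈ Finset.range n, (‖a k‖ * (k + β : ℝ) ^ (-x)) ^ 2 + C := by
  set u : ℕ → ℂ := fun k => a k / ((k + β : ℝ) : ℂ) ^ (x : ℂ) with hu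
  set θ : ℕ → ℝ := fun k => -Real.log (k + β) with hθ
  refine ⟨∑ k ∈ Finset.range n, ∑ l ∈ (Finset.range n).erase k,
    ‖u k‖ * ‖u l‖ * (2 / |θ k - θ l|), by positivity, fun A B y hAB => ?_⟩
  rw [intervalIntegral.integral_comp_add_right
    (fun t : ℝ => ‖dirichletSum a β n (x + t * Complex.I)‖ ^ 2) y]
  have := integral_norm_sq_sum_exp_le (Finset.range n) u θ (injOn_neg_log_add hβ _)
    (A := A + y) (B := B + y) (by linarith)
  simp_rw [dirichletSum_eq_sum_exp a hβ]
  refine this.trans (le_of_eq ?_)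
  congr 1
  rw [show B + y - (A + y) = B - A by ring]
  congr 1
  refine Finset.sum_congr rfl fun k _ => ?_
  rw [hu]
  simp only
  rw [norm_div_ofReal_cpow_ofReal _ (by positivity)]

namespace DirichletContinuation

variable {f : ℂ → ℂ} {a : ℕ → ℂ} {β l : ℝ} {R : ℂ → ℂ}

/-- The hypothesis concerns `[0, T]`, whereas the three lines argument needs arbitrary translates.
The translated interval lies in `[-V, T + V]` with `V = |A| + |y|`. On `[-V, 0]` only polynomial
growth is available; it costs a power of `y`, which the factor `exp (2 y²)` swallows. -/
lemma exists_mean_sq_shift_le (h : DirichletContinuation f a β l R) (A : ℝ) :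
    ∃ C : ℝ, 0 ≤ C ∧ ∀ T y : ℝ, 1 ≤ T →
      ∫ t in A..A + T, ‖R (l + (t + y : ℝ) * Complex.I) * f (l + (t + y : ℝ) * Complex.I)‖ ^ 2 ≤
        C * T * Real.exp (2 * y ^ 2) := by
  obtain ⟨C, hC⟩ := h.mean_sq
  obtain ⟨M, m, hM⟩ := h.growth l
  set G : ℝ → ℂ := fun t => R (l + t * Complex.I) * f (l + t * Complex.I) with hG
  have hGc : Continuous G := by
    rw [← continuousOn_univ]
    have : ContinuousOn (fun s => R s * f s) {s : ℂ | l ≤ s.re} := fun s hs =>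
      (h.diff s hs).continuousAt.continuousWithinAt
    exact this.comp (f := fun t : ℝ => (l : ℂ) + t * Complex.I) (by fun_prop) fun t _ => by simp
  have hGi : ∀ x y : ℝ, IntervalIntegrable (fun t => ‖G t‖ ^ 2) volume x y := fun x y =>
    (by fun_prop : Continuous fun t => ‖G t‖ ^ 2).intervalIntegrable _ _
  have hM0 : 0 ≤ M := by
    have := (norm_nonneg _).trans (hM l (by simp) (by simp))
    simpa using this
  have hC0 : 0 ≤ C := by
    have := (intervalIntegral.integral_nonneg zero_le_one fun t _ => by positivity).trans (hC 1 le_rfl)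
    linarith
  have hGM : ∀ t, ‖G t‖ ≤ M * (1 + |t|) ^ m := fun t => by
    have := hM (l + t * Complex.I) (by simp) (by simp)
    simpa only [hG, Complex.add_im, Complex.ofReal_im, Complex.mul_im, Complex.ofReal_re,
      Complex.I_im, mul_one, Complex.I_re, mul_zero, add_zero, zero_add] using this
  set c := 1 + |A| with hc
  have hc1 : 1 ≤ c := by rw [hc]; linarith [abs_nonneg A]
  set K := c ^ (2 * m + 1) * ((2 * m + 1).factorial * Real.exp 2) with hK
  set K' := c ^ 1 * ((1 : ℕ).factorial * Real.exp 2) with hK'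
  refine ⟨M ^ 2 * K + C * K', by positivity, fun T y hT => ?_⟩
  rw [intervalIntegral.integral_comp_add_right
    (fun t : ℝ => ‖R (l + t * Complex.I) * f (l + t * Complex.I)‖ ^ 2) y]
  change ∫ t in A + y..A + T + y, ‖G t‖ ^ 2 ≤ _
  set V := |A| + |y| with hV
  have hV0 : 0 ≤ V := by positivity
  have hAy : -V ≤ A + y := by rw [hV]; linarith [neg_abs_le A, neg_abs_le y]
  have hAy' : A + T + y ≤ T + V := by rw [hV]; linarith [le_abs_self A, le_abs_self y]
  have h1 : ∫ t in A + y..A + T + y, ‖G t‖ ^ 2 ≤ ∫ t in -V..T + V, ‖G t‖ ^ 2 :=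
    intervalIntegral.integral_mono_interval hAy (by linarith) hAy'
      (Eventually.of_forall fun t => by positivity) (hGi _ _)
  have h2 : ∫ t in -V..T + V, ‖G t‖ ^ 2 =
      (∫ t in -V..0, ‖G t‖ ^ 2) + ∫ t in (0 : ℝ)..T + V, ‖G t‖ ^ 2 :=
    (intervalIntegral.integral_add_adjacent_intervals (hGi _ _) (hGi _ _)).symm
  have h3 : ∫ t in -V..0, ‖G t‖ ^ 2 ≤ M ^ 2 * (c + |y|) ^ (2 * m + 1) := by
    have : ∫ t in -V..0, ‖G t‖ ^ 2 ≤ ∫ t in -V..0, (M * (1 + V) ^ m) ^ 2 := by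
      refine intervalIntegral.integral_mono_on (by linarith) (hGi _ _) (by simp) fun t ht => ?_
      have : |t| ≤ V := by rw [abs_le]; exact ⟨ht.1, ht.2.trans hV0⟩
      gcongr
      exact (hGM t).trans (by gcongr)
    refine this.trans ?_
    rw [intervalIntegral.integral_const, smul_eq_mul, zero_sub, neg_neg,
      show c + |y| = 1 + V by rw [hc, hV]; ring]
    calc V * (M * (1 + V) ^ m) ^ 2 ≤ (1 + V) * (M * (1 + V) ^ m) ^ 2 := by gcongr; linarith
      _ = _ := by ring
  have h4 : ∫ t in (0 : ℝ)..T + V, ‖G t‖ ^ 2 ≤ C * (T * (c + |y|) ^ 1) := by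
    refine (hC (T + V) (by linarith)).trans ?_
    gcongr
    rw [show c + |y| = 1 + V by rw [hc, hV]; ring]
    nlinarith
  have hexp : ∀ j : ℕ, (c + |y|) ^ j ≤ c ^ j * (j.factorial * Real.exp 2) * Real.exp (2 * y ^ 2) := by
    intro j
    have h5 := exp_neg_sq_mul_pow_le j c y hc1
    have h6 : (c + |y|) ^ j ≤ c ^ j * (j.factorial * Real.exp 2) * Real.exp (y ^ 2) := by
      rw [Real.exp_neg, inv_mul_le_iff₀ (Real.exp_pos _)] at h5
      linarith
    refine h6.trans ?_
    gcongr
    nlinarith [sq_nonneg y]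
  calc _ ≤ M ^ 2 * (c + |y|) ^ (2 * m + 1) + C * (T * (c + |y|) ^ 1) := by linarith
    _ ≤ M ^ 2 * (K * Real.exp (2 * y ^ 2)) + C * (T * (K' * Real.exp (2 * y ^ 2))) := by
        gcongr
        · exact hexp _
        · exact hexp 1
    _ ≤ M ^ 2 * (T * (K * Real.exp (2 * y ^ 2))) + C * (T * (K' * Real.exp (2 * y ^ 2))) := by
        have : M ^ 2 * (K * Real.exp (2 * y ^ 2)) ≤ M ^ 2 * (T * (K * Real.exp (2 * y ^ 2))) :=
          mul_le_mul_of_nonneg_left (le_mul_of_one_le_left (by positivity) hT) (by positivity)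
        linarith
    _ = _ := by ring

lemma differentiableAt_factor_mul_sub (h : DirichletContinuation f a β l R) (n : ℕ) (s : ℂ)
    (hs : l ≤ s.re) :
    DifferentiableAt ℂ (fun s => R s * (f s - dirichletSum a β n s)) s := by
  have : (fun s => R s * (f s - dirichletSum a β n s)) =
      fun s => R s * f s - R s * dirichletSum a β n s := by ext; ring
  rw [this]
  exact (h.diff s hs).fun_sub
    ((h.factor_diff s hs).fun_mul (differentiable_dirichletSum a h.β_pos n s))

/-- Beyond the line `Re s = l`, the partial sums approximate the continuation in mean square. -/
theorem mean_sq_sub_dirichletSum_le (h : DirichletContinuation f a β l R) {u v : ℝ} (hu : l < u)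
    (A : ℝ) {ε : ℝ} (hε : 0 < ε) :
    ∃ n₀ : ℕ, ∀ n ≥ n₀, ∃ T₀ : ℝ, ∀ T ≥ T₀, ∀ σ ∈ Set.Icc u v,
      ∫ t in A..A + T, ‖R (σ + t * Complex.I) * (f (σ + t * Complex.I) -
        dirichletSum a β n (σ + t * Complex.I))‖ ^ 2 ≤ ε * T := by
  obtain ⟨CR, hCR⟩ := h.factor_le
  have hCR0 : 0 ≤ CR := (norm_nonneg _).trans (hCR l (by simp))
  set b := max v 1 + 1 with hb
  have hb1 : 1 < b := by rw [hb]; linarith [le_max_right v 1]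
  have hvb : v < b := by rw [hb]; linarith [le_max_left v 1]
  have hlb : l < b := h.lt_one.trans hb1
  obtain ⟨C₁, κ, hC₁, hκ, hright⟩ := h.exists_norm_sub_dirichletSum_le hb1
  -- The interpolation parameter of every `σ ≥ u` is at least `θ₀`. The left edge is allowed to lose
  -- `n ^ (κ θ₀)`, little enough to be recovered from the gain `n ^ (-2κ)` on the right edge.
  set θ₀ := min ((u - l) / (b - l)) 1 with hθ₀
  have hθ₀0 : 0 < θ₀ := lt_min (div_pos (by linarith) (by linarith)) one_pos
  obtain ⟨C₂, hC₂, hleft⟩ := h.exists_sum_norm_sq_le le_rfl (mul_pos hκ hθ₀0)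
  obtain ⟨C₃, hC₃, hmean⟩ := h.exists_mean_sq_shift_le A
  set K := 2 * C₃ + 2 * CR ^ 2 * (C₂ + 1) + CR ^ 2 * C₁ ^ 2 with hK
  have hK0 : 0 ≤ K := by positivity
  have hlim : Tendsto (fun n : ℕ => Real.exp (2 * (l ^ 2 + b ^ 2)) * K * (n : ℝ) ^ (-(κ * θ₀)))
      atTop (𝓝 (Real.exp (2 * (l ^ 2 + b ^ 2)) * K * 0)) :=
    ((tendsto_rpow_neg_atTop (mul_pos hκ hθ₀0)).comp tendsto_natCast_atTop_atTop).const_mul _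
  rw [mul_zero] at hlim
  obtain ⟨n₀, hn₀⟩ := eventually_atTop.mp (hlim.eventually (gt_mem_nhds hε))
  refine ⟨max n₀ 1, fun n hn => ?_⟩
  have hn1 : 1 ≤ n := (le_max_right _ _).trans hn
  have hnR : (1 : ℝ) ≤ n := by exact_mod_cast hn1
  have hn0 : (0 : ℝ) < n := by linarith
  obtain ⟨Cn, hCn, hpoly⟩ := exists_integral_norm_sq_dirichletSum_le a h.β_pos n l
  refine ⟨max 1 Cn, fun T hT σ hσ => ?_⟩
  have hT1 : 1 ≤ T := (le_max_left _ _).trans hT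
  have hTC : Cn ≤ T := (le_max_right _ _).trans hT
  set F : ℂ → ℂ := fun s => R s * (f s - dirichletSum a β n s) with hF
  have hFd : ∀ s : ℂ, l ≤ s.re → DifferentiableAt ℂ F s := h.differentiableAt_factor_mul_sub n
  have hexp1 : ∀ y : ℝ, 1 ≤ Real.exp (2 * y ^ 2) := fun y => Real.one_le_exp (by positivity)
  -- polynomial growth in the strip
  have hgrow : ∃ (M : ℝ) (m : ℕ), ∀ s : ℂ, l ≤ s.re → s.re ≤ b → ‖F s‖ ≤ M * (1 + |s.im|) ^ m := by
    obtain ⟨M, m, hM⟩ := h.growth b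
    set S := ∑ k ∈ Finset.range n, ‖a k‖ * ((k + β : ℝ) ^ (-l) + (k + β : ℝ) ^ (-b)) with hS
    have hβ := h.β_pos
    have hS0 : 0 ≤ S := Finset.sum_nonneg fun k _ => by positivity
    refine ⟨M + CR * S, m, fun s hs hs' => ?_⟩
    have h1 : ‖dirichletSum a β n s‖ ≤ S := by
      refine (norm_sum_le _ _).trans (Finset.sum_le_sum fun k _ => ?_)
      have hk : (0 : ℝ) < k + β := by positivity
      rw [norm_div_ofReal_cpow _ hk]
      gcongr
      rcases le_or_gt 1 (k + β : ℝ) with h1 | h1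
      · exact (Real.rpow_le_rpow_of_exponent_le h1 (neg_le_neg hs)).trans
          (le_add_of_nonneg_right (by positivity))
      · exact (Real.rpow_le_rpow_of_exponent_ge hk h1.le (neg_le_neg hs')).trans
          (le_add_of_nonneg_left (by positivity))
    have h2 : (1 : ℝ) ≤ (1 + |s.im|) ^ m := one_le_pow₀ (by linarith [abs_nonneg s.im])
    calc ‖F s‖ = ‖R s * f s - R s * dirichletSum a β n s‖ := by rw [hF]; ring_nf
      _ ≤ ‖R s * f s‖ + ‖R s * dirichletSum a β n s‖ := norm_sub_le _ _
      _ ≤ M * (1 + |s.im|) ^ m + CR * S * (1 + |s.im|) ^ m := by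
          rw [norm_mul (R s) (dirichletSum a β n s)]
          refine add_le_add (hM s hs hs') ?_
          exact (mul_le_mul (hCR s hs) h1 (norm_nonneg _) hCR0).trans
            (le_mul_of_one_le_right (by positivity) h2)
      _ = _ := by ring
  obtain ⟨M, m, hgrow⟩ := hgrow
  -- the left edge
  have hlineRf : ∀ y : ℝ, Continuous fun t : ℝ =>
      R (l + (t + y : ℝ) * Complex.I) * f (l + (t + y : ℝ) * Complex.I) := fun y => by
    rw [← continuousOn_univ]
    have : ContinuousOn (fun s => R s * f s) {s : ℂ | l ≤ s.re} := fun s hs =>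
      (h.diff s hs).continuousAt.continuousWithinAt
    exact this.comp (f := fun t : ℝ => (l : ℂ) + (t + y : ℝ) * Complex.I) (by fun_prop)
      fun t _ => by simp
  have hlineS : ∀ y : ℝ, Continuous fun t : ℝ =>
      dirichletSum a β n (l + (t + y : ℝ) * Complex.I) := fun y =>
    (differentiable_dirichletSum a h.β_pos n).continuous.comp (by fun_prop)
  have hlineF : ∀ x y : ℝ, l ≤ x → Continuous fun t : ℝ => F (x + (t + y : ℝ) * Complex.I) :=
    fun x y hx => by
      rw [← continuousOn_univ]
      have : ContinuousOn F {s : ℂ | l ≤ s.re} := fun s hs =>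
        (hFd s hs).continuousAt.continuousWithinAt
      exact this.comp (f := fun t : ℝ => (x : ℂ) + (t + y : ℝ) * Complex.I) (by fun_prop)
        fun t _ => by simpa using hx
  have hi1 : ∀ y : ℝ, IntervalIntegrable (fun t : ℝ =>
      2 * ‖R (l + (t + y : ℝ) * Complex.I) * f (l + (t + y : ℝ) * Complex.I)‖ ^ 2)
      volume A (A + T) := fun y =>
    (continuous_const.mul ((hlineRf y).norm.pow 2)).intervalIntegrable _ _
  have hi2 : ∀ y : ℝ, IntervalIntegrable (fun t : ℝ =>
      2 * CR ^ 2 * ‖dirichletSum a β n (l + (t + y : ℝ) * Complex.I)‖ ^ 2)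
      volume A (A + T) := fun y =>
    (continuous_const.mul ((hlineS y).norm.pow 2)).intervalIntegrable _ _
  have hE₀ : ∀ y : ℝ, ∫ t in A..A + T, ‖F (l + (t + y : ℝ) * Complex.I)‖ ^ 2 ≤
      K * T * (n : ℝ) ^ (κ * θ₀) * Real.exp (2 * y ^ 2) := by
    intro y
    have h1 : ∫ t in A..A + T, ‖F (l + (t + y : ℝ) * Complex.I)‖ ^ 2 ≤
        ∫ t in A..A + T,
          (2 * ‖R (l + (t + y : ℝ) * Complex.I) * f (l + (t + y : ℝ) * Complex.I)‖ ^ 2 +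
          2 * CR ^ 2 * ‖dirichletSum a β n (l + (t + y : ℝ) * Complex.I)‖ ^ 2) := by
      refine intervalIntegral.integral_mono_on (by linarith)
        (((hlineF l y le_rfl).norm.pow 2).intervalIntegrable _ _)
        ((hi1 y).add (hi2 y)) fun t _ => ?_
      set s : ℂ := l + (t + y : ℝ) * Complex.I with hs
      have hs' : l ≤ s.re := by simp [hs]
      have h2 : ‖F s‖ ≤ ‖R s * f s‖ + CR * ‖dirichletSum a β n s‖ := by
        calc ‖F s‖ = ‖R s * f s - R s * dirichletSum a β n s‖ := by rw [hF]; ring_nf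
          _ ≤ ‖R s * f s‖ + ‖R s * dirichletSum a β n s‖ := norm_sub_le _ _
          _ ≤ _ := by
            rw [norm_mul (R s) (dirichletSum a β n s)]
            gcongr
            exact hCR s hs'
      calc ‖F s‖ ^ 2 ≤ (‖R s * f s‖ + CR * ‖dirichletSum a β n s‖) ^ 2 := by gcongr
        _ ≤ _ := by nlinarith [sq_nonneg (‖R s * f s‖ - CR * ‖dirichletSum a β n s‖)]
    rw [intervalIntegral.integral_add (hi1 y) (hi2 y),
      intervalIntegral.integral_const_mul, intervalIntegral.integral_const_mul] at h1
    have h3 := hmean T y hT1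
    have h4 := hpoly A (A + T) y (by linarith)
    rw [add_sub_cancel_left] at h4
    have h5 := hleft n hn1
    have hnp : 1 ≤ (n : ℝ) ^ (κ * θ₀) := Real.one_le_rpow hnR (by positivity)
    have h6 : ∫ t in A..A + T, ‖dirichletSum a β n (l + (t + y : ℝ) * Complex.I)‖ ^ 2 ≤
        (C₂ + 1) * (T * (n : ℝ) ^ (κ * θ₀)) := by
      refine h4.trans ?_
      have : T * ∑ k ∈ Finset.range n, (‖a k‖ * (k + β : ℝ) ^ (-l)) ^ 2 ≤
          T * (C₂ * (n : ℝ) ^ (κ * θ₀)) := by gcongr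
      nlinarith
    have hy := hexp1 y
    have hTn : 0 ≤ T * (n : ℝ) ^ (κ * θ₀) := by positivity
    have h7 : C₃ * T * Real.exp (2 * y ^ 2) ≤
        C₃ * (T * (n : ℝ) ^ (κ * θ₀)) * Real.exp (2 * y ^ 2) := by
      gcongr
      exact le_mul_of_one_le_right (by linarith) hnp
    have h8 : (C₂ + 1) * (T * (n : ℝ) ^ (κ * θ₀)) ≤
        (C₂ + 1) * (T * (n : ℝ) ^ (κ * θ₀)) * Real.exp (2 * y ^ 2) :=
      le_mul_of_one_le_right (by positivity) hy
    calc _ ≤ 2 * (C₃ * (T * (n : ℝ) ^ (κ * θ₀)) * Real.exp (2 * y ^ 2)) +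
          2 * CR ^ 2 * ((C₂ + 1) * (T * (n : ℝ) ^ (κ * θ₀)) * Real.exp (2 * y ^ 2)) := by
          refine h1.trans (add_le_add ?_ ?_)
          · linarith
          · exact mul_le_mul_of_nonneg_left (h6.trans h8) (by positivity)
      _ = (2 * C₃ + 2 * CR ^ 2 * (C₂ + 1)) * (T * (n : ℝ) ^ (κ * θ₀) * Real.exp (2 * y ^ 2)) := by
          ring
      _ ≤ K * (T * (n : ℝ) ^ (κ * θ₀) * Real.exp (2 * y ^ 2)) := by
          gcongr
          rw [hK]
          nlinarith [mul_nonneg (sq_nonneg CR) (sq_nonneg C₁)]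
      _ = _ := by ring
  -- the right edge
  have hE₁ : ∀ y : ℝ, ∫ t in A..A + T, ‖F (b + (t + y : ℝ) * Complex.I)‖ ^ 2 ≤
      K * T * (n : ℝ) ^ (-(2 * κ)) * Real.exp (2 * y ^ 2) := by
    intro y
    have h1 : ∫ t in A..A + T, ‖F (b + (t + y : ℝ) * Complex.I)‖ ^ 2 ≤
        ∫ t in A..A + T, (CR * (C₁ * (n : ℝ) ^ (-κ))) ^ 2 := by
      refine intervalIntegral.integral_mono_on (by linarith)
        (((hlineF b y hlb.le).norm.pow 2).intervalIntegrable _ _) (by simp) fun t _ => ?_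
      gcongr
      rw [hF]
      simp only
      rw [norm_mul]
      gcongr
      · exact hCR _ (by simpa using hlb.le)
      · exact hright n hn1 _ (by simp)
    rw [intervalIntegral.integral_const, smul_eq_mul, add_sub_cancel_left] at h1
    have h2 : (n : ℝ) ^ (-(2 * κ)) = ((n : ℝ) ^ (-κ)) ^ 2 := by
      rw [← Real.rpow_natCast, ← Real.rpow_mul hn0.le]
      congr 1
      push_cast
      ring
    rw [h2]
    calc _ ≤ T * (CR * (C₁ * (n : ℝ) ^ (-κ))) ^ 2 := h1
      _ = (CR ^ 2 * C₁ ^ 2) * T * ((n : ℝ) ^ (-κ)) ^ 2 := by ring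
      _ ≤ K * T * ((n : ℝ) ^ (-κ)) ^ 2 := by
          gcongr
          rw [hK]
          have : 0 ≤ 2 * C₃ + 2 * CR ^ 2 * (C₂ + 1) := by positivity
          linarith
      _ ≤ _ := le_mul_of_one_le_right (by positivity) (hexp1 y)
  have hfin := integral_norm_sq_le_interp hlb hFd hgrow (by linarith : A ≤ A + T) hE₀ hE₁
    (σ := σ) ⟨hu.le.trans hσ.1, hσ.2.trans hvb.le⟩
  refine hfin.trans ?_
  set θ := (σ - l) / (b - l) with hθ
  have hθθ₀ : θ₀ ≤ θ := (min_le_left _ _).trans (by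
    rw [hθ]
    have : 0 < b - l := by linarith
    have := hσ.1
    gcongr)
  have hθ1 : θ ≤ 1 := by
    rw [hθ, div_le_one (by linarith)]
    linarith [hσ.2]
  have hKT : 0 ≤ K * T := by positivity
  -- The exponent of `n` is `κθ₀(1 - θ) - 2κθ`, at most `-κθ₀` because `θ ≥ θ₀`.
  have hcalc : (K * T * (n : ℝ) ^ (κ * θ₀)) ^ (1 - θ) * (K * T * (n : ℝ) ^ (-(2 * κ))) ^ θ ≤
      K * T * (n : ℝ) ^ (-(κ * θ₀)) := by
    rw [Real.mul_rpow hKT (by positivity), Real.mul_rpow hKT (by positivity),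
      ← Real.rpow_mul hn0.le, ← Real.rpow_mul hn0.le]
    have h1 : (K * T) ^ (1 - θ) * (K * T) ^ θ = K * T := by
      rw [← Real.rpow_add_of_nonneg hKT (by linarith) (by linarith)]
      simp
    calc _ = ((K * T) ^ (1 - θ) * (K * T) ^ θ) *
          ((n : ℝ) ^ (κ * θ₀ * (1 - θ)) * (n : ℝ) ^ (-(2 * κ) * θ)) := by ring
      _ = K * T * (n : ℝ) ^ (κ * θ₀ * (1 - θ) + -(2 * κ) * θ) := by
          rw [h1, Real.rpow_add hn0]
      _ ≤ _ := by
          refine mul_le_mul_of_nonneg_left (Real.rpow_le_rpow_of_exponent_le hnR ?_) hKT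
          have h2 : 0 ≤ κ * (θ - θ₀) := mul_nonneg hκ.le (by linarith)
          have h3 : 0 ≤ κ * θ₀ * θ := by
            have : 0 ≤ θ := hθ₀0.le.trans hθθ₀
            positivity
          nlinarith
  calc _ ≤ Real.exp (2 * (l ^ 2 + b ^ 2)) * (K * T * (n : ℝ) ^ (-(κ * θ₀))) := by gcongr
    _ = (Real.exp (2 * (l ^ 2 + b ^ 2)) * K * (n : ℝ) ^ (-(κ * θ₀))) * T := by ring
    _ ≤ ε * T := by
        gcongr
        exact (hn₀ n ((le_max_left _ _).trans hn)).le

end DirichletContinuation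

/-! ### Discrete approximation in measure, uniformly on compact sets -/

/-- Only this inequality is needed and, unlike equality, it requires no measurability of the
summands. -/
lemma sum_lintegral_le_lintegral_sum {X ι : Type*} [MeasurableSpace X] (μ : Measure X)
    (s : Finset ι) (F : ι → X → ℝ≥0∞) :
    ∑ i ∈ s, ∫⁻ x, F i x ∂μ ≤ ∫⁻ x, ∑ i ∈ s, F i x ∂μ := by
  classical
  induction s using Finset.induction_on with
  | empty => simp
  | insert i s hi ih =>
    simp only [Finset.sum_insert hi]
    exact (add_le_add le_rfl ih).trans (le_lintegral_add _ _)

/-- Windows of width at most the spacing `h` fit into adjacent intervals of length `h`. This is the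
passage from a continuous to a discrete mean square. -/
lemma sum_integral_shift_le {g : ℝ → ℝ} (hg : Continuous g) (hg0 : ∀ t, 0 ≤ g t) {A w h : ℝ}
    (hw : 0 ≤ w) (hwh : w ≤ h) (N : ℕ) :
    ∑ k ∈ Finset.range N, ∫ t in A..A + w, g (t + k * h) ≤ ∫ t in A..A + N * h, g t := by
  have h1 := intervalIntegral.sum_integral_adjacent_intervals (f := g) (μ := volume)
    (a := fun k : ℕ => A + k * h) (n := N) fun k _ => hg.intervalIntegrable _ _
  simp only [Nat.cast_zero, zero_mul, add_zero] at h1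
  rw [← h1]
  refine Finset.sum_le_sum fun k _ => ?_
  rw [intervalIntegral.integral_comp_add_right]
  refine intervalIntegral.integral_mono_interval le_rfl (by linarith) ?_
    (Eventually.of_forall hg0) (hg.intervalIntegrable _ _)
  push_cast
  linarith

namespace DirichletContinuation

variable {f : ℂ → ℂ} {a : ℕ → ℂ} {β l : ℝ} {R : ℂ → ℂ}

open Classical in
-- A Chebyshev argument. Each bad index contributes at least `π r² δ²` to the integral of `|f -
-- S_n|²` over the square of side `4r`, shifted up by `kτ`. As `4r ≤ τ` these squares overlap at
-- most in edges, so on each vertical line the contributions add up to at most one long mean square,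
-- which is small. The lower bound `ρ` for `R` removes the factor again.
lemma card_ball_le (h : DirichletContinuation f a β l R) {τ : ℝ} (hτ : 0 < τ) {c : ℂ} {r : ℝ}
    (hr : 0 < r) (hrτ : 4 * r ≤ τ) (hl : l < c.re - 2 * r) {ρ : ℝ} (hρ : 0 < ρ)
    (hR : ∀ s : ℂ, s.re ∈ Set.Icc (c.re - 2 * r) (c.re + 2 * r) → ρ ≤ ‖R s‖)
    {δ ε : ℝ} (hδ : 0 < δ) (hε : 0 < ε) :
    ∀ᶠ n in atTop, ∀ᶠ N : ℕ in atTop,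
      (((Finset.range (N + 1)).filter fun k : ℕ => ∃ z ∈ Metric.closedBall c r,
        δ ≤ ‖f (z + (k * τ : ℝ) * Complex.I) -
          dirichletSum a β n (z + (k * τ : ℝ) * Complex.I)‖).card : ℝ) ≤ ε * (N + 1) := by
  set A := c.im - 2 * r with hA
  -- Chosen so that `card · π r² δ² ≤ ρ⁻² · ε'(N + 1)τ · 4r` becomes exactly `card ≤ ε(N + 1)`.
  set ε' := ε * (Real.pi * r * δ ^ 2 * ρ ^ 2) / (4 * τ) with hε'
  have hε'0 : 0 < ε' := by have := Real.pi_pos; positivity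
  obtain ⟨n₀, hn₀⟩ := h.mean_sq_sub_dirichletSum_le (v := c.re + 2 * r) hl A hε'0
  filter_upwards [eventually_ge_atTop n₀] with n hn
  obtain ⟨T₀, hT₀⟩ := hn₀ n hn
  have hNT : Tendsto (fun N : ℕ => ((N + 1 : ℕ) : ℝ) * τ) atTop atTop :=
    (tendsto_natCast_atTop_atTop.comp (tendsto_add_atTop_nat 1)).atTop_mul_const hτ
  filter_upwards [hNT.eventually (eventually_ge_atTop T₀)] with N hN
  set g : ℂ → ℂ := fun s => f s - dirichletSum a β n s with hg
  set X := Set.Ioo (c.re - 2 * r) (c.re + 2 * r) with hX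
  set Y := Set.Ioo (c.im - 2 * r) (c.im + 2 * r) with hY
  have hXI : ∀ x ∈ X, x ∈ Set.Icc (c.re - 2 * r) (c.re + 2 * r) := fun x hx =>
    Set.Ioo_subset_Icc_self hx
  -- Only the product of `R` with `g` is known to be differentiable; where `R` does not vanish,
  -- division recovers `g`.
  have hgd : ∀ s : ℂ, s.re ∈ Set.Icc (c.re - 2 * r) (c.re + 2 * r) → DifferentiableAt ℂ g s := by
    intro s hs
    have h1 := h.differentiableAt_factor_mul_sub n s (hl.le.trans hs.1)
    have hRs : R s ≠ 0 := norm_pos_iff.mp (hρ.trans_le (hR s hs))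
    have h2 := h.factor_diff s (hl.le.trans hs.1)
    have h3 := h1.fun_div h2 hRs
    refine h3.congr_of_eventuallyEq ?_
    filter_upwards [h2.continuousAt.eventually_ne hRs] with w hw
    rw [mul_div_cancel_left₀ _ hw]
  have hgline : ∀ x ∈ X, Continuous fun t : ℝ => g (x + t * Complex.I) := fun x hx => by
    rw [continuous_iff_continuousAt]
    intro t
    refine ContinuousAt.comp (f := fun t : ℝ => (x : ℂ) + t * Complex.I)
      (hgd _ (by simpa using hXI x hx)).continuousAt (by fun_prop)
  set bad := (Finset.range (N + 1)).filter fun k : ℕ => ∃ z ∈ Metric.closedBall c r,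
        δ ≤ ‖f (z + (k * τ : ℝ) * Complex.I) -
          dirichletSum a β n (z + (k * τ : ℝ) * Complex.I)‖ with hbad
  -- one bad index
  have hone : ∀ k ∈ bad, ENNReal.ofReal (Real.pi * r ^ 2) * ENNReal.ofReal δ ^ 2 ≤
      ∫⁻ x in X, ∫⁻ y in Y, ‖g (x + (y + k * τ : ℝ) * Complex.I)‖ₑ ^ 2 := by
    intro k hk
    obtain ⟨z, hz, hδz⟩ := (Finset.mem_filter.mp hk).2
    have h1 := enorm_sq_mul_le_lintegral_square (g := fun s => g (s + (k * τ : ℝ) * Complex.I))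
      hr (c := c) (z := z) (fun s hs => ?_) hz
    · refine le_trans ?_ (h1.trans (le_of_eq ?_))
      · gcongr
        rw [← ofReal_norm]
        exact ENNReal.ofReal_le_ofReal hδz
      · refine lintegral_congr fun x => lintegral_congr fun y => ?_
        congr 3
        push_cast
        ring
    · refine (DifferentiableAt.comp s (g := g) (f := fun s : ℂ => s + (k * τ : ℝ) * Complex.I)
        (hgd _ ?_) (by fun_prop)).differentiableWithinAt
      simpa using hXI _ hs
  -- the contribution of all indices on one vertical line
  have hline : ∀ x ∈ X, ∑ k ∈ Finset.range (N + 1),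
      ∫⁻ y in Y, ‖g (x + (y + k * τ : ℝ) * Complex.I)‖ₑ ^ 2 ≤
        ENNReal.ofReal ((ρ ^ 2)⁻¹ * (ε' * (((N + 1 : ℕ) : ℝ) * τ))) := by
    intro x hx
    have hgc := hgline x hx
    have hgc2 : Continuous fun t : ℝ => ‖g (x + t * Complex.I)‖ ^ 2 := hgc.norm.pow 2
    have h1 : ∀ k : ℕ, ∫⁻ y in Y, ‖g (x + (y + k * τ : ℝ) * Complex.I)‖ₑ ^ 2 =
        ENNReal.ofReal (∫ y in A..A + 4 * r, ‖g (x + (y + k * τ : ℝ) * Complex.I)‖ ^ 2) := by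
      intro k
      have hc : Continuous fun y : ℝ => ‖g (x + (y + k * τ : ℝ) * Complex.I)‖ ^ 2 :=
        hgc2.comp (by fun_prop : Continuous fun y : ℝ => y + k * τ)
      rw [intervalIntegral.integral_of_le (by linarith), integral_Ioc_eq_integral_Ioo,
        show A + 4 * r = c.im + 2 * r by rw [hA]; ring, ofReal_integral_eq_lintegral_ofReal]
      · refine lintegral_congr fun y => ?_
        rw [ENNReal.ofReal_pow (norm_nonneg _), ofReal_norm]
      · exact (hc.integrableOn_Icc (a := A) (b := c.im + 2 * r)).mono_set Set.Ioo_subset_Icc_self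
      · exact Eventually.of_forall fun y => by positivity
    simp only [h1]
    rw [← ENNReal.ofReal_sum_of_nonneg fun k _ =>
      intervalIntegral.integral_nonneg (by linarith) fun y _ => by positivity]
    refine ENNReal.ofReal_le_ofReal ?_
    refine (sum_integral_shift_le hgc2 (fun t => by positivity) (by linarith) hrτ (N + 1)).trans ?_
    have h2 := hT₀ (((N + 1 : ℕ) : ℝ) * τ) hN x (hXI x hx)
    have h3 : ∫ t in A..A + ((N + 1 : ℕ) : ℝ) * τ, ‖g (x + t * Complex.I)‖ ^ 2 ≤
        ∫ t in A..A + ((N + 1 : ℕ) : ℝ) * τ, (ρ ^ 2)⁻¹ *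
          ‖R (x + t * Complex.I) * g (x + t * Complex.I)‖ ^ 2 := by
      have hRg : Continuous fun t : ℝ => R (x + t * Complex.I) * g (x + t * Complex.I) := by
        refine Continuous.mul ?_ hgc
        rw [continuous_iff_continuousAt]
        intro t
        exact ContinuousAt.comp (f := fun t : ℝ => (x : ℂ) + t * Complex.I)
          (h.factor_diff _ (by simpa using hl.le.trans hx.1.le)).continuousAt (by fun_prop)
      refine intervalIntegral.integral_mono_on (le_add_of_nonneg_right (by positivity))
        (hgc2.intervalIntegrable _ _)
        ((continuous_const.mul (hRg.norm.pow 2)).intervalIntegrable _ _) fun t _ => ?_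
      rw [norm_mul, mul_pow, ← mul_assoc]
      refine le_mul_of_one_le_left (by positivity) ?_
      rw [inv_mul_eq_div, one_le_div (by positivity)]
      gcongr
      exact hR _ (by simpa using hXI x hx)
    refine h3.trans ?_
    rw [intervalIntegral.integral_const_mul]
    gcongr
  have htotal : (bad.card : ℝ≥0∞) * (ENNReal.ofReal (Real.pi * r ^ 2) * ENNReal.ofReal δ ^ 2) ≤
      ENNReal.ofReal ((ρ ^ 2)⁻¹ * (ε' * (((N + 1 : ℕ) : ℝ) * τ))) * ENNReal.ofReal (4 * r) := by
    rw [← nsmul_eq_mul, ← Finset.sum_const]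
    calc _ ≤ ∑ k ∈ bad, ∫⁻ x in X, ∫⁻ y in Y, ‖g (x + (y + k * τ : ℝ) * Complex.I)‖ₑ ^ 2 :=
          Finset.sum_le_sum hone
      _ ≤ ∑ k ∈ Finset.range (N + 1),
          ∫⁻ x in X, ∫⁻ y in Y, ‖g (x + (y + k * τ : ℝ) * Complex.I)‖ₑ ^ 2 :=
          Finset.sum_le_sum_of_subset (Finset.filter_subset _ _)
      _ ≤ ∫⁻ x in X, ∑ k ∈ Finset.range (N + 1),
          ∫⁻ y in Y, ‖g (x + (y + k * τ : ℝ) * Complex.I)‖ₑ ^ 2 :=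
          sum_lintegral_le_lintegral_sum _ _ _
      _ ≤ ∫⁻ x in X, ENNReal.ofReal ((ρ ^ 2)⁻¹ * (ε' * (((N + 1 : ℕ) : ℝ) * τ))) :=
          setLIntegral_mono' measurableSet_Ioo hline
      _ = _ := by
          rw [setLIntegral_const, hX, Real.volume_Ioo]
          congr 2
          ring
  have hπ := Real.pi_pos
  rw [← ENNReal.ofReal_natCast, ← ENNReal.ofReal_pow hδ.le, ← ENNReal.ofReal_mul (by positivity),
    ← ENNReal.ofReal_mul (by positivity), ← ENNReal.ofReal_mul (by positivity),
    ENNReal.ofReal_le_ofReal_iff (by positivity)] at htotal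
  have hpos : 0 < Real.pi * r ^ 2 * δ ^ 2 := by positivity
  refine le_of_mul_le_mul_right (htotal.trans (le_of_eq ?_)) hpos
  rw [hε']
  push_cast
  field_simp

open Classical in
/-- The partial sums of the Dirichlet series approximate the discrete shifts of its continuation
in measure, uniformly on compact sets away from the poles. -/
theorem card_compact_le (h : DirichletContinuation f a β l R) {τ : ℝ} (hτ : 0 < τ) {K : Set ℂ}
    (hK : IsCompact K)
    (hR : ∀ c ∈ K, ∃ r > 0, l < c.re - r ∧
      ∃ ρ > 0, ∀ s : ℂ, s.re ∈ Set.Icc (c.re - r) (c.re + r) → ρ ≤ ‖R s‖)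
    {δ ε : ℝ} (hδ : 0 < δ) (hε : 0 < ε) :
    ∀ᶠ n in atTop, ∀ᶠ N : ℕ in atTop,
      (((Finset.range (N + 1)).filter fun k : ℕ => ∃ z ∈ K,
        δ ≤ ‖f (z + (k * τ : ℝ) * Complex.I) -
          dirichletSum a β n (z + (k * τ : ℝ) * Complex.I)‖).card : ℝ) ≤ ε * (N + 1) := by
  -- The radius is chosen before `ε`. The finite subcover is then independent of `ε`, which can be
  -- divided among its members.
  have hball : ∀ c ∈ K, ∃ r > 0, ∀ ε > 0, ∀ᶠ n in atTop, ∀ᶠ N : ℕ in atTop,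
      (((Finset.range (N + 1)).filter fun k : ℕ => ∃ z ∈ Metric.closedBall c r,
        δ ≤ ‖f (z + (k * τ : ℝ) * Complex.I) -
          dirichletSum a β n (z + (k * τ : ℝ) * Complex.I)‖).card : ℝ) ≤ ε * (N + 1) := by
    intro c hc
    obtain ⟨r, hr, hlr, ρ, hρ, hRρ⟩ := hR c hc
    refine ⟨min (r / 2) (τ / 4), by positivity, fun ε hε =>
      h.card_ball_le hτ (by positivity) ?_ ?_ hρ (fun s hs => hRρ s ?_) hδ hε⟩
    · linarith [min_le_right (r / 2) (τ / 4)]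
    · linarith [min_le_left (r / 2) (τ / 4)]
    · have := min_le_left (r / 2) (τ / 4)
      exact ⟨by linarith [hs.1], by linarith [hs.2]⟩
  choose! r hr hcard using hball
  obtain ⟨t, htK, htcov⟩ := hK.elim_nhds_subcover (fun c => Metric.closedBall c (r c))
    fun c hc => Metric.closedBall_mem_nhds c (hr c hc)
  have hε' : 0 < ε / (t.card + 1) := by positivity
  have hall : ∀ᶠ n in atTop, ∀ c ∈ t, ∀ᶠ N : ℕ in atTop,
      (((Finset.range (N + 1)).filter fun k : ℕ => ∃ z ∈ Metric.closedBall c (r c),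
        δ ≤ ‖f (z + (k * τ : ℝ) * Complex.I) -
          dirichletSum a β n (z + (k * τ : ℝ) * Complex.I)‖).card : ℝ) ≤
            ε / (t.card + 1) * (N + 1) :=
    (eventually_all_finset t).mpr fun c hc => hcard c (htK c hc) _ hε'
  filter_upwards [hall] with n hn
  filter_upwards [(eventually_all_finset t).mpr hn] with N hN
  calc _ ≤ ((t.biUnion fun c => (Finset.range (N + 1)).filter fun k : ℕ =>
          ∃ z ∈ Metric.closedBall c (r c), δ ≤ ‖f (z + (k * τ : ℝ) * Complex.I) -
            dirichletSum a β n (z + (k * τ : ℝ) * Complex.I)‖).card : ℝ) := by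
        norm_cast
        refine Finset.card_le_card fun k hk => ?_
        rw [Finset.mem_filter] at hk
        obtain ⟨hkN, z, hz, hδz⟩ := hk
        obtain ⟨c, hc, hzc⟩ := Set.mem_iUnion₂.mp (htcov hz)
        exact Finset.mem_biUnion.mpr ⟨c, hc, Finset.mem_filter.mpr ⟨hkN, z, hzc, hδz⟩⟩
    _ ≤ ∑ c ∈ t, (((Finset.range (N + 1)).filter fun k : ℕ =>
          ∃ z ∈ Metric.closedBall c (r c), δ ≤ ‖f (z + (k * τ : ℝ) * Complex.I) -
            dirichletSum a β n (z + (k * τ : ℝ) * Complex.I)‖).card : ℝ) := by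
        exact_mod_cast Finset.card_biUnion_le
    _ ≤ ∑ c ∈ t, ε / (t.card + 1) * (N + 1) := Finset.sum_le_sum hN
    _ = (t.card / (t.card + 1)) * (ε * (N + 1)) := by
        rw [Finset.sum_const, nsmul_eq_mul]; ring
    _ ≤ 1 * (ε * (N + 1)) := by
        gcongr
        rw [div_le_one (by positivity)]
        linarith
    _ = _ := one_mul _

end DirichletContinuation

/-! ### Equidistribution on the torus -/

lemma integral_empirical {X E : Type*} [MeasurableSpace X] [NormedAddCommGroup E]
    [NormedSpace ℝ E] [CompleteSpace E] (x : ℕ → X) (N : ℕ) {F : X → E}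
    (hF : StronglyMeasurable F) :
    ∫ y, F y ∂(empirical x N : Measure X) =
      ((N + 1 : ℕ) : ℝ)⁻¹ • ∑ k ∈ Finset.range (N + 1), F (x k) := by
  change ∫ y, F y ∂(((N + 1 : ℕ) : ℝ≥0∞)⁻¹ • ∑ k ∈ Finset.range (N + 1), Measure.dirac (x k)) = _
  rw [integral_smul_measure, integral_finsetSum_measure]
  · simp only [integral_dirac' _ _ hF, ENNReal.toReal_inv, ENNReal.toReal_natCast]
  · intro k _
    exact integrable_dirac' hF (by simp [enorm_lt_top])

/-- Weyl's criterion: on a compact space it is enough to test convergence of averages on a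
separating star subalgebra. -/
lemma tendsto_empirical_of_starSubalgebra {X : Type*} [TopologicalSpace X] [CompactSpace X]
    [MeasurableSpace X] [OpensMeasurableSpace X] (x : ℕ → X) (μ : ProbabilityMeasure X)
    (𝒜 : StarSubalgebra ℂ C(X, ℂ)) (hsep : 𝒜.SeparatesPoints)
    (h𝒜 : ∀ F ∈ 𝒜, Tendsto (fun N : ℕ => ((N + 1 : ℕ) : ℝ)⁻¹ • ∑ k ∈ Finset.range (N + 1), F (x k))
      atTop (𝓝 (∫ y, F y ∂(μ : Measure X)))) :
    Tendsto (empirical x) atTop (𝓝 μ) := by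
  have hdense := ContinuousMap.starSubalgebra_topologicalClosure_eq_top_of_separatesPoints 𝒜 hsep
  have hint : ∀ F : C(X, ℂ), Integrable F (μ : Measure X) := fun F =>
    Integrable.of_bound F.continuous.aestronglyMeasurable ‖F‖
      (Eventually.of_forall F.norm_coe_le_norm)
  have hall : ∀ F : C(X, ℂ), Tendsto (fun N : ℕ =>
      ((N + 1 : ℕ) : ℝ)⁻¹ • ∑ k ∈ Finset.range (N + 1), F (x k))
      atTop (𝓝 (∫ y, F y ∂(μ : Measure X))) := by
    intro F
    rw [Metric.tendsto_atTop]
    intro ε hε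
    have hF : F ∈ closure (𝒜 : Set C(X, ℂ)) := by
      have : F ∈ 𝒜.topologicalClosure := by rw [hdense]; trivial
      exact this
    obtain ⟨G, hG, hFG⟩ := Metric.mem_closure_iff.mp hF (ε / 3) (by linarith)
    obtain ⟨N₀, hN₀⟩ := Metric.tendsto_atTop.mp (h𝒜 G hG) (ε / 3) (by linarith)
    refine ⟨N₀, fun N hN => ?_⟩
    have hpt : ∀ y, ‖F y - G y‖ ≤ ε / 3 := fun y => by
      have := (F - G).norm_coe_le_norm y
      rw [← dist_eq_norm F G] at this
      exact this.trans hFG.le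
    have h1 : dist (((N + 1 : ℕ) : ℝ)⁻¹ • ∑ k ∈ Finset.range (N + 1), F (x k))
        (((N + 1 : ℕ) : ℝ)⁻¹ • ∑ k ∈ Finset.range (N + 1), G (x k)) ≤ ε / 3 := by
      rw [dist_eq_norm, ← smul_sub, ← Finset.sum_sub_distrib, norm_smul, norm_inv,
        Real.norm_natCast, inv_mul_le_iff₀ (by positivity)]
      refine (norm_sum_le_of_le _ fun k _ => hpt (x k)).trans (le_of_eq ?_)
      simp
    have h2 : dist (∫ y, G y ∂(μ : Measure X)) (∫ y, F y ∂(μ : Measure X)) ≤ ε / 3 := by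
      rw [dist_eq_norm, ← integral_sub (hint G) (hint F)]
      refine (norm_integral_le_of_norm_le_const (C := ε / 3) (Eventually.of_forall fun y => ?_)).trans
        (le_of_eq ?_)
      · rw [norm_sub_rev]; exact hpt y
      · simp
    calc _ ≤ _ := dist_triangle4 _ (((N + 1 : ℕ) : ℝ)⁻¹ • ∑ k ∈ Finset.range (N + 1), G (x k))
          (∫ y, G y ∂(μ : Measure X)) _
      _ < ε := by linarith [hN₀ N hN]
  rw [ProbabilityMeasure.tendsto_iff_forall_integral_tendsto]
  intro F
  have h1 := hall ⟨fun y => (F y : ℂ), by fun_prop⟩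
  have h2 := (Complex.continuous_re.tendsto _).comp h1
  have h3 : ∫ y, (F y : ℂ) ∂(μ : Measure X) = ((∫ y, F y ∂(μ : Measure X) : ℝ) : ℂ) :=
    integral_ofReal
  simp only [ContinuousMap.coe_mk] at h2
  rw [h3, Complex.ofReal_re] at h2
  refine h2.congr fun N => ?_
  rw [integral_empirical x N F.continuous.stronglyMeasurable, Function.comp_apply,
    Complex.smul_re, Complex.re_sum]
  simp only [Complex.ofReal_re]

/-- Translation by `g` preserves the integral and multiplies it by `χ g ≠ 1`. -/
lemma integral_monoidHom_eq_zero {G : Type*} [Group G] [MeasurableSpace G] [MeasurableMul G]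
    (μ : Measure G) [μ.IsMulLeftInvariant] (χ : G →* Circle) {g : G} (hg : χ g ≠ 1) :
    ∫ x, (χ x : ℂ) ∂μ = 0 := by
  have h1 := integral_mul_left_eq_self (μ := μ) (fun x => (χ x : ℂ)) g
  simp only [map_mul, Circle.coe_mul] at h1
  rw [integral_const_mul] at h1
  have h2 : ((χ g : ℂ) - 1) * ∫ x, (χ x : ℂ) ∂μ = 0 := by rw [sub_mul, h1]; ring
  rcases mul_eq_zero.mp h2 with h3 | h3
  · exact absurd (Circle.ext (by simpa using sub_eq_zero.mp h3)) hg
  · exact h3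

/-- The geometric sums stay bounded by `2 / ‖z - 1‖`. -/
lemma tendsto_average_pow {z : ℂ} (hz : ‖z‖ = 1) (hz1 : z ≠ 1) :
    Tendsto (fun N : ℕ => ((N + 1 : ℕ) : ℝ)⁻¹ • ∑ k ∈ Finset.range (N + 1), z ^ k) atTop (𝓝 0) := by
  have hpos : 0 < ‖z - 1‖ := norm_pos_iff.mpr (sub_ne_zero.mpr hz1)
  have h0 : Tendsto (fun N : ℕ => ((N + 1 : ℕ) : ℝ)⁻¹ * (2 / ‖z - 1‖)) atTop (𝓝 (0 * (2 / ‖z - 1‖))) :=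
    ((tendsto_inv_atTop_zero.comp
      (tendsto_natCast_atTop_atTop.comp (tendsto_add_atTop_nat 1))).mul_const _)
  rw [zero_mul] at h0
  refine squeeze_zero_norm (fun N => ?_) h0
  rw [norm_smul, geom_sum_eq hz1, norm_div, norm_inv, Real.norm_natCast]
  gcongr
  refine (norm_sub_le _ _).trans ?_
  rw [norm_pow, hz]
  norm_num

/-- The point `((p^{-it})_p, ((m + α)^{-it})_m)` of the torus. -/
def torusPoint (α t : ℝ) : Omega1 × Omega2 :=
  (fun p => Circle.exp (-(t * Real.log p)), fun m => Circle.exp (-(t * Real.log (m + α))))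

/-- The discrete shifts form the orbit of a rotation of the torus, so averages of characters along
it are averages of geometric sums. -/
lemma torusPoint_nat_mul (α h : ℝ) (k : ℕ) : torusPoint α (k * h) = torusPoint α h ^ k := by
  ext i <;> simp [torusPoint, ← Circle.exp_natCast_mul] <;> ring_nf

/-- The coordinates of a point of the torus. -/
def torusCoord (ω : Omega1 × Omega2) : Nat.Primes ⊕ ℕ → Circle := Sum.elim ω.1 ω.2

/-- The character `ω ↦ ∏ ω_i ^ {n_i}` of the torus. -/
def torusChar (n : Nat.Primes ⊕ ℕ →₀ ℤ) : Omega1 × Omega2 →* Circle where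
  toFun ω := n.prod fun i e => torusCoord ω i ^ e
  map_one' := by
    refine Finset.prod_eq_one fun i _ => ?_
    rcases i with p | m <;> simp [torusCoord]
  map_mul' ω ω' := by
    rw [← Finsupp.prod_mul]
    refine Finset.prod_congr rfl fun i _ => ?_
    rcases i with p | m <;> simp [torusCoord, mul_zpow]

lemma continuous_torusChar (n : Nat.Primes ⊕ ℕ →₀ ℤ) : Continuous (torusChar n) := by
  refine continuous_finsetProd _ fun i _ => Continuous.zpow ?_ _
  rcases i with p | m
  · exact (continuous_apply p).comp continuous_fst
  · exact (continuous_apply m).comp continuous_snd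

lemma circle_exp_sum {ι : Type*} (s : Finset ι) (x : ι → ℝ) :
    Circle.exp (∑ i ∈ s, x i) = ∏ i ∈ s, Circle.exp (x i) := by
  classical
  induction s using Finset.induction_on with
  | empty => simp
  | insert i s hi ih => rw [Finset.sum_insert hi, Finset.prod_insert hi, Circle.exp_add, ih]

lemma torusCoord_torusPoint (α t : ℝ) (i : Nat.Primes ⊕ ℕ) : torusCoord (torusPoint α t) i =
    Circle.exp (-(t * Sum.elim (fun p : Nat.Primes => Real.log p)
      (fun m : ℕ => Real.log (m + α)) i)) := by
  rcases i with p | m <;> rfl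

/-- The value `1` would place `h ∑ n_i v_i` in `2πℤ`, where the `v_i` are the logarithms: a rational
relation between them and `2π / h`. The proof of the theorem uses the linear independence of the
family here and nowhere else. -/
lemma torusChar_torusPoint_ne_one {α h : ℝ} (hh : 0 < h) (hL : LinearIndependent ℚ (familyL α h))
    {n : Nat.Primes ⊕ ℕ →₀ ℤ} (hn : n ≠ 0) : torusChar n (torusPoint α h) ≠ 1 := by
  intro h1
  set v : Nat.Primes ⊕ ℕ → ℝ := Sum.elim (fun p : Nat.Primes => Real.log p)
    (fun m : ℕ => Real.log (m + α)) with hv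
  have h2 : torusChar n (torusPoint α h) =
      Circle.exp (∑ i ∈ n.support, -(h * (n i * v i))) := by
    change ∏ i ∈ n.support, torusCoord (torusPoint α h) i ^ n i = _
    rw [circle_exp_sum]
    refine Finset.prod_congr rfl fun i _ => ?_
    rw [torusCoord_torusPoint, ← Circle.exp_intCast_mul]
    congr 1
    ring
  rw [h2, Circle.exp_eq_one] at h1
  obtain ⟨m, hm⟩ := h1
  have hLI : LinearIndependent ℚ (familyL α h ∘ Equiv.sumAssoc Nat.Primes ℕ Unit) :=
    hL.comp _ (Equiv.injective _)
  rw [linearIndependent_iff'] at hLI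
  have hfam : ∀ i, (familyL α h ∘ Equiv.sumAssoc Nat.Primes ℕ Unit) (Sum.inl i) = v i := by
    rintro (p | k) <;> rfl
  have hunit : (familyL α h ∘ Equiv.sumAssoc Nat.Primes ℕ Unit) (Sum.inr ()) = 2 * Real.pi / h := rfl
  -- The integer `m` from `2πm` becomes the coefficient of `2π / h`; the exponents `n_i` are the
  -- other coefficients.
  have h4 := hLI (n.support.disjSum {()}) (Sum.elim (fun i => (n i : ℚ)) fun _ => (m : ℚ)) (by
    rw [Finset.sum_disjSum, Finset.sum_singleton, hunit]
    simp only [hfam, Sum.elim_inl, Sum.elim_inr, Rat.smul_def, Rat.cast_intCast]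
    rw [Finset.sum_neg_distrib, ← Finset.mul_sum] at hm
    field_simp
    linarith)
  refine hn (Finsupp.ext fun i => ?_)
  by_contra hi
  have h5 := h4 (Sum.inl i) (Finset.inl_mem_disjSum.mpr (Finsupp.mem_support_iff.mpr hi))
  rw [Sum.elim_inl] at h5
  exact hi (by exact_mod_cast h5)

/-- The character `torusChar n` as a continuous complex function. -/
def torusCharMap (n : Nat.Primes ⊕ ℕ →₀ ℤ) : C(Omega1 × Omega2, ℂ) :=
  ⟨fun ω => (torusChar n ω : ℂ), continuous_subtype_val.comp (continuous_torusChar n)⟩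

lemma torusChar_add (m n : Nat.Primes ⊕ ℕ →₀ ℤ) (ω : Omega1 × Omega2) :
    torusChar (m + n) ω = torusChar m ω * torusChar n ω :=
  Finsupp.prod_add_index' (h := fun i (e : ℤ) => torusCoord ω i ^ e) (fun _ => zpow_zero _)
    fun _ => zpow_add _

lemma torusChar_zero (ω : Omega1 × Omega2) : torusChar 0 ω = 1 :=
  Finsupp.prod_zero_index (h := fun i (e : ℤ) => torusCoord ω i ^ e)

lemma torusChar_neg (n : Nat.Primes ⊕ ℕ →₀ ℤ) (ω : Omega1 × Omega2) :
    torusChar (-n) ω = (torusChar n ω)⁻¹ := by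
  rw [eq_inv_iff_mul_eq_one, ← torusChar_add, neg_add_cancel, torusChar_zero]

/-- The star algebra of trigonometric polynomials on the torus. -/
def trigPoly : StarSubalgebra ℂ C(Omega1 × Omega2, ℂ) where
  toSubalgebra := Algebra.adjoin ℂ (Set.range torusCharMap)
  star_mem' := by
    change Algebra.adjoin ℂ (Set.range torusCharMap) ≤
      star (Algebra.adjoin ℂ (Set.range torusCharMap))
    refine Algebra.adjoin_le ?_
    rintro - ⟨n, rfl⟩
    refine Algebra.subset_adjoin ⟨-n, ContinuousMap.ext fun ω => ?_⟩
    change (torusChar (-n) ω : ℂ) = star (torusChar n ω : ℂ)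
    rw [torusChar_neg, Circle.coe_inv_eq_conj]
    rfl

/-- The characters are closed under multiplication, so the algebra they generate is their linear
span. Weyl's criterion thus reduces to single characters. -/
lemma trigPoly_toSubmodule :
    Subalgebra.toSubmodule trigPoly.toSubalgebra = Submodule.span ℂ (Set.range torusCharMap) := by
  apply Algebra.adjoin_eq_span_of_subset
  refine Set.Subset.trans ?_ Submodule.subset_span
  intro x hx
  refine Submonoid.closure_induction (fun _ => id) ⟨0, ?_⟩ ?_ hx
  · ext ω
    change (torusChar 0 ω : ℂ) = 1
    rw [torusChar_zero, Circle.coe_one]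
  · rintro - - - - ⟨m, rfl⟩ ⟨n, rfl⟩
    refine ⟨m + n, ?_⟩
    ext ω
    change (torusChar (m + n) ω : ℂ) = torusChar m ω * torusChar n ω
    rw [torusChar_add, Circle.coe_mul]

lemma torusChar_single (i : Nat.Primes ⊕ ℕ) (ω : Omega1 × Omega2) :
    torusChar (Finsupp.single i 1) ω = torusCoord ω i := by
  change (Finsupp.single i (1 : ℤ)).prod (fun i e => torusCoord ω i ^ e) = _
  rw [Finsupp.prod_single_index (zpow_zero _), zpow_one]

lemma trigPoly_separatesPoints : trigPoly.SeparatesPoints := by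
  intro x y hxy
  have : ∃ i, torusCoord x i ≠ torusCoord y i := by
    by_contra! hall
    exact hxy (Prod.ext (funext fun p => hall (Sum.inl p)) (funext fun m => hall (Sum.inr m)))
  obtain ⟨i, hi⟩ := this
  refine ⟨_, ⟨torusCharMap (Finsupp.single i 1), Algebra.subset_adjoin ⟨_, rfl⟩, rfl⟩, ?_⟩
  change (torusChar (Finsupp.single i 1) x : ℂ) ≠ torusChar (Finsupp.single i 1) y
  rw [torusChar_single, torusChar_single]
  exact fun h => hi (Circle.ext h)

instance : haar1.IsMulLeftInvariant :=
  inferInstanceAs (Measure.haarMeasure (⊤ : PositiveCompacts Omega1)).IsMulLeftInvariant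

instance : haar2.IsMulLeftInvariant :=
  inferInstanceAs (Measure.haarMeasure (⊤ : PositiveCompacts Omega2)).IsMulLeftInvariant

instance : haarOmega.IsMulLeftInvariant :=
  Measure.prod.instIsMulLeftInvariant (μ := haar1) (ν := haar2)

/-- Under the linear independence condition, the points `torusPoint α (k h)` are equidistributed
on the torus. -/
theorem tendsto_empirical_torusPoint {α h : ℝ} (hh : 0 < h)
    (hL : LinearIndependent ℚ (familyL α h)) :
    Tendsto (empirical fun k : ℕ => torusPoint α (k * h)) atTop
      (𝓝 (⟨haarOmega, inferInstance⟩ : ProbabilityMeasure (Omega1 × Omega2))) := by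
  refine tendsto_empirical_of_starSubalgebra _ _ trigPoly trigPoly_separatesPoints fun F hF => ?_
  have hF' : F ∈ Submodule.span ℂ (Set.range torusCharMap) := by
    rw [← trigPoly_toSubmodule]; exact hF
  simp only [ProbabilityMeasure.coe_mk]
  have hint : ∀ F : C(Omega1 × Omega2, ℂ), Integrable F haarOmega := fun F =>
    Integrable.of_bound F.continuous.aestronglyMeasurable ‖F‖
      (Eventually.of_forall F.norm_coe_le_norm)
  induction hF' using Submodule.span_induction with
  | mem G hG =>
    obtain ⟨n, rfl⟩ := hG
    have hval : ∀ k : ℕ, torusCharMap n (torusPoint α (k * h)) =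
        (torusChar n (torusPoint α h) : ℂ) ^ k := fun k => by
      rw [torusPoint_nat_mul]
      change ((torusChar n (torusPoint α h ^ k) : Circle) : ℂ) = _
      rw [map_pow, Circle.coe_pow]
    simp only [hval]
    rcases eq_or_ne n 0 with rfl | hn
    · have h1 : ∫ ω, torusCharMap 0 ω ∂haarOmega = 1 := by
        have : ∀ ω, torusCharMap 0 ω = 1 := fun ω => by
          change (torusChar 0 ω : ℂ) = 1
          rw [torusChar_zero, Circle.coe_one]
        simp [this]
      rw [h1]
      refine tendsto_const_nhds.congr fun N => ?_
      rw [torusChar_zero]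
      have : ((N : ℂ) + 1) ≠ 0 := by exact_mod_cast N.succ_ne_zero
      simp only [Circle.coe_one, one_pow, Finset.sum_const, Finset.card_range, nsmul_eq_mul, mul_one,
        Complex.real_smul]
      push_cast
      rw [inv_mul_cancel₀ this]
    · have hne := torusChar_torusPoint_ne_one hh hL hn
      have h1 : ∫ ω, torusCharMap n ω ∂haarOmega = 0 := integral_monoidHom_eq_zero _ _ hne
      rw [h1]
      refine tendsto_average_pow (Circle.norm_coe _) fun h2 => hne (Circle.ext (by simpa using h2))
  | zero => simp
  | add F G hFs hGs ihF ihG =>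
    have hF' : F ∈ trigPoly := by
      rw [← trigPoly_toSubmodule] at hFs; exact hFs
    have hG' : G ∈ trigPoly := by
      rw [← trigPoly_toSubmodule] at hGs; exact hGs
    have := (ihF hF').add (ihG hG')
    simp only [ContinuousMap.add_apply]
    rw [integral_add (hint F) (hint G)]
    refine this.congr fun N => ?_
    rw [← smul_add, Finset.sum_add_distrib]
  | smul c F hFs ihF =>
    have hF' : F ∈ trigPoly := by
      rw [← trigPoly_toSubmodule] at hFs; exact hFs
    have := (ihF hF').const_smul c
    simp only [ContinuousMap.smul_apply]
    rw [integral_smul]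
    refine this.congr fun N => ?_
    rw [smul_comm, Finset.smul_sum]

/-! ### Orthogonality of the coordinates -/

lemma omegaExt_mul (ω ω' : Omega1) (m : ℕ) :
    omegaExt (ω * ω') m = omegaExt ω m * omegaExt ω' m := by
  simp [omegaExt, mul_pow, Finset.prod_mul_distrib]

lemma continuous_omegaExt (m : ℕ) : Continuous fun ω => omegaExt ω m :=
  continuous_finsetProd _ fun _ _ => (continuous_apply _).pow _

/-- The function `m ↦ m ^ (-it)` is completely multiplicative, so unique factorisation determines it
by its values at primes. This matches the vertical shift of `φ` with a point of the first torus. -/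
lemma omegaExt_torusPoint (α t : ℝ) {m : ℕ} (hm : m ≠ 0) :
    omegaExt (torusPoint α t).1 m = Circle.exp (-(t * Real.log m)) := by
  have h4 : -(t * Real.log m) =
      ∑ p ∈ m.primeFactors.attach, (m.factorization p.1 : ℝ) * -(t * Real.log p.1) := by
    rw [Finset.sum_attach m.primeFactors
      (fun p => (m.factorization p : ℝ) * -(t * Real.log p))]
    conv_lhs => rw [← Nat.prod_factorization_pow_eq_self hm]
    rw [Finsupp.prod, Nat.support_factorization, Nat.cast_prod, Real.log_prod]
    · rw [Finset.mul_sum, ← Finset.sum_neg_distrib]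
      refine Finset.sum_congr rfl fun p _ => ?_
      rw [Nat.cast_pow, Real.log_pow]
      ring
    · intro p hp
      have := (Nat.prime_of_mem_primeFactors hp).pos
      positivity
  rw [h4, circle_exp_sum, omegaExt]
  refine Finset.prod_congr rfl fun p _ => ?_
  rw [Circle.exp_natCast_mul]
  rfl

/-- `ω ↦ ω(k) / ω(l)` as a character of the first torus. -/
def omegaExtDiv (k l : ℕ) : Omega1 →* Circle where
  toFun ω := omegaExt ω k / omegaExt ω l
  map_one' := by simp [omegaExt]
  map_mul' ω ω' := by rw [omegaExt_mul, omegaExt_mul, mul_div_mul_comm]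

/-- `ω ↦ ω_k / ω_l` as a character of the second torus. -/
def coordDiv (k l : ℕ) : Omega2 →* Circle where
  toFun ω := ω k / ω l
  map_one' := by simp
  map_mul' ω ω' := by simp [mul_div_mul_comm]

/-- The chosen `t` makes the quotient equal to `exp (iπ) = -1`. -/
lemma circle_exp_log_div_ne_one {x y : ℝ} (hx : 0 < x) (hy : 0 < y) (hxy : x ≠ y) :
    ∃ t : ℝ, Circle.exp (-(t * Real.log x)) / Circle.exp (-(t * Real.log y)) ≠ 1 := by
  have hne : Real.log x - Real.log y ≠ 0 := sub_ne_zero.mpr fun h =>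
    hxy (Real.log_injOn_pos hx hy h)
  refine ⟨-(Real.pi / (Real.log x - Real.log y)), ?_⟩
  rw [← Circle.exp_sub]
  have : -(-(Real.pi / (Real.log x - Real.log y)) * Real.log x) -
      -(-(Real.pi / (Real.log x - Real.log y)) * Real.log y) = Real.pi := by
    field_simp
  rw [this]
  exact Circle.exp_pi_ne_one

/-- The integrand is the character `ω ↦ ω(k) / ω(l)`. It is nontrivial, since at the point `(p ^
(-it))_p` it equals `(k / l) ^ (-it)`, which is not `1` for a suitable `t`. No comparison of prime
factorisations is needed. -/
lemma integral_omegaExt_mul_conj {k l : ℕ} (hk : k ≠ 0) (hl : l ≠ 0) (hkl : k ≠ l) :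
    ∫ ω, (omegaExt ω k : ℂ) * (starRingEnd ℂ) (omegaExt ω l : ℂ) ∂haar1 = 0 := by
  obtain ⟨t, ht⟩ := circle_exp_log_div_ne_one (x := k) (y := l) (by positivity) (by positivity)
    (by exact_mod_cast hkl)
  have h1 := integral_monoidHom_eq_zero haar1 (omegaExtDiv k l) (g := (torusPoint 1 t).1) (by
    change omegaExt _ k / omegaExt _ l ≠ 1
    rw [omegaExt_torusPoint _ _ hk, omegaExt_torusPoint _ _ hl]
    exact ht)
  rw [← h1]
  refine integral_congr_ae (Eventually.of_forall fun ω => ?_)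
  simp only [omegaExtDiv, MonoidHom.coe_mk, OneHom.coe_mk]
  rw [div_eq_mul_inv, Circle.coe_mul, Circle.coe_inv_eq_conj]

/-- The point `((m + 1) ^ (-it))_m` serves only to show that the character is nontrivial; its
parameter `1` is unrelated to the `α` of the theorem. -/
lemma integral_coord_mul_conj {k l : ℕ} (hkl : k ≠ l) :
    ∫ ω : Omega2, (ω k : ℂ) * (starRingEnd ℂ) (ω l : ℂ) ∂haar2 = 0 := by
  obtain ⟨t, ht⟩ := circle_exp_log_div_ne_one (x := k + 1) (y := l + 1) (by positivity)
    (by positivity) (by simpa using hkl)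
  have h1 := integral_monoidHom_eq_zero haar2 (coordDiv k l) (g := (torusPoint 1 t).2) ht
  rw [← h1]
  refine integral_congr_ae (Eventually.of_forall fun ω => ?_)
  simp only [coordDiv, MonoidHom.coe_mk, OneHom.coe_mk]
  rw [div_eq_mul_inv, Circle.coe_mul, Circle.coe_inv_eq_conj]

/-! ### Almost sure convergence of orthogonal Dirichlet series -/

/-- The largest of the values `p m (m + n)` with `n ≤ 2 ^ j`. -/
def dyadicMax {Ω : Type*} (p : ℕ → ℕ → Ω → ℝ≥0∞) (j m : ℕ) (ω : Ω) : ℝ≥0∞ :=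
  (Finset.range (2 ^ j + 1)).sup fun n => p m (m + n) ω

lemma le_dyadicMax {Ω : Type*} (p : ℕ → ℕ → Ω → ℝ≥0∞) {j m n : ℕ} (hn : n ≤ 2 ^ j) (ω : Ω) :
    p m (m + n) ω ≤ dyadicMax p j m ω :=
  Finset.le_sup (f := fun n => p m (m + n) ω) (Finset.mem_range.mpr (Nat.lt_succ_of_le hn))

/-! ### Maximal inequality and orthogonality. -/

section Maximal

variable {Ω : Type*} [MeasurableSpace Ω] {μ : Measure Ω} {p : ℕ → ℕ → Ω → ℝ≥0∞} {v : ℕ → ℝ≥0∞}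

lemma measurable_dyadicMax (hp : ∀ m n, Measurable (p m n)) (j m : ℕ) :
    Measurable (dyadicMax p j m) := by
  unfold dyadicMax
  simp only [Finset.sup_eq_iSup]
  exact Measurable.iSup fun n => Measurable.iSup fun _ => hp _ _

/-- A maximal inequality of Rademacher–Menshov type. -/
lemma lintegral_dyadicMax_sq_le (hp : ∀ m n, Measurable (p m n))
    (htri : ∀ m k n, m ≤ k → k ≤ n → ∀ ω, p m n ω ≤ p m k ω + p k n ω)
    (hself : ∀ m ω, p m m ω = 0)
    (hsq : ∀ m n, m ≤ n → ∫⁻ ω, p m n ω ^ (2 : ℝ) ∂μ ≤ ∑ k ∈ Finset.Ico m n, v k) (j m : ℕ) :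
    (∫⁻ ω, dyadicMax p j m ω ^ (2 : ℝ) ∂μ) ^ (1 / 2 : ℝ) ≤
      (j + 1) * (∑ k ∈ Finset.Ico m (m + 2 ^ j), v k) ^ (1 / 2 : ℝ) := by
  induction j generalizing m with
  | zero =>
    simp only [pow_zero, CharP.cast_eq_zero, zero_add, one_mul]
    refine ENNReal.rpow_le_rpow ((lintegral_mono fun ω => ?_).trans (hsq m (m + 1) (by omega)))
      (by norm_num)
    refine ENNReal.rpow_le_rpow (Finset.sup_le fun n hn => ?_) (by norm_num)
    have : n = 0 ∨ n = 1 := by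
      have := Finset.mem_range.mp hn
      simp at this
      omega
    rcases this with rfl | rfl
    · rw [add_zero, hself]; exact zero_le
    · exact le_rfl
  | succ j ih =>
    set V := ∑ k ∈ Finset.Ico m (m + 2 ^ (j + 1)), v k with hV
    set V₁ := ∑ k ∈ Finset.Ico m (m + 2 ^ j), v k with hV₁
    set V₂ := ∑ k ∈ Finset.Ico (m + 2 ^ j) (m + 2 ^ j + 2 ^ j), v k with hV₂
    have h2 : m + 2 ^ (j + 1) = m + 2 ^ j + 2 ^ j := by rw [pow_succ]; omega
    have hVV : V₁ + V₂ = V := by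
      rw [hV, h2]
      exact Finset.sum_Ico_consecutive v (Nat.le_add_right _ _) (Nat.le_add_right _ _)
    -- The block is cut at its midpoint: an increment ending in the second half is the increment to
    -- the midpoint plus one that starts there.
    have hpt : ∀ ω, dyadicMax p (j + 1) m ω ≤ p m (m + 2 ^ j) ω +
        max (dyadicMax p j m ω) (dyadicMax p j (m + 2 ^ j) ω) := by
      intro ω
      refine Finset.sup_le fun n hn => ?_
      have hn' : n ≤ 2 ^ (j + 1) := Nat.lt_succ_iff.mp (Finset.mem_range.mp hn)
      rcases le_total n (2 ^ j) with hnj | hnj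
      · exact (le_dyadicMax p hnj ω).trans ((le_max_left _ _).trans le_add_self)
      · obtain ⟨i, rfl⟩ := Nat.exists_eq_add_of_le hnj
        have hi : i ≤ 2 ^ j := by rw [pow_succ] at hn'; omega
        refine (htri m (m + 2 ^ j) _ (by omega) (by omega) ω).trans ?_
        gcongr
        rw [← add_assoc]
        exact (le_dyadicMax p hi ω).trans (le_max_right _ _)
    have hmeas1 : AEMeasurable (p m (m + 2 ^ j)) μ := (hp _ _).aemeasurable
    have hmeas2 : AEMeasurable (fun ω => max (dyadicMax p j m ω) (dyadicMax p j (m + 2 ^ j) ω)) μ :=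
      ((measurable_dyadicMax hp _ _).max (measurable_dyadicMax hp _ _)).aemeasurable
    have hsplit := ENNReal.lintegral_Lp_add_le hmeas1 hmeas2 (p := 2) (by norm_num)
    -- The square of the larger half-maximum is at most the sum of the squares, and the variances
    -- `V₁` and `V₂` of the halves add up to `V`. Passing to halves therefore costs no constant
    -- factor, and each doubling adds just one to `j + 1`.
    have hmax : (∫⁻ ω, max (dyadicMax p j m ω) (dyadicMax p j (m + 2 ^ j) ω) ^ (2 : ℝ) ∂μ)
        ^ (1 / 2 : ℝ) ≤ (j + 1) * V ^ (1 / 2 : ℝ) := by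
      have h3 : ∀ m', ∫⁻ ω, dyadicMax p j m' ω ^ (2 : ℝ) ∂μ ≤
          (j + 1) ^ (2 : ℝ) * ∑ k ∈ Finset.Ico m' (m' + 2 ^ j), v k := fun m' => by
        have := ENNReal.rpow_le_rpow (ih m') (by norm_num : (0 : ℝ) ≤ 2)
        rwa [ENNReal.mul_rpow_of_nonneg _ _ (by norm_num), ← ENNReal.rpow_mul,
          ← ENNReal.rpow_mul, one_div, inv_mul_cancel₀ (by norm_num), ENNReal.rpow_one,
          ENNReal.rpow_one] at this
      have h4 : ∫⁻ ω, max (dyadicMax p j m ω) (dyadicMax p j (m + 2 ^ j) ω) ^ (2 : ℝ) ∂μ ≤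
          (j + 1) ^ (2 : ℝ) * V := by
        calc _ ≤ ∫⁻ ω, (dyadicMax p j m ω ^ (2 : ℝ) + dyadicMax p j (m + 2 ^ j) ω ^ (2 : ℝ)) ∂μ := by
              refine lintegral_mono fun ω => ?_
              rcases max_choice (dyadicMax p j m ω) (dyadicMax p j (m + 2 ^ j) ω) with h | h
              · rw [h]; exact le_self_add
              · rw [h]; exact le_add_self
          _ = _ := lintegral_add_left ((measurable_dyadicMax hp _ _).pow_const _) _
          _ ≤ _ := add_le_add (h3 m) (h3 _)
          _ = _ := by rw [← mul_add, hVV]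
      refine (ENNReal.rpow_le_rpow h4 (by norm_num)).trans (le_of_eq ?_)
      rw [ENNReal.mul_rpow_of_nonneg _ _ (by norm_num), ← ENNReal.rpow_mul]
      norm_num
    have hfirst : (∫⁻ ω, p m (m + 2 ^ j) ω ^ (2 : ℝ) ∂μ) ^ (1 / 2 : ℝ) ≤ V ^ (1 / 2 : ℝ) := by
      refine ENNReal.rpow_le_rpow ((hsq _ _ (Nat.le_add_right _ _)).trans ?_) (by norm_num)
      rw [← hVV]
      exact le_self_add
    calc _ ≤ (∫⁻ ω, (p m (m + 2 ^ j) + fun ω => max (dyadicMax p j m ω)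
          (dyadicMax p j (m + 2 ^ j) ω)) ω ^ (2 : ℝ) ∂μ) ^ (1 / 2 : ℝ) := by
          refine ENNReal.rpow_le_rpow (lintegral_mono fun ω => ?_) (by norm_num)
          exact ENNReal.rpow_le_rpow (hpt ω) (by norm_num)
      _ ≤ _ := hsplit
      _ ≤ V ^ (1 / 2 : ℝ) + (j + 1) * V ^ (1 / 2 : ℝ) := add_le_add hfirst hmax
      _ = _ := by push_cast; ring

/-- If the second moments of the increments decay polynomially faster than `1 / k`, the increments
are almost surely Cauchy. -/
theorem ae_cauchy_of_maximal [IsProbabilityMeasure μ] (hp : ∀ m n, Measurable (p m n))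
    (htri : ∀ m k n, m ≤ k → k ≤ n → ∀ ω, p m n ω ≤ p m k ω + p k n ω)
    (htri' : ∀ m k n, m ≤ k → k ≤ n → ∀ ω, p k n ω ≤ p m k ω + p m n ω)
    (hself : ∀ m ω, p m m ω = 0)
    (hsq : ∀ m n, m ≤ n → ∫⁻ ω, p m n ω ^ (2 : ℝ) ∂μ ≤ ∑ k ∈ Finset.Ico m n, v k)
    {C η : ℝ} (hC : 0 ≤ C) (hη : 0 < η)
    (hv : ∀ k, v k ≤ ENNReal.ofReal (C * (k + 1 : ℝ) ^ (-(1 + 2 * η)))) :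
    ∀ᵐ ω ∂μ, ∀ ε > 0, ∃ m₀ : ℕ, ∀ m n, m₀ ≤ m → m ≤ n → p m n ω ≤ ε := by
  set M : ℕ → Ω → ℝ≥0∞ := fun j => dyadicMax p j (2 ^ j) with hM
  have hMm : ∀ j, Measurable (M j) := fun j => measurable_dyadicMax hp _ _
  -- The block from `2 ^ j` to `2 ^ (j + 1)` has `2 ^ j` terms of size at most `C 2 ^ (-j(1 + 2η))`,
  -- with total at most `C 2 ^ (-2ηj)`. Its square root, times the factor `j + 1` of the maximal
  -- inequality, is summable in `j`.
  set w : ℕ → ℝ := fun j => (j + 1) * (√C * ((2 : ℝ) ^ (-η)) ^ j) with hw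
  have hblock : ∀ j : ℕ, ∑ k ∈ Finset.Ico (2 ^ j) (2 ^ j + 2 ^ j), v k ≤
      ENNReal.ofReal (C * (((2 : ℝ) ^ (-η)) ^ j) ^ 2) := by
    intro j
    have h2j : (0 : ℝ) < (2 : ℝ) ^ j := by positivity
    have hterm : ∀ k ∈ Finset.Ico (2 ^ j) (2 ^ j + 2 ^ j),
        v k ≤ ENNReal.ofReal (C * ((2 : ℝ) ^ j) ^ (-(1 + 2 * η))) := by
      intro k hk
      refine (hv k).trans (ENNReal.ofReal_le_ofReal ?_)
      gcongr ?_ * ?_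
      refine Real.rpow_le_rpow_of_nonpos h2j ?_ (by linarith)
      have : (2 : ℝ) ^ j ≤ k := by exact_mod_cast (Finset.mem_Ico.mp hk).1
      linarith
    refine (Finset.sum_le_sum hterm).trans (le_of_eq ?_)
    rw [Finset.sum_const, Nat.card_Ico, add_tsub_cancel_left, nsmul_eq_mul,
      ← ENNReal.ofReal_natCast, ← ENNReal.ofReal_mul (by positivity)]
    congr 1
    have h1 : ((2 : ℝ) ^ j) ^ (-(1 + 2 * η)) = ((2 : ℝ) ^ j)⁻¹ * (((2 : ℝ) ^ (-η)) ^ j) ^ 2 := by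
      have h3 : ((2 : ℝ) ^ (-η)) ^ j = ((2 : ℝ) ^ j) ^ (-η) := by
        rw [← Real.rpow_natCast, ← Real.rpow_natCast, ← Real.rpow_mul (by norm_num),
          ← Real.rpow_mul (by norm_num), mul_comm]
      rw [show -(1 + 2 * η) = -1 + (-η) + (-η) by ring, Real.rpow_add h2j, Real.rpow_add h2j,
        Real.rpow_neg_one, h3]
      ring
    rw [h1]
    push_cast
    field_simp
  have hL2 : ∀ j, (∫⁻ ω, M j ω ^ (2 : ℝ) ∂μ) ^ (1 / 2 : ℝ) ≤ ENNReal.ofReal (w j) := by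
    intro j
    refine (lintegral_dyadicMax_sq_le hp htri hself hsq j (2 ^ j)).trans ?_
    have h1 : (∑ k ∈ Finset.Ico (2 ^ j) (2 ^ j + 2 ^ j), v k) ^ (1 / 2 : ℝ) ≤
        ENNReal.ofReal (√C * ((2 : ℝ) ^ (-η)) ^ j) := by
      refine (ENNReal.rpow_le_rpow (hblock j) (by norm_num)).trans (le_of_eq ?_)
      rw [ENNReal.ofReal_rpow_of_nonneg (by positivity) (by norm_num), ← Real.sqrt_eq_rpow,
        Real.sqrt_mul hC, Real.sqrt_sq (by positivity)]
    calc _ ≤ ((j : ℝ≥0∞) + 1) * ENNReal.ofReal (√C * ((2 : ℝ) ^ (-η)) ^ j) := by gcongr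
      _ = _ := by
        rw [hw]
        simp only
        rw [ENNReal.ofReal_mul (p := (j : ℝ) + 1) (by positivity)]
        congr 1
        rw [ENNReal.ofReal_add (by positivity) (by norm_num), ENNReal.ofReal_natCast,
          ENNReal.ofReal_one]
  have hL1 : ∀ j, ∫⁻ ω, M j ω ∂μ ≤ ENNReal.ofReal (w j) := by
    intro j
    refine le_trans ?_ (hL2 j)
    have := ENNReal.lintegral_mul_le_Lp_mul_Lq μ Real.HolderConjugate.two_two
      (hMm j).aemeasurable (aemeasurable_const (b := (1 : ℝ≥0∞)))
    simpa using this
  have hws : Summable w := by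
    have h2 : ‖(2 : ℝ) ^ (-η)‖ < 1 := by
      rw [Real.norm_of_nonneg (by positivity)]
      exact Real.rpow_lt_one_of_one_lt_of_neg (by norm_num) (by linarith)
    have h3 := (summable_pow_mul_geometric_of_norm_lt_one 1 h2).add
      (summable_geometric_of_norm_lt_one h2)
    refine (h3.mul_left √C).congr fun j => ?_
    rw [hw]
    ring
  have hfin : ∫⁻ ω, ∑' j, M j ω ∂μ ≠ ∞ := by
    rw [lintegral_tsum fun j => (hMm j).aemeasurable]
    refine ne_top_of_le_ne_top ?_ (ENNReal.tsum_le_tsum hL1)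
    rw [← ENNReal.ofReal_tsum_of_nonneg (fun j => by rw [hw]; positivity) hws]
    exact ENNReal.ofReal_ne_top
  have hae := ae_lt_top (Measurable.tsum hMm) hfin
  filter_upwards [hae] with ω hω ε hε
  have htail := ENNReal.tendsto_sum_nat_add (fun j => M j ω) hω.ne
  obtain ⟨J, hJ⟩ := ((tendsto_order.1 htail).2 (ε / 2) (ENNReal.half_pos hε.ne')).exists
  -- An increment from `2 ^ J` to any `n` passes through the dyadic points in between, so the tail
  -- of the summable series of block maxima bounds it.
  have hstep : ∀ i n, 2 ^ J ≤ n → n ≤ 2 ^ (J + i) →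
      p (2 ^ J) n ω ≤ ∑ j ∈ Finset.range i, M (j + J) ω := by
    intro i
    induction i with
    | zero =>
      intro n h1 h2
      have : n = 2 ^ J := le_antisymm (by simpa using h2) h1
      rw [this, hself]
      exact zero_le
    | succ i ih =>
      intro n h1 h2
      rw [Finset.sum_range_succ]
      rcases le_total n (2 ^ (J + i)) with h3 | h3
      · exact (ih n h1 h3).trans le_self_add
      · obtain ⟨d, rfl⟩ := Nat.exists_eq_add_of_le h3
        have hd : d ≤ 2 ^ (J + i) := by
          rw [← add_assoc, pow_succ] at h2; omega
        have h4 : 2 ^ J ≤ 2 ^ (J + i) := Nat.pow_le_pow_right (by norm_num) (by omega)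
        refine (htri _ _ _ h4 (by omega) ω).trans (add_le_add (ih _ h4 le_rfl) ?_)
        rw [hM]
        simp only
        rw [add_comm i J]
        exact le_dyadicMax p hd ω
  have hbd : ∀ n, 2 ^ J ≤ n → p (2 ^ J) n ω ≤ ε / 2 := by
    intro n hn
    refine (hstep n n hn ?_).trans ((ENNReal.sum_le_tsum _).trans hJ.le)
    exact (Nat.lt_two_pow_self).le.trans (Nat.pow_le_pow_right (by norm_num) (by omega))
  refine ⟨2 ^ J, fun m n hm hmn => ?_⟩
  calc p m n ω ≤ p (2 ^ J) m ω + p (2 ^ J) n ω := htri' _ _ _ hm hmn ω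
    _ ≤ ε / 2 + ε / 2 := add_le_add (hbd m hm) (hbd n (hm.trans hmn))
    _ = ε := ENNReal.add_halves ε

lemma lintegral_enorm_sq_sum_orthonormal [IsProbabilityMeasure μ] {ξ : ℕ → Ω → ℂ}
    (hξm : ∀ k, Measurable (ξ k)) (hξ1 : ∀ k ω, ‖ξ k ω‖ = 1)
    (horth : ∀ k l, k ≠ l → ∫ ω, ξ k ω * (starRingEnd ℂ) (ξ l ω) ∂μ = 0)
    (s : Finset ℕ) (u : ℕ → ℂ) :
    ∫⁻ ω, ‖∑ k ∈ s, u k * ξ k ω‖ₑ ^ 2 ∂μ = ∑ k ∈ s, ‖u k‖ₑ ^ 2 := by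
  classical
  have hint : ∀ k l, Integrable (fun ω => u k * (starRingEnd ℂ) (u l) *
      (ξ k ω * (starRingEnd ℂ) (ξ l ω))) μ := fun k l => by
    refine Integrable.of_bound (C := ‖u k‖ * ‖u l‖) ?_ (Eventually.of_forall fun ω => ?_)
    · have h1 := hξm k
      have h2 := Complex.continuous_conj.measurable.comp (hξm l)
      exact ((h1.mul h2).const_mul _).aestronglyMeasurable
    · simp [hξ1]
  have hpt : ∀ ω, ((‖∑ k ∈ s, u k * ξ k ω‖ ^ 2 : ℝ) : ℂ) = ∑ k ∈ s, ∑ l ∈ s,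
      u k * (starRingEnd ℂ) (u l) * (ξ k ω * (starRingEnd ℂ) (ξ l ω)) := by
    intro ω
    rw [Complex.ofReal_pow, ← Complex.mul_conj', map_sum, Finset.sum_mul_sum]
    refine Finset.sum_congr rfl fun k _ => Finset.sum_congr rfl fun l _ => ?_
    rw [map_mul]
    ring
  have hval : ((∫ ω, ‖∑ k ∈ s, u k * ξ k ω‖ ^ 2 ∂μ : ℝ) : ℂ) = ((∑ k ∈ s, ‖u k‖ ^ 2 : ℝ) : ℂ) := by
    have h0 : ((∫ ω, ‖∑ k ∈ s, u k * ξ k ω‖ ^ 2 ∂μ : ℝ) : ℂ) =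
        ∫ ω, ((‖∑ k ∈ s, u k * ξ k ω‖ ^ 2 : ℝ) : ℂ) ∂μ := integral_ofReal.symm
    rw [h0]
    simp_rw [hpt]
    rw [integral_finsetSum _ fun k _ => integrable_finsetSum _ fun l _ => hint k l]
    push_cast
    refine Finset.sum_congr rfl fun k hk => ?_
    rw [integral_finsetSum _ fun l _ => hint k l]
    rw [Finset.sum_eq_single k]
    · rw [integral_const_mul]
      have : ∀ ω, ξ k ω * (starRingEnd ℂ) (ξ k ω) = 1 := fun ω => by
        rw [Complex.mul_conj', hξ1]; simp
      simp only [this, integral_const, probReal_univ, one_smul, mul_one]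
      rw [Complex.mul_conj']
    · intro l _ hlk
      rw [integral_const_mul, horth k l hlk.symm, mul_zero]
    · exact fun h => absurd hk h
  have hmeas : Measurable fun ω => ∑ k ∈ s, u k * ξ k ω :=
    Finset.measurable_fun_sum s fun k _ => (hξm k).const_mul _
  have hbint : Integrable (fun ω => ‖∑ k ∈ s, u k * ξ k ω‖ ^ 2) μ := by
    refine Integrable.of_bound (C := (∑ k ∈ s, ‖u k‖) ^ 2)
      (hmeas.norm.pow_const 2).aestronglyMeasurable (Eventually.of_forall fun ω => ?_)
    rw [Real.norm_of_nonneg (by positivity)]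
    gcongr
    refine (norm_sum_le _ _).trans (le_of_eq ?_)
    simp [hξ1]
  have h1 := ofReal_integral_eq_lintegral_ofReal hbint (Eventually.of_forall fun ω => by positivity)
  rw [Complex.ofReal_inj.mp hval, ENNReal.ofReal_sum_of_nonneg fun k _ => by positivity] at h1
  simp only [ENNReal.ofReal_pow (norm_nonneg _), ofReal_norm] at h1
  exact h1.symm

end Maximal

/-! ### Random Dirichlet series to the right of `Re s = 1/2`. -/

section RandomSeries

variable {Ω : Type*} [MeasurableSpace Ω] {μ : Measure Ω} [IsProbabilityMeasure μ] {ξ : ℕ → Ω → ℂ}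
  {a : ℕ → ℂ} {β : ℝ}

lemma dirichletSum_sub (a : ℕ → ℂ) (β : ℝ) {m n : ℕ} (hmn : m ≤ n) (s : ℂ) :
    dirichletSum a β n s - dirichletSum a β m s =
      ∑ k ∈ Finset.Ico m n, a k / ((k + β : ℝ) : ℂ) ^ s :=
  (Finset.sum_Ico_eq_sub _ hmn).symm

/-- An increment of the partial sums is measured by its `L²` norm over a square around the disc,
which dominates the supremum over the disc. Minkowski's inequality gives the triangle inequalities;
Tonelli and orthogonality give the second moments. The maximal argument then applies to these
function-valued increments as to scalars. -/
lemma ae_uniformCauchySeqOn_closedBall (hβ : 0 < β) (hβ1 : β ≤ 1)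
    (ha : ∀ ε : ℝ, 0 < ε → ∃ C : ℝ, ∀ k : ℕ, ‖a k‖ ≤ C * (k + 1 : ℝ) ^ ε)
    (hξm : ∀ k, Measurable (ξ k)) (hξ1 : ∀ k ω, ‖ξ k ω‖ = 1)
    (horth : ∀ k l, k ≠ l → ∫ ω, ξ k ω * (starRingEnd ℂ) (ξ l ω) ∂μ = 0)
    {c : ℂ} {r : ℝ} (hr : 0 < r) (hc : 1 / 2 < c.re - 2 * r) :
    ∀ᵐ ω ∂μ, UniformCauchySeqOn (fun n => dirichletSum (fun k => a k * ξ k ω) β n) atTop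
      (Metric.closedBall c r) := by
  set X := Set.Ioo (c.re - 2 * r) (c.re + 2 * r) with hX
  set Y := Set.Ioo (c.im - 2 * r) (c.im + 2 * r) with hY
  set ν : Measure (ℝ × ℝ) := (volume.restrict X).prod (volume.restrict Y) with hν
  have hν' : ν = volume.restrict (X ×ˢ Y) := by
    rw [hν, Measure.prod_restrict, Measure.volume_eq_prod]
  set u : ℕ → ℝ × ℝ → ℂ := fun k q => a k / ((k + β : ℝ) : ℂ) ^ ((q.1 : ℂ) + q.2 * Complex.I)
    with hu
  have huc : ∀ k, Continuous (u k) := fun k => by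
    have hk : ((k + β : ℝ) : ℂ) ≠ 0 := by
      have : (0 : ℝ) < k + β := by positivity
      exact_mod_cast this.ne'
    refine continuous_const.div ?_ fun q => ?_
    · exact Continuous.const_cpow (by fun_prop) (Or.inl hk)
    · simp only [ne_eq, Complex.cpow_eq_zero_iff, hk, false_and, not_false_eq_true]
  set G : ℕ → ℕ → Ω → ℝ × ℝ → ℂ := fun m n ω q => ∑ k ∈ Finset.Ico m n, u k q * ξ k ω with hG
  have hGm : ∀ m n, Measurable fun x : Ω × (ℝ × ℝ) => G m n x.1 x.2 := fun m n =>
    Finset.measurable_fun_sum _ fun k _ =>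
      ((huc k).measurable.comp measurable_snd).mul ((hξm k).comp measurable_fst)
  have hGm' : ∀ m n ω, Measurable (G m n ω) := fun m n ω =>
    Finset.measurable_fun_sum _ fun k _ => (huc k).measurable.mul_const _
  set p : ℕ → ℕ → Ω → ℝ≥0∞ := fun m n ω => (∫⁻ q, ‖G m n ω q‖ₑ ^ (2 : ℝ) ∂ν) ^ (1 / 2 : ℝ) with hp
  have hpm : ∀ m n, Measurable (p m n) := fun m n =>
    (Measurable.lintegral_prod_right' ((hGm m n).enorm.pow_const (2 : ℝ))).pow_const _
  have hpsq : ∀ m n ω, p m n ω ^ (2 : ℝ) = ∫⁻ q, ‖G m n ω q‖ₑ ^ (2 : ℝ) ∂ν := fun m n ω => by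
    rw [hp]
    simp only
    rw [← ENNReal.rpow_mul]
    norm_num
  have hmink : ∀ (F₁ F₂ F₃ : ℝ × ℝ → ℂ), Measurable F₁ → Measurable F₂ →
      (∀ q, ‖F₃ q‖ₑ ≤ ‖F₁ q‖ₑ + ‖F₂ q‖ₑ) →
      (∫⁻ q, ‖F₃ q‖ₑ ^ (2 : ℝ) ∂ν) ^ (1 / 2 : ℝ) ≤ (∫⁻ q, ‖F₁ q‖ₑ ^ (2 : ℝ) ∂ν) ^ (1 / 2 : ℝ) +
        (∫⁻ q, ‖F₂ q‖ₑ ^ (2 : ℝ) ∂ν) ^ (1 / 2 : ℝ) := by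
    intro F₁ F₂ F₃ h1 h2 h3
    refine le_trans (ENNReal.rpow_le_rpow (lintegral_mono fun q => ?_) (by norm_num))
      (ENNReal.lintegral_Lp_add_le h1.enorm.aemeasurable h2.enorm.aemeasurable
        (p := 2) (by norm_num))
    exact ENNReal.rpow_le_rpow (h3 q) (by norm_num)
  have htri : ∀ m k n, m ≤ k → k ≤ n → ∀ ω, p m n ω ≤ p m k ω + p k n ω := by
    intro m k n hmk hkn ω
    refine hmink _ _ _ (hGm' m k ω) (hGm' k n ω) fun q => ?_
    rw [hG]
    simp only
    rw [← Finset.sum_Ico_consecutive _ hmk hkn]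
    exact enorm_add_le _ _
  have htri' : ∀ m k n, m ≤ k → k ≤ n → ∀ ω, p k n ω ≤ p m k ω + p m n ω := by
    intro m k n hmk hkn ω
    refine hmink _ _ _ (hGm' m k ω) (hGm' m n ω) fun q => ?_
    have : G k n ω q = G m n ω q - G m k ω q := by
      rw [hG]
      simp only
      rw [← Finset.sum_Ico_consecutive _ hmk hkn, add_sub_cancel_left]
    rw [this, add_comm]
    exact enorm_sub_le
  have hself : ∀ m ω, p m m ω = 0 := fun m ω => by
    simp [hp, hG]
  -- The left side of the square is at abscissa `1/2 + 2η`. With coefficients `O(k ^ η)` the squared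
  -- terms are `O(k ^ (2(η - 1/2 - 2η))) = O(k ^ (-(1 + 2η)))`.
  set η := (c.re - 2 * r - 1 / 2) / 2 with hη
  have hη0 : 0 < η := by rw [hη]; linarith
  obtain ⟨Ca, hCa⟩ := ha η hη0
  have hCa0 : 0 ≤ Ca := by have := (norm_nonneg _).trans (hCa 0); simpa using this
  set x₁ := c.re + 2 * r with hx₁
  set B := Ca * β ^ (-x₁) with hB
  have hB0 : 0 ≤ B := by have := Real.rpow_nonneg hβ.le (-x₁); positivity
  have hubd : ∀ k, ∀ q ∈ X ×ˢ Y, ‖u k q‖ ^ 2 ≤ B ^ 2 * (k + 1 : ℝ) ^ (-(1 + 2 * η)) := by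
    rintro k ⟨x, y⟩ ⟨hx, -⟩
    have hk : (0 : ℝ) < k + β := by positivity
    have hk1 : (0 : ℝ) < k + 1 := by positivity
    have hk1' : (1 : ℝ) ≤ k + 1 := by linarith [(Nat.cast_nonneg k : (0 : ℝ) ≤ k)]
    have hx0 : 0 ≤ x := by linarith [hx.1]
    have h1 : ‖u k (x, y)‖ ≤ B * (k + 1 : ℝ) ^ (η - (c.re - 2 * r)) := by
      rw [hu]
      simp only
      rw [norm_div_ofReal_cpow _ hk]
      simp only [Complex.add_re, Complex.ofReal_re, Complex.mul_re, Complex.I_re, mul_zero,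
        Complex.ofReal_im, Complex.I_im, mul_one, sub_self, add_zero]
      calc ‖a k‖ * (k + β : ℝ) ^ (-x) ≤
            (Ca * (k + 1 : ℝ) ^ η) * (β ^ (-x) * (k + 1 : ℝ) ^ (-x)) := by
            gcongr
            · exact hCa k
            · exact shift_rpow_neg_le hβ hβ1 hx0 k
        _ ≤ (Ca * (k + 1 : ℝ) ^ η) * (β ^ (-x₁) * (k + 1 : ℝ) ^ (-(c.re - 2 * r))) := by
            gcongr ?_ * (?_ * ?_)
            · exact Real.rpow_le_rpow_of_exponent_ge hβ hβ1 (by linarith [hx.2])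
            · exact Real.rpow_le_rpow_of_exponent_le hk1' (by linarith [hx.1])
        _ = B * ((k + 1 : ℝ) ^ η * (k + 1 : ℝ) ^ (-(c.re - 2 * r))) := by rw [hB]; ring
        _ = _ := by rw [← Real.rpow_add hk1, ← sub_eq_add_neg]
    calc _ ≤ (B * (k + 1 : ℝ) ^ (η - (c.re - 2 * r))) ^ 2 := by gcongr
      _ = B ^ 2 * (k + 1 : ℝ) ^ (-(1 + 2 * η)) := by
        rw [mul_pow, ← Real.rpow_natCast, ← Real.rpow_natCast, ← Real.rpow_mul hk1.le]
        congr 2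
        push_cast
        rw [hη]
        ring
  set C := (4 * r) * (4 * r) * B ^ 2 with hC
  have hνuniv : ν Set.univ = ENNReal.ofReal ((4 * r) * (4 * r)) := by
    rw [hν, ← Set.univ_prod_univ, Measure.prod_prod, Measure.restrict_apply_univ,
      Measure.restrict_apply_univ, hX, hY, Real.volume_Ioo, Real.volume_Ioo,
      ENNReal.ofReal_mul (by positivity)]
    congr 2 <;> ring
  have hsq : ∀ m n, m ≤ n → ∫⁻ ω, p m n ω ^ (2 : ℝ) ∂μ ≤
      ∑ k ∈ Finset.Ico m n, ENNReal.ofReal (C * (k + 1 : ℝ) ^ (-(1 + 2 * η))) := by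
    intro m n _
    simp only [hpsq]
    rw [lintegral_lintegral_swap ((hGm m n).enorm.pow_const (2 : ℝ)).aemeasurable]
    have h1 : ∀ q, ∫⁻ ω, ‖G m n ω q‖ₑ ^ (2 : ℝ) ∂μ = ∑ k ∈ Finset.Ico m n, ‖u k q‖ₑ ^ 2 := by
      intro q
      rw [← lintegral_enorm_sq_sum_orthonormal hξm hξ1 horth (Finset.Ico m n) fun k => u k q]
      simp only [ENNReal.rpow_two, hG]
    simp only [h1]
    rw [lintegral_finsetSum _ fun k _ => ((huc k).measurable.enorm.pow_const 2)]
    refine Finset.sum_le_sum fun k _ => ?_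
    calc ∫⁻ q, ‖u k q‖ₑ ^ 2 ∂ν ≤
          ∫⁻ q, ENNReal.ofReal (B ^ 2 * (k + 1 : ℝ) ^ (-(1 + 2 * η))) ∂ν := by
          rw [hν']
          refine setLIntegral_mono' (measurableSet_Ioo.prod measurableSet_Ioo) fun q hq => ?_
          rw [← ofReal_norm, ← ENNReal.ofReal_pow (norm_nonneg _)]
          exact ENNReal.ofReal_le_ofReal (hubd k q hq)
      _ = _ := by
          rw [lintegral_const, hνuniv, ← ENNReal.ofReal_mul (by positivity)]
          congr 1
          rw [hC]
          ring
  have hfin := ae_cauchy_of_maximal hpm htri htri' hself hsq (by positivity) hη0 fun k => le_rfl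
  filter_upwards [hfin] with ω hω
  have hdiff : ∀ m n, m ≤ n → ∀ q : ℝ × ℝ,
      dirichletSum (fun k => a k * ξ k ω) β n (q.1 + q.2 * Complex.I) -
        dirichletSum (fun k => a k * ξ k ω) β m (q.1 + q.2 * Complex.I) = G m n ω q := by
    intro m n hmn q
    rw [dirichletSum_sub _ _ hmn]
    refine Finset.sum_congr rfl fun k _ => ?_
    rw [hu]
    ring
  have hunif : ∀ ε > 0, ∃ m₀ : ℕ, ∀ m n, m₀ ≤ m → m ≤ n → ∀ z ∈ Metric.closedBall c r,
      ‖dirichletSum (fun k => a k * ξ k ω) β n z - dirichletSum (fun k => a k * ξ k ω) β m z‖ ≤ ε := by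
    intro ε hε
    -- The area mean inequality gives `π r² |·|² ≤ (rε)²`, and `π ≥ 1` leaves `|·| ≤ ε`.
    obtain ⟨m₀, hm₀⟩ := hω (ENNReal.ofReal (r * ε)) (by simpa using mul_pos hr hε)
    refine ⟨m₀, fun m n hm hmn z hz => ?_⟩
    have h1 := enorm_sq_mul_le_lintegral_square (g := fun s =>
      dirichletSum (fun k => a k * ξ k ω) β n s - dirichletSum (fun k => a k * ξ k ω) β m s) hr
      (((differentiable_dirichletSum _ hβ n).sub
        (differentiable_dirichletSum _ hβ m)).differentiableOn) hz
    have h2 : ∫⁻ x in X, ∫⁻ y in Y, ‖dirichletSum (fun k => a k * ξ k ω) β n (x + y * Complex.I) -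
        dirichletSum (fun k => a k * ξ k ω) β m (x + y * Complex.I)‖ₑ ^ 2 = p m n ω ^ (2 : ℝ) := by
      rw [hpsq, hν, lintegral_prod _ ((hGm' m n ω).enorm.pow_const (2 : ℝ)).aemeasurable]
      refine lintegral_congr fun x => lintegral_congr fun y => ?_
      rw [← hdiff m n hmn (x, y), ENNReal.rpow_two]
    have h3 := h1.trans (h2.le.trans (ENNReal.rpow_le_rpow (hm₀ m n hm hmn)
      (by norm_num : (0 : ℝ) ≤ 2)))
    rw [ENNReal.rpow_two, ← ofReal_norm, ← ENNReal.ofReal_pow (norm_nonneg _),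
      ← ENNReal.ofReal_pow (by positivity), ← ENNReal.ofReal_mul (by positivity),
      ENNReal.ofReal_le_ofReal_iff (by positivity)] at h3
    refine le_of_sq_le_sq ?_ hε.le
    have hr2 : 0 < r ^ 2 := by positivity
    refine le_of_mul_le_mul_left (a := r ^ 2) ?_ hr2
    calc _ ≤ Real.pi * r ^ 2 * _ := by
          gcongr
          exact le_mul_of_one_le_left hr2.le (by linarith [Real.pi_gt_three])
      _ ≤ _ := h3
      _ = _ := by ring
  rw [Metric.uniformCauchySeqOn_iff]
  intro ε hε
  obtain ⟨m₀, hm₀⟩ := hunif (ε / 2) (by linarith)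
  refine ⟨m₀, fun m hm n hn z hz => ?_⟩
  rw [dist_eq_norm]
  rcases le_total m n with h | h
  · rw [norm_sub_rev]; linarith [hm₀ m n hm h z hz]
  · linarith [hm₀ n m hn h z hz]

/-- An orthogonal Dirichlet series with coefficients of size `k ^ ε` converges almost surely in
`H(D)` for every open `D` in the half-plane `Re s > 1 / 2`. -/
theorem ae_exists_tendsto_hol (hβ : 0 < β) (hβ1 : β ≤ 1)
    (ha : ∀ ε : ℝ, 0 < ε → ∃ C : ℝ, ∀ k : ℕ, ‖a k‖ ≤ C * (k + 1 : ℝ) ^ ε)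
    (hξm : ∀ k, Measurable (ξ k)) (hξ1 : ∀ k ω, ‖ξ k ω‖ = 1)
    (horth : ∀ k l, k ≠ l → ∫ ω, ξ k ω * (starRingEnd ℂ) (ξ l ω) ∂μ = 0)
    (D : Opens ℂ) (hD : ∀ s ∈ D, 1 / 2 < s.re) :
    ∀ᵐ ω ∂μ, ∃ F : Hol D, Tendsto (fun n : ℕ => Hol.ofFun (G := D)
      (dirichletSum (fun k => a k * ξ k ω) β n)
      (differentiable_dirichletSum _ hβ n).differentiableOn) atTop (𝓝 F) := by
  set r : ℂ → ℝ := fun c => (c.re - 1 / 2) / 4 with hr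
  have hr0 : ∀ c ∈ D, 0 < r c := fun c hc => by
    have := hD c hc
    simp only [hr]; linarith
  -- A countable subcover, so that the exceptional null sets of the single discs form a null set.
  obtain ⟨t, htD, htc, hcov⟩ := TopologicalSpace.countable_cover_nhdsWithin (s := (D : Set ℂ))
    (f := fun c => Metric.ball c (r c))
    fun c hc => mem_nhdsWithin_of_mem_nhds (Metric.ball_mem_nhds c (hr0 c hc))
  have hall : ∀ᵐ ω ∂μ, ∀ c ∈ t, UniformCauchySeqOn
      (fun n => dirichletSum (fun k => a k * ξ k ω) β n) atTop (Metric.closedBall c (r c)) := by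
    rw [ae_ball_iff htc]
    intro c hc
    refine ae_uniformCauchySeqOn_closedBall hβ hβ1 ha hξm hξ1 horth (hr0 c (htD hc)) ?_
    have := hD c (htD hc)
    simp only [hr]; linarith
  filter_upwards [hall] with ω hω
  set S : ℕ → ℂ → ℂ := fun n => dirichletSum (fun k => a k * ξ k ω) β n with hS
  have hpt : ∀ z ∈ D, ∃ w, Tendsto (fun n => S n z) atTop (𝓝 w) := by
    intro z hz
    obtain ⟨c, hc, hzc⟩ := Set.mem_iUnion₂.mp (hcov hz)
    exact cauchySeq_tendsto_of_complete ((hω c hc).cauchySeq (Metric.ball_subset_closedBall hzc))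
  choose! L hL using hpt
  have hball : ∀ z ∈ D, ∃ c ∈ t, z ∈ Metric.ball c (r c) ∧
      TendstoUniformlyOn S L atTop (Metric.closedBall c (r c) ∩ D) := by
    intro z hz
    obtain ⟨c, hc, hzc⟩ := Set.mem_iUnion₂.mp (hcov hz)
    refine ⟨c, hc, hzc, ?_⟩
    exact ((hω c hc).mono Set.inter_subset_left).tendstoUniformlyOn_of_tendsto
      fun x hx => hL x hx.2
  have hloc : TendstoLocallyUniformlyOn S L atTop (D : Set ℂ) := by
    intro V hV z hz
    obtain ⟨c, hc, hzc, hu⟩ := hball z hz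
    refine ⟨Metric.closedBall c (r c) ∩ D, ?_, hu V hV⟩
    exact inter_mem (mem_nhdsWithin_of_mem_nhds (Filter.mem_of_superset
      (Metric.isOpen_ball.mem_nhds hzc) Metric.ball_subset_closedBall)) self_mem_nhdsWithin
  have hLd : DifferentiableOn ℂ L D := hloc.differentiableOn
    (Eventually.of_forall fun n => (differentiable_dirichletSum _ hβ n).differentiableOn) D.isOpen
  refine ⟨Hol.ofFun L hLd, ?_⟩
  have : LocallyCompactSpace D := D.isOpen.locallyCompactSpace
  refine tendsto_subtype_rng.mpr ?_
  refine ContinuousMap.tendsto_iff_tendstoLocallyUniformly.mpr ?_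
  exact (tendstoLocallyUniformlyOn_iff_tendstoLocallyUniformly_comp_coe).mp hloc

end RandomSeries

/-! ### Weak convergence through approximation in measure -/

open Classical in
/-- If `x` is approximated in measure by sequences `y n` whose empirical measures have limits
`μ n`, and if `μ n` tends to `μ`, then the empirical measures of `x` tend to `μ`. -/
theorem tendsto_empirical_of_approx {X : Type*} [UniformSpace X]
    [(uniformity X).IsCountablyGenerated] [MeasurableSpace X] [OpensMeasurableSpace X]
    {x : ℕ → X} {y : ℕ → ℕ → X} {μ : ℕ → ProbabilityMeasure X} {ρ : ProbabilityMeasure X}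
    (hy : ∀ n, Tendsto (empirical (y n)) atTop (𝓝 (μ n))) (hμ : Tendsto μ atTop (𝓝 ρ))
    (hxy : ∀ V ∈ uniformity X, ∀ ε : ℝ, 0 < ε → ∀ᶠ n in atTop, ∀ᶠ N : ℕ in atTop,
      (((Finset.range (N + 1)).filter fun k => (x k, y n k) ∉ V).card : ℝ) ≤ ε * (N + 1)) :
    Tendsto (empirical x) atTop (𝓝 ρ) := by
  -- The metric is auxiliary: it makes bounded Lipschitz functions available as test functions for
  -- weak convergence.
  let _ : PseudoMetricSpace X := UniformSpace.pseudoMetricSpace X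
  rw [tendsto_iff_forall_lipschitz_integral_tendsto]
  intro f hfb hfL
  have hy' := fun n => tendsto_iff_forall_lipschitz_integral_tendsto.mp (hy n) f hfb hfL
  have hμ' := tendsto_iff_forall_lipschitz_integral_tendsto.mp hμ f hfb hfL
  obtain ⟨C, hC⟩ := hfb
  obtain ⟨L, hL⟩ := hfL
  have hfm : StronglyMeasurable f := hL.continuous.stronglyMeasurable
  have hC0 : 0 ≤ C := dist_nonneg.trans (hC (x 0) (x 0))
  simp only [integral_empirical _ _ hfm] at hy' ⊢
  rw [Metric.tendsto_atTop]
  intro ε hε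
  -- Good indices cost at most `Lδ` each, bad ones at most `C` on a proportion `η`. Adding `1` to
  -- `L` and `C` avoids division by zero.
  set δ := ε / (4 * (L + 1)) with hδ
  have hδ0 : 0 < δ := by positivity
  set η := ε / (4 * (C + 1)) with hη
  have hη0 : 0 < η := by positivity
  have hV := hxy _ (Metric.dist_mem_uniformity hδ0) η hη0
  obtain ⟨n, hn1, hn2⟩ := (hV.and (hμ'.eventually (Metric.ball_mem_nhds _
    (by linarith : 0 < ε / 4)))).exists
  rw [← eventually_atTop]
  filter_upwards [hn1, (hy' n).eventually (Metric.ball_mem_nhds _ (by linarith : 0 < ε / 4))]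
    with N hN1 hN2
  set bad := (Finset.range (N + 1)).filter fun k => (x k, y n k) ∉ {p : X × X | dist p.1 p.2 < δ}
    with hbad
  have hterm : ∀ k ∈ Finset.range (N + 1), ‖f (x k) - f (y n k)‖ ≤
      L * δ + if k ∈ bad then C else 0 := by
    intro k hk
    rw [← dist_eq_norm]
    by_cases hkb : k ∈ bad
    · rw [if_pos hkb]
      exact (hC _ _).trans (le_add_of_nonneg_left (by positivity))
    · rw [if_neg hkb, add_zero]
      have : dist (x k) (y n k) < δ := by
        by_contra hcon
        exact hkb (Finset.mem_filter.mpr ⟨hk, hcon⟩)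
      exact (hL.dist_le_mul _ _).trans (by gcongr)
  have hsum : ∑ k ∈ Finset.range (N + 1), ‖f (x k) - f (y n k)‖ ≤
      (N + 1 : ℕ) * (L * δ + C * η) := by
    refine (Finset.sum_le_sum hterm).trans ?_
    rw [Finset.sum_add_distrib, Finset.sum_const, Finset.card_range, nsmul_eq_mul,
      ← Finset.sum_filter, Finset.sum_const, nsmul_eq_mul, mul_add]
    refine add_le_add le_rfl ?_
    have hsub : (Finset.range (N + 1)).filter (· ∈ bad) = bad := by
      ext k
      simp only [Finset.mem_filter, and_iff_right_iff_imp]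
      exact fun h => (Finset.mem_filter.mp h).1
    rw [hsub]
    have hcard : (bad.card : ℝ) ≤ η * (N + 1) := hN1
    calc (bad.card : ℝ) * C ≤ η * (N + 1) * C := mul_le_mul_of_nonneg_right hcard hC0
      _ = ((N + 1 : ℕ) : ℝ) * (C * η) := by push_cast; ring
  have h1 : dist (((N + 1 : ℕ) : ℝ)⁻¹ • ∑ k ∈ Finset.range (N + 1), f (x k))
      (((N + 1 : ℕ) : ℝ)⁻¹ • ∑ k ∈ Finset.range (N + 1), f (y n k)) ≤ L * δ + C * η := by
    rw [dist_eq_norm, ← smul_sub, ← Finset.sum_sub_distrib, norm_smul, norm_inv,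
      Real.norm_natCast, inv_mul_le_iff₀ (by positivity)]
    exact (norm_sum_le _ _).trans hsum
  have h2 : L * δ ≤ ε / 4 := by
    have : (L : ℝ) * δ = ε / 4 * (L / (L + 1)) := by rw [hδ]; field_simp
    rw [this]
    refine mul_le_of_le_one_right (by linarith) ?_
    rw [div_le_one (by positivity)]
    linarith
  have h3 : C * η ≤ ε / 4 := by
    have : C * η = ε / 4 * (C / (C + 1)) := by rw [hη]; field_simp
    rw [this]
    refine mul_le_of_le_one_right (by linarith) ?_
    rw [div_le_one (by positivity)]
    linarith
  calc _ ≤ _ := dist_triangle4 _ (((N + 1 : ℕ) : ℝ)⁻¹ • ∑ k ∈ Finset.range (N + 1), f (y n k))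
        (∫ ω, f ω ∂(μ n : Measure X)) _
    _ < ε := by
      have := Metric.mem_ball.mp hN2
      have := Metric.mem_ball.mp hn2
      linarith

/-- Almost sure convergence implies convergence of the distributions. -/
lemma tendsto_map_of_ae_tendsto {Ω X : Type*} [MeasurableSpace Ω] {P : Measure Ω}
    [IsProbabilityMeasure P] [TopologicalSpace X] [MeasurableSpace X] [OpensMeasurableSpace X]
    {Z : ℕ → Ω → X} {W : Ω → X} (hZ : ∀ n, AEMeasurable (Z n) P) (hW : AEMeasurable W P)
    (hlim : ∀ᵐ ω ∂P, Tendsto (fun n => Z n ω) atTop (𝓝 (W ω))) :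
    Tendsto (β := ProbabilityMeasure X)
      (fun n => ⟨P.map (Z n), Measure.isProbabilityMeasure_map (hZ n)⟩) atTop
      (𝓝 (⟨P.map W, Measure.isProbabilityMeasure_map hW⟩ : ProbabilityMeasure X)) := by
  refine ProbabilityMeasure.tendsto_iff_forall_integral_tendsto.mpr fun F => ?_
  change Tendsto (fun n => ∫ x, F x ∂(P.map (Z n))) atTop (𝓝 (∫ x, F x ∂(P.map W)))
  have hmap : ∀ {V : Ω → X}, AEMeasurable V P → ∫ x, F x ∂(P.map V) = ∫ ω, F (V ω) ∂P := fun hV =>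
    integral_map hV F.continuous.aestronglyMeasurable
  rw [hmap hW]
  simp only [hmap (hZ _)]
  refine tendsto_integral_of_dominated_convergence (fun _ => ‖F‖) (fun n => ?_)
    (integrable_const _) (fun n => Eventually.of_forall fun ω => F.norm_coe_le_norm _) ?_
  · exact (F.continuous.measurable.comp_aemeasurable (hZ n)).aestronglyMeasurable
  · filter_upwards [hlim] with ω hω
    exact (F.continuous.tendsto _).comp hω

lemma tendsto_empirical_comp {X Y : Type*} [TopologicalSpace X] [MeasurableSpace X]
    [BorelSpace X] [TopologicalSpace Y] [MeasurableSpace Y] [BorelSpace Y] {x : ℕ → X}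
    {μ : Measure X} [IsProbabilityMeasure μ] {f : X → Y} (hf : Continuous f)
    (hx : Tendsto (empirical x) atTop (𝓝 (⟨μ, inferInstance⟩ : ProbabilityMeasure X))) :
    Tendsto (empirical fun k => f (x k)) atTop
      (𝓝 (⟨μ.map f, Measure.isProbabilityMeasure_map hf.aemeasurable⟩ :
        ProbabilityMeasure Y)) := by
  have h := ProbabilityMeasure.tendsto_map_of_tendsto_of_continuous _ _ hx hf
  refine h.congr fun N => (Subtype.ext ?_).symm
  change ((N + 1 : ℕ) : ℝ≥0∞)⁻¹ • ∑ k ∈ Finset.range (N + 1), Measure.dirac (f (x k)) =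
    Measure.map f (((N + 1 : ℕ) : ℝ≥0∞)⁻¹ •
    ∑ k ∈ Finset.range (N + 1), Measure.dirac (x k))
  rw [Measure.map_smul, Measure.map_finset_sum hf.aemeasurable]
  simp only [Measure.map_dirac' hf.measurable]

/-! ### The uniform structure of `H(D)` -/

instance (G : Opens ℂ) : UniformSpace (Hol G) :=
  inferInstanceAs (UniformSpace
    {f : C(G, ℂ) // ∃ F : ℂ → ℂ, DifferentiableOn ℂ F G ∧ ∀ z : G, f z = F z})

instance (G : Opens ℂ) : (uniformity (Hol G)).IsCountablyGenerated :=
  haveI : LocallyCompactSpace G := G.isOpen.locallyCompactSpace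
  inferInstanceAs (comap (fun q : Hol G × Hol G => (q.1.1, q.2.1))
    (uniformity C(G, ℂ))).IsCountablyGenerated

instance (G : Opens ℂ) : T2Space (Hol G) :=
  inferInstanceAs (T2Space
    {f : C(G, ℂ) // ∃ F : ℂ → ℂ, DifferentiableOn ℂ F G ∧ ∀ z : G, f z = F z})

/-- The uniformity is induced from `C(G, ℂ)`, where it is that of compact convergence. An entourage
is thus controlled by closeness on one compact set. -/
lemma exists_compact_of_mem_uniformity_hol {G : Opens ℂ} {U : Set (Hol G × Hol G)}
    (hU : U ∈ uniformity (Hol G)) :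
    ∃ K : Set ℂ, IsCompact K ∧ K ⊆ G ∧ ∃ δ > 0, ∀ P Q : Hol G,
      (∀ z : G, (z : ℂ) ∈ K → ‖P.1 z - Q.1 z‖ < δ) → (P, Q) ∈ U := by
  obtain ⟨U', hU', hsub⟩ := hU
  obtain ⟨K, W, hK, hW, hKW⟩ := (ContinuousMap.mem_compactConvergence_entourage_iff U').mp hU'
  obtain ⟨δ, hδ, hδW⟩ := Metric.mem_uniformity_dist.mp hW
  refine ⟨Subtype.val '' K, hK.image continuous_subtype_val, ?_, δ, hδ, fun P Q hPQ => ?_⟩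
  · rintro _ ⟨z, _, rfl⟩
    exact z.2
  · refine hsub (hKW fun z hz => hδW ?_)
    rw [dist_eq_norm]
    exact hPQ z ⟨z, hz, rfl⟩

lemma continuous_hol_of_uncurry {X : Type*} [TopologicalSpace X] {G : Opens ℂ} {F : X → ℂ → ℂ}
    (hF : ∀ x, DifferentiableOn ℂ (F x) G)
    (hc : Continuous fun q : X × G => F q.1 q.2) :
    Continuous fun x => Hol.ofFun (G := G) (F x) (hF x) := by
  refine Continuous.subtype_mk ?_ _
  exact ContinuousMap.continuous_of_continuous_uncurry _ hc

/-! ### The limit theorem, given the approximation by partial sums -/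

/-- The shift multiplies the `k`-th coefficient by the unimodular number `(k + β) ^ (-it)`, a
coordinate of a torus point when `β = α` and a product of coordinates when `β = 1`. -/
lemma dirichletSum_twist (a : ℕ → ℂ) {β : ℝ} (hβ : 0 < β) (n : ℕ) (z : ℂ) (t : ℝ) :
    dirichletSum a β n (z + t * Complex.I) =
      dirichletSum (fun k => a k * (Circle.exp (-(t * Real.log (k + β))) : ℂ)) β n z := by
  refine Finset.sum_congr rfl fun k _ => ?_
  have hk : (0 : ℝ) < k + β := by positivity
  have hk0 : ((k + β : ℝ) : ℂ) ≠ 0 := by exact_mod_cast hk.ne'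
  change _ = a k * (Circle.exp (-(t * Real.log (k + β))) : ℂ) / ((k + β : ℝ) : ℂ) ^ z
  rw [Complex.cpow_add _ _ hk0, Circle.coe_exp, mul_comm (_ ^ z), ← div_div]
  congr 1
  rw [div_eq_mul_inv, ← Complex.cpow_neg, Complex.cpow_def_of_ne_zero hk0,
    ← Complex.ofReal_log hk.le]
  congr 2
  push_cast
  ring

lemma continuous_dirichletSum_uncurry {X : Type*} [TopologicalSpace X] {A : X → ℕ → ℂ}
    (hA : ∀ k, Continuous fun x => A x k) {β : ℝ} (hβ : 0 < β) (n : ℕ) (G : Opens ℂ) :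
    Continuous fun q : X × G => dirichletSum (A q.1) β n q.2 := by
  refine continuous_finsetSum _ fun k _ => ?_
  have hk : ((k + β : ℝ) : ℂ) ≠ 0 := by
    have : (0 : ℝ) < k + β := by positivity
    exact_mod_cast this.ne'
  refine Continuous.div ((hA k).comp continuous_fst) ?_ fun q => ?_
  · exact Continuous.const_cpow (by fun_prop) (Or.inl hk)
  · simp only [ne_eq, Complex.cpow_eq_zero_iff, hk, false_and, not_false_eq_true]

namespace MatsumotoZeta

variable (Φ : MatsumotoZeta)

/-- Re-indexing by `k + 1` makes the series of `φ` the case `β = 1`, so one theory serves both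
series. -/
lemma partialSum_eq (D : Opens ℂ) (ω : Omega1) (n : ℕ) : Φ.partialSum D ω n = Hol.ofFun
    (dirichletSum (fun k => Φ.c (k + 1) * (omegaExt ω (k + 1) : ℂ)) 1 n)
    (differentiable_dirichletSum _ one_pos n).differentiableOn := by
  refine Subtype.ext (ContinuousMap.ext fun z => ?_)
  change ∑ k ∈ Finset.Icc 1 n, Φ.c k * (omegaExt ω k : ℂ) / (k : ℂ) ^ (z : ℂ) =
    ∑ k ∈ Finset.range n, Φ.c (k + 1) * (omegaExt ω (k + 1) : ℂ) / ((k + 1 : ℝ) : ℂ) ^ (z : ℂ)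
  induction n with
  | zero => simp
  | succ n ih =>
    rw [Finset.sum_Icc_succ_top (by omega), ih, Finset.sum_range_succ]
    push_cast
    rfl

end MatsumotoZeta

lemma half_lt_re_of_mem_hurwitzDomain {α : ℝ} {q : ℕ} {b : ℕ → ℂ} {s : ℂ}
    (hs : s ∈ hurwitzDomain α q b) : 1 / 2 < s.re := by
  unfold hurwitzDomain at hs
  split_ifs at hs
  · exact hs
  · exact hs.1

open Classical in
/-- For large `n`, the proportion of the shifts `k τ` for which `f` is not `δ`-close on `K` to
the `n`-th partial sum of its Dirichlet series is eventually at most `ε`. -/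
def ApproxInMeasure (f : ℂ → ℂ) (a : ℕ → ℂ) (β τ : ℝ) (K : Set ℂ) (δ ε : ℝ) : Prop :=
  ∀ᶠ n in atTop, ∀ᶠ N : ℕ in atTop, (((Finset.range (N + 1)).filter fun k : ℕ => ∃ z ∈ K,
    δ ≤ ‖f (z + (k * τ : ℝ) * Complex.I) -
      dirichletSum a β n (z + (k * τ : ℝ) * Complex.I)‖).card : ℝ) ≤ ε * (N + 1)

open Classical in
/-- The limit theorem, under the hypothesis that both functions are approximated in measure by
the partial sums of their Dirichlet series. -/
theorem limit_theorem_of_approx (Φ : MatsumotoZeta)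
    {α : ℝ} (hα₀ : 0 < α) (hα₁ : α ≤ 1) {q : ℕ} (hq : 0 < q) {b : ℕ → ℂ}
    {h : ℝ} (hh : 0 < h) (hL : LinearIndependent ℚ (familyL α h))
    {D₁ D₂ : Opens ℂ} (hD₁ : (D₁ : Set ℂ) ⊆ Φ.domain)
    (hD₂ : (D₂ : Set ℂ) ⊆ hurwitzDomain α q b)
    (hc : ∀ ε : ℝ, 0 < ε → ∃ C : ℝ, ∀ k : ℕ, ‖Φ.c (k + 1)‖ ≤ C * (k + 1 : ℝ) ^ ε)
    (hb : ∀ ε : ℝ, 0 < ε → ∃ C : ℝ, ∀ k : ℕ, ‖b k‖ ≤ C * (k + 1 : ℝ) ^ ε)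
    (happ₁ : ∀ K : Set ℂ, IsCompact K → K ⊆ D₁ → ∀ δ ε : ℝ, 0 < δ → 0 < ε →
      ApproxInMeasure Φ.φ (fun k => Φ.c (k + 1)) 1 h K δ ε)
    (happ₂ : ∀ K : Set ℂ, IsCompact K → K ⊆ D₂ → ∀ δ ε : ℝ, 0 < δ → 0 < ε →
      ApproxInMeasure (periodicHurwitz α q b) b α h K δ ε) :
    (∀ᵐ ω ∂haarOmega,
      Tendsto (Φ.partialSum D₁ ω.1) atTop (𝓝 (randomZ Φ hα₀ b D₁ D₂ ω).1) ∧
      Tendsto (hurwitzPartialSum hα₀ b D₂ ω.2) atTop (𝓝 (randomZ Φ hα₀ b D₁ D₂ ω).2)) ∧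
    ∃ hZ : AEMeasurable (randomZ Φ hα₀ b D₁ D₂) haarOmega,
      Tendsto (fun N : ℕ => empirical (fun k : ℕ => shiftZ Φ hq hD₁ hD₂ (k * h)) N) atTop
        (𝓝 (⟨haarOmega.map (randomZ Φ hα₀ b D₁ D₂), Measure.isProbabilityMeasure_map hZ⟩ :
          ProbabilityMeasure (Hol D₁ × Hol D₂))) := by
  have hhalf₁ : ∀ s ∈ D₁, 1 / 2 < s.re := fun s hs => Φ.half_le.trans_lt (hD₁ hs).1
  have hhalf₂ : ∀ s ∈ D₂, 1 / 2 < s.re := fun s hs => half_lt_re_of_mem_hurwitzDomain (hD₂ hs)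
  have h₁ : ∀ᵐ ω ∂haar1, Tendsto (Φ.partialSum D₁ ω) atTop (𝓝 (Φ.random D₁ ω)) := by
    filter_upwards [ae_exists_tendsto_hol (μ := haar1) (ξ := fun k ω => (omegaExt ω (k + 1) : ℂ))
      one_pos le_rfl hc
      (fun k => (continuous_subtype_val.comp (continuous_omegaExt _)).measurable)
      (fun k ω => Circle.norm_coe _)
      (fun k l hkl => integral_omegaExt_mul_conj k.succ_ne_zero l.succ_ne_zero (by omega))
      D₁ hhalf₁] with ω hω
    refine tendsto_nhds_limUnder ?_
    obtain ⟨F, hF⟩ := hω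
    exact ⟨F, hF.congr fun n => (Φ.partialSum_eq D₁ ω n).symm⟩
  have h₂ : ∀ᵐ ω ∂haar2,
      Tendsto (hurwitzPartialSum hα₀ b D₂ ω) atTop (𝓝 (hurwitzRandom hα₀ b D₂ ω)) := by
    filter_upwards [ae_exists_tendsto_hol (μ := haar2) (ξ := fun k ω => (ω k : ℂ))
      hα₀ hα₁ hb (fun k => (continuous_subtype_val.comp (continuous_apply k)).measurable)
      (fun k ω => Circle.norm_coe _) (fun k l hkl => integral_coord_mul_conj hkl)
      D₂ hhalf₂] with ω hω
    exact tendsto_nhds_limUnder hω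
  have hae : ∀ᵐ ω ∂haarOmega,
      Tendsto (Φ.partialSum D₁ ω.1) atTop (𝓝 (randomZ Φ hα₀ b D₁ D₂ ω).1) ∧
      Tendsto (hurwitzPartialSum hα₀ b D₂ ω.2) atTop (𝓝 (randomZ Φ hα₀ b D₁ D₂ ω).2) :=
    (Measure.quasiMeasurePreserving_fst.ae h₁).and (Measure.quasiMeasurePreserving_snd.ae h₂)
  refine ⟨hae, ?_⟩
  set Z : ℕ → Omega1 × Omega2 → Hol D₁ × Hol D₂ :=
    fun n ω => (Φ.partialSum D₁ ω.1 n, hurwitzPartialSum hα₀ b D₂ ω.2 n) with hZdef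
  have hZc : ∀ n, Continuous (Z n) := by
    intro n
    refine Continuous.prodMk ?_ ?_
    · simp only [Φ.partialSum_eq]
      refine continuous_hol_of_uncurry _ (continuous_dirichletSum_uncurry
        (A := fun ω : Omega1 × Omega2 => fun k => Φ.c (k + 1) * (omegaExt ω.1 (k + 1) : ℂ))
        (fun k => ?_) one_pos n D₁)
      exact continuous_const.mul (continuous_subtype_val.comp
        ((continuous_omegaExt _).comp continuous_fst))
    · refine continuous_hol_of_uncurry _ (continuous_dirichletSum_uncurry
        (A := fun ω : Omega1 × Omega2 => fun k => b k * (ω.2 k : ℂ)) (fun k => ?_) hα₀ n D₂)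
      exact continuous_const.mul (continuous_subtype_val.comp
        ((continuous_apply k).comp continuous_snd))
  have hlim : ∀ᵐ ω ∂haarOmega, Tendsto (fun n => Z n ω) atTop (𝓝 (randomZ Φ hα₀ b D₁ D₂ ω)) := by
    filter_upwards [hae] with ω hω
    exact hω.1.prodMk_nhds hω.2
  have hZm : AEMeasurable (randomZ Φ hα₀ b D₁ D₂) haarOmega := by
    let _ : PseudoMetricSpace (Hol D₁ × Hol D₂) := UniformSpace.pseudoMetricSpace _
    exact aemeasurable_of_tendsto_metrizable_ae atTop (fun n => (hZc n).aemeasurable) hlim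
  refine ⟨hZm, ?_⟩
  refine tendsto_empirical_of_approx
    (fun n => tendsto_empirical_comp (hZc n) (tendsto_empirical_torusPoint hh hL))
    (tendsto_map_of_ae_tendsto (fun n => (hZc n).aemeasurable) hZm hlim) ?_
  intro V hV ε hε
  obtain ⟨V₁, hV₁, V₂, hV₂, hVV⟩ := entourageProd_subset hV
  obtain ⟨K₁, hK₁, hKD₁, δ₁, hδ₁, hclose₁⟩ := exists_compact_of_mem_uniformity_hol hV₁
  obtain ⟨K₂, hK₂, hKD₂, δ₂, hδ₂, hclose₂⟩ := exists_compact_of_mem_uniformity_hol hV₂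
  filter_upwards [happ₁ K₁ hK₁ hKD₁ δ₁ (ε / 2) hδ₁ (by linarith),
    happ₂ K₂ hK₂ hKD₂ δ₂ (ε / 2) hδ₂ (by linarith)] with n hn₁ hn₂
  filter_upwards [hn₁, hn₂] with N hN₁ hN₂
  -- A product of entourages fails only if one coordinate fails. After the twist, `Z n` at the torus
  -- point is the pair of partial sums at the shifted arguments.
  have hsub : ((Finset.range (N + 1)).filter fun k : ℕ =>
      (shiftZ Φ hq hD₁ hD₂ (k * h), Z n (torusPoint α (k * h))) ∉ V) ⊆
      ((Finset.range (N + 1)).filter fun k : ℕ => ∃ z ∈ K₁, δ₁ ≤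
        ‖Φ.φ (z + (k * h : ℝ) * Complex.I) -
          dirichletSum (fun k => Φ.c (k + 1)) 1 n (z + (k * h : ℝ) * Complex.I)‖) ∪
      ((Finset.range (N + 1)).filter fun k : ℕ => ∃ z ∈ K₂, δ₂ ≤
        ‖periodicHurwitz α q b (z + (k * h : ℝ) * Complex.I) -
          dirichletSum b α n (z + (k * h : ℝ) * Complex.I)‖) := by
    intro k hk
    rw [Finset.mem_filter] at hk
    by_contra hcon
    simp only [Finset.mem_union, Finset.mem_filter, hk.1, true_and, not_or, not_exists, not_and,
      not_le] at hcon
    refine hk.2 (hVV ⟨hclose₁ _ _ fun z hz => ?_, hclose₂ _ _ fun z hz => ?_⟩)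
    · have := hcon.1 z hz
      rw [dirichletSum_twist _ one_pos] at this
      rw [Φ.partialSum_eq]
      change ‖Φ.φ (z + (k * h : ℝ) * Complex.I) - dirichletSum (fun m => Φ.c (m + 1) *
        (omegaExt (torusPoint α (k * h)).1 (m + 1) : ℂ)) 1 n z‖ < δ₁
      simp only [omegaExt_torusPoint α _ (Nat.succ_ne_zero _)]
      push_cast at this ⊢
      exact this
    · have := hcon.2 z hz
      rw [dirichletSum_twist _ hα₀] at this
      exact this
  calc _ ≤ _ := Nat.cast_le.mpr ((Finset.card_le_card hsub).trans (Finset.card_union_le _ _))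
    _ ≤ ε / 2 * (N + 1) + ε / 2 * (N + 1) := by
      rw [Nat.cast_add]
      exact add_le_add hN₁ hN₂
    _ = ε * (N + 1) := by ring

/-! ### Multiplying out the Euler product -/

/-- The sum of the moduli of the terms of the power series `P` at radius `r` is at most `M`. -/
def AbsSumLE (P : PowerSeries ℂ) (r M : ℝ) : Prop :=
  Summable (fun n => ‖PowerSeries.coeff n P‖ * r ^ n) ∧
    ∑' n, ‖PowerSeries.coeff n P‖ * r ^ n ≤ M

/-- The power series `P` takes the value `v` at `x`. -/
def HasEval (P : PowerSeries ℂ) (x v : ℂ) : Prop :=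
  HasSum (fun n => PowerSeries.coeff n P * x ^ n) v

lemma AbsSumLE.norm_coeff_le {P : PowerSeries ℂ} {r M : ℝ} (h : AbsSumLE P r M) (hr : 0 ≤ r)
    (n : ℕ) : ‖PowerSeries.coeff n P‖ * r ^ n ≤ M :=
  (h.1.le_tsum n fun _ _ => by positivity).trans h.2

lemma AbsSumLE.summable_norm {P : PowerSeries ℂ} {r M : ℝ} (h : AbsSumLE P r M) {x : ℂ}
    (hx : ‖x‖ ≤ r) : Summable fun n => ‖PowerSeries.coeff n P * x ^ n‖ := by
  refine h.1.of_nonneg_of_le (fun n => norm_nonneg _) fun n => ?_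
  rw [norm_mul, norm_pow]
  gcongr

lemma AbsSumLE.mul {P Q : PowerSeries ℂ} {r M M' : ℝ} (hr : 0 ≤ r) (hP : AbsSumLE P r M)
    (hQ : AbsSumLE Q r M') : AbsSumLE (P * Q) r (M * M') := by
  have hP' : Summable fun n => ‖‖PowerSeries.coeff n P‖ * r ^ n‖ := by
    simpa [abs_of_nonneg hr] using hP.1
  have hQ' : Summable fun n => ‖‖PowerSeries.coeff n Q‖ * r ^ n‖ := by
    simpa [abs_of_nonneg hr] using hQ.1
  have hs := (summable_norm_sum_mul_antidiagonal_of_summable_norm hP' hQ').of_norm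
  have hle : ∀ n, ‖PowerSeries.coeff n (P * Q)‖ * r ^ n ≤
      ∑ kl ∈ Finset.HasAntidiagonal.antidiagonal n, ‖PowerSeries.coeff kl.1 P‖ * r ^ kl.1 *
        (‖PowerSeries.coeff kl.2 Q‖ * r ^ kl.2) := by
    intro n
    rw [PowerSeries.coeff_mul]
    refine (mul_le_mul_of_nonneg_right (norm_sum_le _ _) (by positivity)).trans ?_
    rw [Finset.sum_mul]
    refine Finset.sum_le_sum fun kl hkl => ?_
    rw [← Finset.HasAntidiagonal.mem_antidiagonal.mp hkl, norm_mul, pow_add]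
    exact le_of_eq (by ring)
  have hsum := hs.of_nonneg_of_le (fun n => by positivity) hle
  refine ⟨hsum, (hsum.tsum_le_tsum hle hs).trans ?_⟩
  rw [← tsum_mul_tsum_eq_tsum_sum_antidiagonal_of_summable_norm hP' hQ']
  exact mul_le_mul hP.2 hQ.2 (tsum_nonneg fun n => by positivity)
    ((tsum_nonneg fun n => by positivity).trans hP.2)

lemma HasEval.mul {P Q : PowerSeries ℂ} {r M M' : ℝ} (hP : AbsSumLE P r M)
    (hQ : AbsSumLE Q r M') {x v w : ℂ} (hx : ‖x‖ ≤ r) (hv : HasEval P x v) (hw : HasEval Q x w) :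
    HasEval (P * Q) x (v * w) := by
  have h1 := hP.summable_norm hx
  have h2 := hQ.summable_norm hx
  have hs := (summable_norm_sum_mul_antidiagonal_of_summable_norm h1 h2).of_norm
  have heq := tsum_mul_tsum_eq_tsum_sum_antidiagonal_of_summable_norm h1 h2
  rw [hv.tsum_eq, hw.tsum_eq] at heq
  rw [heq]
  refine Eq.subst (motive := fun F => HasSum F _) (funext fun n => ?_) hs.hasSum
  rw [PowerSeries.coeff_mul, Finset.sum_mul]
  refine Finset.sum_congr rfl fun kl hkl => ?_
  rw [← Finset.HasAntidiagonal.mem_antidiagonal.mp hkl, pow_add]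
  ring

/-- The inverse of `1 - a X ^ f` is a geometric series. -/
lemma inv_one_sub_eq_mk (a : ℂ) {f : ℕ} (hf : 0 < f) :
    (1 - PowerSeries.C a * PowerSeries.X ^ f : PowerSeries ℂ)⁻¹ =
      PowerSeries.mk fun n => if f ∣ n then a ^ (n / f) else 0 := by
  symm
  rw [PowerSeries.eq_inv_iff_mul_eq_one (by simp [hf.ne'])]
  ext n
  rw [mul_sub, mul_one, mul_left_comm, map_sub, PowerSeries.coeff_C_mul,
    PowerSeries.coeff_mul_X_pow', PowerSeries.coeff_one]
  simp only [PowerSeries.coeff_mk]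
  rcases Nat.eq_zero_or_pos n with rfl | hn
  · simp [hf.ne']
  by_cases hfn : f ≤ n
  · rw [if_pos hfn, if_neg hn.ne']
    by_cases hd : f ∣ n
    · obtain ⟨k, rfl⟩ := hd
      obtain ⟨k, rfl⟩ : ∃ j, k = j + 1 := ⟨k - 1, by
        have : k ≠ 0 := by rintro rfl; simp at hn
        omega⟩
      have h1 : f * (k + 1) - f = f * k := by rw [mul_add, mul_one, Nat.add_sub_cancel]
      rw [h1, if_pos (dvd_mul_right _ _), if_pos (dvd_mul_right _ _),
        Nat.mul_div_cancel_left _ hf, Nat.mul_div_cancel_left _ hf]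
      ring
    · have : ¬ f ∣ n - f := fun h => hd (by
        have := Nat.dvd_add h (dvd_refl f)
        rwa [Nat.sub_add_cancel hfn] at this)
      rw [if_neg hd, if_neg this]
      simp
  · have hd : ¬ f ∣ n := fun h => hfn (Nat.le_of_dvd hn h)
    rw [if_neg hfn, if_neg hd, if_neg hn.ne']
    simp

lemma hasEval_inv_one_sub (a : ℂ) {f : ℕ} (hf : 0 < f) {x : ℂ} (hx : ‖a * x ^ f‖ < 1) :
    HasEval (1 - PowerSeries.C a * PowerSeries.X ^ f : PowerSeries ℂ)⁻¹ x
      (1 - a * x ^ f)⁻¹ := by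
  rw [inv_one_sub_eq_mk a hf, HasEval]
  have hinj : Function.Injective fun k : ℕ => f * k := fun k l h => Nat.eq_of_mul_eq_mul_left hf h
  rw [← hinj.hasSum_iff]
  · refine Eq.subst (motive := fun F => HasSum F _) (funext fun k => ?_)
      (hasSum_geometric_of_norm_lt_one hx)
    simp only [Function.comp_apply, PowerSeries.coeff_mk, dvd_mul_right, if_true,
      Nat.mul_div_cancel_left _ hf]
    rw [mul_pow, pow_mul]
  · intro n hn
    have : ¬ f ∣ n := fun ⟨k, hk⟩ => hn ⟨k, hk.symm⟩
    simp [this]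

lemma absSumLE_inv_one_sub (a : ℂ) {f : ℕ} (hf : 0 < f) {r ρ : ℝ} (hr : 0 ≤ r)
    (hρ : ‖a‖ * r ^ f ≤ ρ) (hρ1 : ρ < 1) :
    AbsSumLE (1 - PowerSeries.C a * PowerSeries.X ^ f : PowerSeries ℂ)⁻¹ r (1 - ρ)⁻¹ := by
  have h0 : 0 ≤ ‖a‖ * r ^ f := by positivity
  have hs : HasSum (fun n => ‖PowerSeries.coeff n
      (1 - PowerSeries.C a * PowerSeries.X ^ f : PowerSeries ℂ)⁻¹‖ * r ^ n)
      (1 - ‖a‖ * r ^ f)⁻¹ := by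
    rw [inv_one_sub_eq_mk a hf]
    have hinj : Function.Injective fun k : ℕ => f * k :=
      fun k l h => Nat.eq_of_mul_eq_mul_left hf h
    rw [← hinj.hasSum_iff]
    · refine Eq.subst (motive := fun F => HasSum F _) (funext fun k => ?_)
        (hasSum_geometric_of_lt_one h0 (hρ.trans_lt hρ1))
      simp only [Function.comp_apply, PowerSeries.coeff_mk, dvd_mul_right, if_true,
        Nat.mul_div_cancel_left _ hf]
      rw [mul_pow, pow_mul, norm_pow]
    · intro n hn
      have : ¬ f ∣ n := fun ⟨k, hk⟩ => hn ⟨k, hk.symm⟩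
      simp [this]
  refine ⟨hs.summable, ?_⟩
  rw [hs.tsum_eq]
  exact inv_anti₀ (by linarith) (by linarith)

lemma absSumLE_one (r : ℝ) : AbsSumLE 1 r 1 := by
  have : HasSum (fun n => ‖PowerSeries.coeff n (1 : PowerSeries ℂ)‖ * r ^ n) 1 := by
    refine Eq.subst (motive := fun F => HasSum F _) (funext fun n => ?_)
      (hasSum_ite_eq (0 : ℕ) (1 : ℝ))
    rw [PowerSeries.coeff_one]
    split_ifs with h <;> simp [h]
  exact ⟨this.summable, this.tsum_eq.le⟩

lemma hasEval_one (x : ℂ) : HasEval 1 x 1 := by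
  refine Eq.subst (motive := fun F => HasSum F _) (funext fun n => ?_)
    (hasSum_ite_eq (0 : ℕ) (1 : ℂ))
  rw [PowerSeries.coeff_one]
  split_ifs with h <;> simp [h]

/-- Each factor is majorised by a geometric series with sum at most `(1 - ρ)⁻¹`, and absolute sums
are submultiplicative under the Cauchy product. Absolute convergence also lets evaluation commute
with multiplication. -/
lemma absSumLE_prod_inv {ι : Type*} (s : Finset ι) {a : ι → ℂ} {f : ι → ℕ} (hf : ∀ j, 0 < f j)
    {r ρ : ℝ} (hr : 0 ≤ r) (hρ : ∀ j, ‖a j‖ * r ^ f j ≤ ρ) (hρ1 : ρ < 1) :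
    AbsSumLE (∏ j ∈ s, (1 - PowerSeries.C (a j) * PowerSeries.X ^ f j) : PowerSeries ℂ)⁻¹ r
      ((1 - ρ)⁻¹ ^ s.card) ∧
    ∀ x : ℂ, ‖x‖ ≤ r →
      HasEval (∏ j ∈ s, (1 - PowerSeries.C (a j) * PowerSeries.X ^ f j) : PowerSeries ℂ)⁻¹ x
        (∏ j ∈ s, (1 - a j * x ^ f j)⁻¹) := by
  classical
  induction s using Finset.induction_on with
  | empty =>
    simp only [Finset.prod_empty, Finset.card_empty, pow_zero]
    have : (1 : PowerSeries ℂ)⁻¹ = 1 := by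
      rw [eq_comm, PowerSeries.eq_inv_iff_mul_eq_one (by simp), one_mul]
    rw [this]
    exact ⟨absSumLE_one r, fun x _ => hasEval_one x⟩
  | insert j s hj ih =>
    rw [Finset.prod_insert hj, PowerSeries.mul_inv_rev, Finset.card_insert_of_notMem hj, pow_succ]
    have hG := absSumLE_inv_one_sub (a j) (hf j) hr (hρ j) hρ1
    refine ⟨ih.1.mul hr hG, fun x hx => ?_⟩
    rw [Finset.prod_insert hj, mul_comm (1 - a j * x ^ f j)⁻¹]
    refine HasEval.mul ih.1 hG hx (ih.2 x hx) (hasEval_inv_one_sub _ (hf j) ?_)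
    rw [norm_mul, norm_pow]
    refine lt_of_le_of_lt ?_ ((hρ j).trans_lt hρ1)
    gcongr

namespace EulerData

variable (E : EulerData)

/-- The base is at most `1`, so the exponent `f = 1` is the worst, and there the factors `p ^ B`
cancel. -/
lemma mul_rpow_pow_le (p : Nat.Primes) (j : Fin (E.g p)) {ε : ℝ} (hε : 0 < ε) :
    ‖E.a p j‖ * ((p : ℝ) ^ (-(E.A + E.B + ε))) ^ E.f p j ≤ (p : ℝ) ^ (-(E.A + ε)) := by
  have hp1 : (1 : ℝ) ≤ p := by exact_mod_cast p.2.one_lt.le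
  have hp0 : (0 : ℝ) < p := by linarith
  have h1 : (p : ℝ) ^ (-(E.A + E.B + ε)) ≤ 1 :=
    Real.rpow_le_one_of_one_le_of_nonpos hp1 (by linarith [E.A_nonneg, E.B_nonneg])
  calc _ ≤ (p : ℝ) ^ E.B * ((p : ℝ) ^ (-(E.A + E.B + ε))) ^ 1 := by
        refine mul_le_mul (E.a_le p j) ?_ (by positivity) (by positivity)
        exact pow_le_pow_of_le_one (by positivity) h1 (E.f_pos p j)
    _ = _ := by
        rw [pow_one, ← Real.rpow_add hp0]
        congr 1
        ring

lemma rpow_neg_lt_one (p : Nat.Primes) {ε : ℝ} (hε : 0 < ε) : (p : ℝ) ^ (-(E.A + ε)) < 1 :=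
  Real.rpow_lt_one_of_one_lt_of_neg (by exact_mod_cast p.2.one_lt) (by linarith [E.A_nonneg])

/-- The bound for the power series at `p`. -/
lemma absSumLE_localSeries (p : Nat.Primes) {ε : ℝ} (hε : 0 < ε) :
    AbsSumLE (E.localSeries p) ((p : ℝ) ^ (-(E.A + E.B + ε)))
      ((1 - (p : ℝ) ^ (-(E.A + ε)))⁻¹ ^ E.g p) := by
  have h := (absSumLE_prod_inv Finset.univ (E.f_pos p) (by positivity)
    (fun j => E.mul_rpow_pow_le p j hε) (E.rpow_neg_lt_one p hε)).1
  rwa [Finset.card_univ, Fintype.card_fin] at h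

lemma hasEval_localSeries (p : Nat.Primes) {w : ℂ} (hw : E.A + E.B < w.re) :
    HasEval (E.localSeries p) ((p : ℂ) ^ (-w))
      (∏ j : Fin (E.g p), (1 - E.a p j * (p : ℂ) ^ (-(w * E.f p j)))⁻¹) := by
  have hε : 0 < w.re - (E.A + E.B) := by linarith
  have h := (absSumLE_prod_inv Finset.univ (E.f_pos p) (by positivity)
    (fun j => E.mul_rpow_pow_le p j hε) (E.rpow_neg_lt_one p hε)).2 ((p : ℂ) ^ (-w)) (by
      rw [Complex.norm_natCast_cpow_of_pos p.2.pos]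
      refine le_of_eq ?_
      congr 1
      simp)
  refine Eq.subst (motive := HasEval _ _) (Finset.prod_congr rfl fun j _ => ?_) h
  rw [← Complex.cpow_mul_nat, neg_mul]

/-- For `ρ ≤ 1/2` one has `(1 - ρ)⁻¹ ≤ exp (2ρ)`, and `g(p) ρ ≤ C₁ p ^ (-ε) ≤ C₁`. The power is
therefore at most `exp (2C₁)`, which `p ^ ε` exceeds for large `p`. -/
lemma exists_localBound_le {ε : ℝ} (hε : 0 < ε) : ∃ P₀ : ℕ, ∀ p : Nat.Primes, P₀ ≤ p →
    (1 - (p : ℝ) ^ (-(E.A + ε)))⁻¹ ^ E.g p ≤ (p : ℝ) ^ ε := by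
  have h1 : Tendsto (fun n : ℕ => (n : ℝ) ^ (-(E.A + ε))) atTop (𝓝 0) :=
    (tendsto_rpow_neg_atTop (by linarith [E.A_nonneg])).comp tendsto_natCast_atTop_atTop
  have h2 : Tendsto (fun n : ℕ => (n : ℝ) ^ ε) atTop atTop :=
    (tendsto_rpow_atTop hε).comp tendsto_natCast_atTop_atTop
  obtain ⟨P₀, hP₀⟩ := eventually_atTop.mp ((h1.eventually_le_const (by norm_num : (0 : ℝ) < 1 / 2)).and
    (h2.eventually_ge_atTop (Real.exp (2 * E.C₁))))
  refine ⟨P₀, fun p hp => ?_⟩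
  obtain ⟨hp1, hp2⟩ := hP₀ p hp
  set ρ := (p : ℝ) ^ (-(E.A + ε)) with hρ
  have hp1' : (1 : ℝ) ≤ p := by exact_mod_cast p.2.one_lt.le
  have hp0 : (0 : ℝ) < p := by linarith
  have hρ0 : 0 ≤ ρ := by positivity
  have h3 : (1 - ρ)⁻¹ ≤ Real.exp (2 * ρ) := by
    have : (1 - ρ)⁻¹ ≤ 1 + 2 * ρ := by
      rw [inv_le_iff_one_le_mul₀ (by linarith)]
      nlinarith
    linarith [Real.add_one_le_exp (2 * ρ)]
  calc (1 - ρ)⁻¹ ^ E.g p ≤ Real.exp (2 * ρ) ^ E.g p := by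
        have : 0 ≤ (1 - ρ)⁻¹ := inv_nonneg.mpr (by linarith)
        gcongr
    _ = Real.exp (E.g p * (2 * ρ)) := by rw [← Real.exp_nat_mul]
    _ ≤ Real.exp (2 * E.C₁) := by
        refine Real.exp_le_exp.mpr ?_
        calc (E.g p : ℝ) * (2 * ρ) ≤ (E.C₁ * (p : ℝ) ^ E.A) * (2 * ρ) := by
              gcongr
              exact E.g_le p
          _ = 2 * E.C₁ * (p : ℝ) ^ (-ε) := by
              have : (p : ℝ) ^ E.A * ρ = (p : ℝ) ^ (-ε) := by
                rw [hρ, ← Real.rpow_add hp0]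
                congr 1
                ring
              rw [← this]
              ring
          _ ≤ 2 * E.C₁ * 1 := by
              have := E.C₁_pos
              gcongr
              exact Real.rpow_le_one_of_one_le_of_nonpos hp1' (by linarith)
          _ = 2 * E.C₁ := mul_one _
    _ ≤ _ := hp2

/-- The coefficient of `X ^ e` in the Euler factor at `n`, and `1` if `n` is not a prime. -/
def localCoeff (n e : ℕ) : ℂ :=
  if hn : n.Prime then PowerSeries.coeff e (E.localSeries ⟨n, hn⟩) else 1

lemma cTilde_eq_prod (k : ℕ) : E.cTilde k = k.factorization.prod E.localCoeff := by
  rw [cTilde, Finsupp.prod, Nat.support_factorization, ← Finset.prod_attach k.primeFactors]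
  refine Finset.prod_congr rfl fun p _ => ?_
  rw [localCoeff, dif_pos (Nat.prime_of_mem_primeFactors p.2)]
  rfl

lemma cTilde_one : E.cTilde 1 = 1 := by simp [cTilde_eq_prod]

lemma cTilde_mul {m n : ℕ} (hmn : m.Coprime n) :
    E.cTilde (m * n) = E.cTilde m * E.cTilde n := by
  rw [cTilde_eq_prod, cTilde_eq_prod, cTilde_eq_prod, Nat.factorization_mul_of_coprime hmn,
    Finsupp.prod_add_index_of_disjoint]
  simpa [Nat.support_factorization] using hmn.disjoint_primeFactors

lemma constantCoeff_localSeries (p : Nat.Primes) :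
    PowerSeries.coeff 0 (E.localSeries p) = 1 := by
  rw [localSeries, PowerSeries.coeff_zero_eq_constantCoeff_apply, PowerSeries.constantCoeff_inv,
    map_prod]
  simp [(E.f_pos p _).ne']

lemma cTilde_prime_pow (p : Nat.Primes) (e : ℕ) :
    E.cTilde ((p : ℕ) ^ e) = PowerSeries.coeff e (E.localSeries p) := by
  have h0 : E.localCoeff p 0 = 1 := by
    rw [localCoeff, dif_pos p.2]
    exact E.constantCoeff_localSeries p
  rw [cTilde_eq_prod, p.2.factorization_pow, Finsupp.prod_single_index h0, localCoeff,
    dif_pos p.2]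
  rfl

/-- The local bound is used with `ε / 2`, which leaves a spare factor `p ^ (εe / 2)` at the prime
power `p ^ e`. For all but finitely many primes this absorbs the local constant; the remaining
primes contribute a bounded product. -/
lemma exists_norm_cTilde_le {ε : ℝ} (hε : 0 < ε) :
    ∃ C : ℝ, 0 ≤ C ∧ ∀ k : ℕ, k ≠ 0 → ‖E.cTilde k‖ ≤ C * (k : ℝ) ^ (E.A + E.B + ε) := by
  obtain ⟨P₀, hP₀⟩ := E.exists_localBound_le (half_pos hε)
  -- The maximum with `1` lets the product over the small prime factors of `k` be extended to all `n
  -- < P₀` without decreasing.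
  set M : ℕ → ℝ := fun n => if n < P₀ then max 1 ((1 - (n : ℝ) ^ (-(E.A + ε / 2)))⁻¹ ^
    (if hn : n.Prime then E.g ⟨n, hn⟩ else 0)) else 1 with hM
  have hM1 : ∀ n, 1 ≤ M n := fun n => by
    simp only [hM]
    split_ifs <;> simp
  have hlocal : ∀ p ≠ 0, ∀ e ≠ 0, p.Prime →
      ‖E.localCoeff p e‖ ≤ M p * ((p ^ e : ℕ) : ℝ) ^ (E.A + E.B + ε) := by
    intro p hp0' e he hp
    have hp1 : (1 : ℝ) ≤ p := by exact_mod_cast hp.one_lt.le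
    have hp0 : (0 : ℝ) < p := by linarith
    have he1 : (1 : ℝ) ≤ e := by exact_mod_cast Nat.one_le_iff_ne_zero.mpr he
    have h1 := (E.absSumLE_localSeries ⟨p, hp⟩ (half_pos hε)).norm_coeff_le (by positivity) e
    rw [localCoeff, dif_pos hp]
    change _ * ((p : ℝ) ^ (-(E.A + E.B + ε / 2))) ^ e ≤
      (1 - (p : ℝ) ^ (-(E.A + ε / 2)))⁻¹ ^ E.g ⟨p, hp⟩ at h1
    rw [← Real.rpow_mul_natCast hp0.le, neg_mul, Real.rpow_neg hp0.le, ← div_eq_mul_inv,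
      div_le_iff₀ (by positivity)] at h1
    have hpow : ((p ^ e : ℕ) : ℝ) ^ (E.A + E.B + ε) =
        (p : ℝ) ^ (ε / 2 * e) * (p : ℝ) ^ ((E.A + E.B + ε / 2) * e) := by
      push_cast
      rw [← Real.rpow_natCast, ← Real.rpow_mul hp0.le, ← Real.rpow_add hp0]
      congr 1
      ring
    rw [hpow, ← mul_assoc]
    refine h1.trans (mul_le_mul_of_nonneg_right ?_ (by positivity))
    by_cases hpP : p < P₀
    · have : (1 - (p : ℝ) ^ (-(E.A + ε / 2)))⁻¹ ^ E.g ⟨p, hp⟩ ≤ M p := by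
        simp only [hM, if_pos hpP, dif_pos hp]
        exact le_max_right _ _
      exact this.trans (le_mul_of_one_le_right (zero_le_one.trans (hM1 p))
        (Real.one_le_rpow hp1 (by positivity)))
    · have h2 : M p = 1 := by simp only [hM, if_neg hpP]
      rw [h2, one_mul]
      refine (hP₀ ⟨p, hp⟩ (not_lt.mp hpP)).trans (Real.rpow_le_rpow_of_exponent_le hp1 ?_)
      nlinarith
  refine ⟨∏ n ∈ Finset.range P₀, M n, Finset.prod_nonneg fun n _ => zero_le_one.trans (hM1 n),
    fun k hk => ?_⟩
  have hprod : ∏ p ∈ k.primeFactors, ((p ^ k.factorization p : ℕ) : ℝ) ^ (E.A + E.B + ε) =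
      (k : ℝ) ^ (E.A + E.B + ε) := by
    rw [Real.finsetProd_rpow _ _ fun p _ => Nat.cast_nonneg _, ← Nat.cast_prod]
    congr 2
    conv_rhs => rw [← Nat.prod_factorization_pow_eq_self hk]
    rfl
  have hMprod : ∏ p ∈ k.primeFactors, M p ≤ ∏ n ∈ Finset.range P₀, M n := by
    have h1 : ∏ p ∈ k.primeFactors, M p = ∏ p ∈ k.primeFactors.filter (· < P₀), M p := by
      rw [Finset.prod_filter]
      refine Finset.prod_congr rfl fun p _ => ?_
      split_ifs with h
      · rfl
      · simp only [hM, if_neg h]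
    rw [h1]
    have hsub : k.primeFactors.filter (· < P₀) ⊆ Finset.range P₀ := fun p hp =>
      Finset.mem_range.mpr (Finset.mem_filter.mp hp).2
    rw [← Finset.prod_sdiff hsub]
    refine le_mul_of_one_le_left (Finset.prod_nonneg fun n _ => zero_le_one.trans (hM1 n)) ?_
    calc (1 : ℝ) = ∏ n ∈ Finset.range P₀ \ k.primeFactors.filter (· < P₀), (1 : ℝ) :=
          Finset.prod_const_one.symm
      _ ≤ _ := Finset.prod_le_prod (fun _ _ => zero_le_one) fun n _ => hM1 n
  rw [cTilde_eq_prod, Finsupp.prod, Nat.support_factorization, norm_prod, ← hprod]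
  refine (Finset.prod_le_prod (fun _ _ => norm_nonneg _) fun p hp => ?_).trans
    (Finset.prod_mul_distrib.le.trans (mul_le_mul_of_nonneg_right hMprod
      (Finset.prod_nonneg fun _ _ => by positivity)))
  have hp' := Nat.prime_of_mem_primeFactors hp
  exact hlocal p hp'.ne_zero _ (Finsupp.mem_support_iff.mp
    (by rwa [Nat.support_factorization])) hp'

lemma exists_norm_c_le {ε : ℝ} (hε : 0 < ε) :
    ∃ C : ℝ, ∀ k : ℕ, ‖E.c (k + 1)‖ ≤ C * (k + 1 : ℝ) ^ ε := by
  obtain ⟨C, hC0, hC⟩ := E.exists_norm_cTilde_le hε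
  refine ⟨C, fun k => ?_⟩
  have hk : (0 : ℝ) < ((k + 1 : ℕ) : ℝ) := by positivity
  rw [c, norm_mul, Complex.norm_real, Real.norm_of_nonneg (by positivity)]
  calc _ ≤ (((k + 1 : ℕ) : ℝ) ^ (-E.A - E.B)) * (C * ((k + 1 : ℕ) : ℝ) ^ (E.A + E.B + ε)) := by
        gcongr
        exact hC _ k.succ_ne_zero
    _ = C * ((k + 1 : ℕ) : ℝ) ^ ε := by
        rw [mul_left_comm, ← Real.rpow_add hk]
        congr 2
        ring
    _ = _ := by push_cast; rfl

lemma c_div_cpow {k : ℕ} (hk : k ≠ 0) (s : ℂ) :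
    E.c k / (k : ℂ) ^ s = E.cTilde k * (k : ℂ) ^ (-(s + E.A + E.B)) := by
  have hk0 : (k : ℂ) ≠ 0 := by exact_mod_cast hk
  rw [c, Complex.ofReal_cpow (by positivity), div_eq_mul_inv, ← Complex.cpow_neg,
    mul_comm (_ ^ _) (E.cTilde k), mul_assoc, Complex.ofReal_natCast, ← Complex.cpow_add _ _ hk0]
  congr 2
  push_cast
  ring

/-- The Dirichlet series of the shifted Euler product. -/
theorem hasSum_eulerProduct {s : ℂ} (hs : 1 < s.re) :
    HasSum (fun k : ℕ => E.c (k + 1) / ((k + 1 : ℝ) : ℂ) ^ s)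
      (E.eulerProduct (s + E.A + E.B)) := by
  set w : ℂ := s + E.A + E.B with hw
  have hwre : w.re = s.re + E.A + E.B := by simp [hw]
  set F : ℕ → ℂ := fun k => E.cTilde k * (k : ℂ) ^ (-w) with hF
  have hw0 : -w ≠ 0 := by
    intro h
    have := congrArg Complex.re h
    simp only [Complex.neg_re, Complex.zero_re, hwre] at this
    linarith [E.A_nonneg, E.B_nonneg]
  have hF0 : F 0 = 0 := by simp [hF, Complex.zero_cpow hw0]
  have hF1 : F 1 = 1 := by simp [hF, cTilde_one]
  have hFs : ∀ k : ℕ, F (k + 1) = E.c (k + 1) / ((k + 1 : ℝ) : ℂ) ^ s := fun k => by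
    refine (E.c_div_cpow k.succ_ne_zero s).symm.trans ?_
    push_cast
    rfl
  have hFsum : Summable fun k => ‖F k‖ := by
    obtain ⟨C, hC⟩ := E.exists_norm_c_le (ε := (s.re - 1) / 2) (by linarith)
    rw [← summable_nat_add_iff 1]
    refine ((summable_nat_add_one_rpow (x := (s.re + 1) / 2) (by linarith)).mul_left C).of_nonneg_of_le
      (fun _ => norm_nonneg _) fun k => ?_
    have hk : (0 : ℝ) < k + 1 := by positivity
    rw [hFs, norm_div_ofReal_cpow _ hk]
    calc _ ≤ C * (k + 1 : ℝ) ^ ((s.re - 1) / 2) * (k + 1 : ℝ) ^ (-s.re) := by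
          gcongr
          exact hC k
      _ = _ := by
          rw [mul_assoc, ← Real.rpow_add hk]
          congr 2
          ring
  have hprod := EulerProduct.eulerProduct_hasProd hF1 (fun {m n} hmn => by
    simp only [hF]
    rw [E.cTilde_mul hmn, Nat.cast_mul, Complex.natCast_mul_natCast_cpow]
    ring) hFsum hF0
  have heq : ∀ p : Nat.Primes, ∑' e, F ((p : ℕ) ^ e) =
      ∏ j : Fin (E.g p), (1 - E.a p j * (p : ℂ) ^ (-(w * E.f p j)))⁻¹ := fun p => by
    rw [← (E.hasEval_localSeries p (w := w) (by rw [hwre]; linarith)).tsum_eq]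
    refine tsum_congr fun e => ?_
    simp only [hF]
    rw [E.cTilde_prime_pow, Nat.cast_pow, ← Complex.natCast_cpow_natCast_mul,
      Complex.cpow_nat_mul]
  simp only [heq] at hprod
  have htsum : E.eulerProduct w = ∑' n, F n := hprod.tprod_eq
  have h1 : HasSum F (E.eulerProduct w) := htsum ▸ hFsum.of_norm.hasSum
  rw [← hasSum_nat_add_iff' 1] at h1
  simpa [hF0, hFs] using h1

end EulerData

/-! ### The factor that removes the poles -/

/-- The factor `∏ ((s - p) / (s + 1)) ^ n`, over a finite set of points `p`. -/
def poleFactor (P : Finset ℂ) (n : ℕ) (s : ℂ) : ℂ := ∏ p ∈ P, ((s - p) / (s + 1)) ^ n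

lemma one_le_norm_add_one {s : ℂ} (hs : 0 ≤ s.re) : 1 ≤ ‖s + 1‖ := by
  refine le_trans ?_ (Complex.re_le_norm _)
  simp [hs]

lemma add_one_ne_zero_of_re_nonneg {s : ℂ} (hs : 0 ≤ s.re) : s + 1 ≠ 0 :=
  norm_pos_iff.mp (zero_lt_one.trans_le (one_le_norm_add_one hs))

lemma differentiableAt_poleFactor (P : Finset ℂ) (n : ℕ) {s : ℂ} (hs : 0 ≤ s.re) :
    DifferentiableAt ℂ (poleFactor P n) s := by
  refine DifferentiableAt.fun_finsetProd fun p _ => ?_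
  have := add_one_ne_zero_of_re_nonneg hs
  fun_prop (disch := assumption)

/-- The denominators `s + 1` keep the factor bounded on `Re s ≥ 0`, so multiplying by it preserves
both growth and mean square bounds. -/
lemma exists_norm_poleFactor_le (P : Finset ℂ) (n : ℕ) :
    ∃ C : ℝ, 0 ≤ C ∧ ∀ s : ℂ, 0 ≤ s.re → ‖poleFactor P n s‖ ≤ C := by
  refine ⟨∏ p ∈ P, (1 + ‖p + 1‖) ^ n, by positivity, fun s hs => ?_⟩
  rw [poleFactor, norm_prod]
  refine Finset.prod_le_prod (fun _ _ => norm_nonneg _) fun p _ => ?_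
  rw [norm_pow, norm_div]
  gcongr
  have h1 := one_le_norm_add_one hs
  rw [div_le_iff₀ (by linarith)]
  have h2 : ‖s - p‖ ≤ ‖s + 1‖ + ‖p + 1‖ := by
    have := norm_sub_le (s + 1) (p + 1)
    rwa [add_sub_add_right_eq_sub] at this
  nlinarith [norm_nonneg (p + 1)]

/-- Since `u / (u + c)` increases with `u`, each ratio is at least `r / (r + ‖p + 1‖)`. The bound
depends only on the distance to the vertical lines through the poles, hence is uniform under
vertical shifts; this is why the domains exclude whole lines. -/
lemma exists_le_norm_poleFactor (P : Finset ℂ) (n : ℕ) {r : ℝ} (hr : 0 < r) :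
    ∃ ρ > 0, ∀ s : ℂ, 0 ≤ s.re → (∀ p ∈ P, r ≤ |s.re - p.re|) → ρ ≤ ‖poleFactor P n s‖ := by
  refine ⟨∏ p ∈ P, (r / (r + ‖p + 1‖)) ^ n, by positivity, fun s hs hP => ?_⟩
  rw [poleFactor, norm_prod]
  refine Finset.prod_le_prod (fun _ _ => by positivity) fun p hp => ?_
  rw [norm_pow, norm_div]
  refine pow_le_pow_left₀ (by positivity) ?_ n
  have h1 := one_le_norm_add_one hs
  have h2 : ‖s + 1‖ ≤ ‖s - p‖ + ‖p + 1‖ := by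
    have := norm_add_le (s - p) (p + 1)
    rwa [← add_assoc, sub_add_cancel] at this
  have h3 : r ≤ ‖s - p‖ := (hP p hp).trans (Complex.abs_re_le_norm (s - p))
  rw [div_le_div_iff₀ (by positivity) (by linarith)]
  nlinarith [norm_nonneg (p + 1)]

/-- The factor removes the poles of `f`. -/
lemma differentiableAt_poleFactor_mul (P : Finset ℂ) {n : ℕ} {f : ℂ → ℂ}
    (hf : ∀ p ∈ P, DifferentiableAt ℂ (fun z => (z - p) ^ n * f z) p) {s : ℂ} (hs : 0 ≤ s.re)
    (hs' : s ∉ P → DifferentiableAt ℂ f s) :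
    DifferentiableAt ℂ (fun z => poleFactor P n z * f z) s := by
  by_cases hsP : s ∈ P
  · have heq : (fun z => poleFactor P n z * f z) =
        fun z => poleFactor (P.erase s) n z * (1 / (z + 1)) ^ n * ((z - s) ^ n * f z) := by
      funext z
      rw [poleFactor, ← Finset.mul_prod_erase P _ hsP, ← poleFactor, div_eq_mul_one_div,
        mul_pow]
      ring
    rw [heq]
    refine ((differentiableAt_poleFactor _ n hs).mul ?_).mul (hf s hsP)
    have := add_one_ne_zero_of_re_nonneg hs
    fun_prop (disch := assumption)
  · exact (differentiableAt_poleFactor P n hs).mul (hs' hsP)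

/-- A continuous function that has polynomial growth for large `|t|` in a vertical strip has
polynomial growth in the strip. -/
lemma exists_growth_of_continuous {F : ℂ → ℂ} {l : ℝ} (hF : ∀ s : ℂ, l ≤ s.re → ContinuousAt F s)
    {M t₀ c b : ℝ}
    (hM : ∀ s : ℂ, l ≤ s.re → s.re ≤ b → t₀ ≤ |s.im| → ‖F s‖ ≤ M * |s.im| ^ c) :
    ∃ (M' : ℝ) (m : ℕ), ∀ s : ℂ, l ≤ s.re → s.re ≤ b → ‖F s‖ ≤ M' * (1 + |s.im|) ^ m := by
  set t₁ := max t₀ 1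
  have hK : IsCompact (Set.Icc l b ×ℂ Set.Icc (-t₁) t₁) := isCompact_Icc.reProdIm isCompact_Icc
  obtain ⟨M₁, hM₁⟩ := hK.exists_bound_of_continuousOn (f := F) fun s hs =>
    (hF s hs.1.1).continuousWithinAt
  refine ⟨max |M| |M₁|, ⌈|c|⌉₊, fun s hs hsb => ?_⟩
  have h1 : 1 ≤ 1 + |s.im| := by linarith [abs_nonneg s.im]
  rcases le_total |s.im| t₁ with ht | ht
  · calc ‖F s‖ ≤ M₁ := hM₁ s ⟨⟨hs, hsb⟩, abs_le.mp ht⟩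
      _ ≤ max |M| |M₁| * 1 := by
        rw [mul_one]
        exact (le_abs_self _).trans (le_max_right _ _)
      _ ≤ _ := by
        gcongr
        exact one_le_pow₀ h1
  · have ht1 : 1 ≤ |s.im| := (le_max_right _ _).trans ht
    calc ‖F s‖ ≤ M * |s.im| ^ c := hM s hs hsb ((le_max_left _ _).trans ht)
      _ ≤ max |M| |M₁| * (1 + |s.im|) ^ (⌈|c|⌉₊ : ℝ) := by
        refine mul_le_mul ((le_abs_self _).trans (le_max_left _ _)) ?_ (by positivity)
          (by positivity)
        calc |s.im| ^ c ≤ |s.im| ^ (⌈|c|⌉₊ : ℝ) :=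
              Real.rpow_le_rpow_of_exponent_le ht1 ((le_abs_self c).trans (Nat.le_ceil _))
          _ ≤ _ := Real.rpow_le_rpow (by positivity) (by linarith) (by positivity)
      _ = _ := by rw [Real.rpow_natCast]

/-- A mean square bound for large `T` extends to all `T ≥ 1`. -/
lemma exists_mean_sq_of_eventually {F : ℝ → ℂ} (hF : Continuous F) {C T₀ : ℝ}
    (hC : ∀ T, T₀ ≤ T → ∫ t in (0 : ℝ)..T, ‖F t‖ ^ 2 ≤ C * T) :
    ∃ C' : ℝ, ∀ T, 1 ≤ T → ∫ t in (0 : ℝ)..T, ‖F t‖ ^ 2 ≤ C' * T := by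
  set T₁ := max T₀ 1
  have hT₁ : 1 ≤ T₁ := le_max_right _ _
  refine ⟨|C| * T₁, fun T hT => ?_⟩
  have hmono : ∫ t in (0 : ℝ)..T, ‖F t‖ ^ 2 ≤ ∫ t in (0 : ℝ)..(max T T₁), ‖F t‖ ^ 2 :=
    intervalIntegral.integral_mono_interval le_rfl (by linarith) (le_max_left _ _)
      (Eventually.of_forall fun t => by positivity) ((by fun_prop : Continuous fun t =>
        ‖F t‖ ^ 2).intervalIntegrable _ _)
  refine hmono.trans ((hC _ ((le_max_left T₀ 1).trans (le_max_right _ _))).trans ?_)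
  calc C * max T T₁ ≤ |C| * (T₁ * T) := by
        refine mul_le_mul (le_abs_self C) (max_le ?_ ?_) (by positivity) (abs_nonneg C)
        · exact le_mul_of_one_le_left (by linarith) hT₁
        · exact le_mul_of_one_le_right (by linarith) hT
    _ = _ := by ring

/-- The approximation in measure on compact sets that avoid the vertical lines through the
points removed by the factor. -/
theorem DirichletContinuation.approxInMeasure {f : ℂ → ℂ} {a : ℕ → ℂ} {β l : ℝ} {P : Finset ℂ}
    {n : ℕ} (h : DirichletContinuation f a β l (poleFactor P n)) {τ : ℝ} (hτ : 0 < τ) {K : Set ℂ}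
    (hK : IsCompact K) (hKl : ∀ c ∈ K, l < c.re) (hKP : ∀ c ∈ K, ∀ p ∈ P, c.re ≠ p.re)
    {δ ε : ℝ} (hδ : 0 < δ) (hε : 0 < ε) : ApproxInMeasure f a β τ K δ ε := by
  have hl : 0 < l := by linarith [h.half_le]
  refine h.card_compact_le hτ hK (fun c hc => ?_) hδ hε
  have hc1 := hKl c hc
  have hev : ∀ᶠ r in 𝓝[>] (0 : ℝ), (∀ p ∈ P, 2 * r < |c.re - p.re|) ∧
      2 * r < c.re - l := by
    have hlim : Tendsto (fun r : ℝ => 2 * r) (𝓝[>] 0) (𝓝 0) := by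
      have : Tendsto (fun r : ℝ => 2 * r) (𝓝 0) (𝓝 (2 * 0)) := tendsto_id.const_mul 2
      rw [mul_zero] at this
      exact this.mono_left nhdsWithin_le_nhds
    refine ((Finset.eventually_all _).mpr fun p hp => ?_).and
      (hlim.eventually_lt_const (by linarith))
    refine hlim.eventually_lt_const (abs_pos.mpr (sub_ne_zero.mpr ?_))
    exact hKP c hc p hp
  obtain ⟨r, ⟨hr1, hr2⟩, hr0⟩ := (hev.and self_mem_nhdsWithin).exists
  have hr0 : 0 < r := hr0
  obtain ⟨ρ, hρ, hρs⟩ := exists_le_norm_poleFactor P n hr0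
  refine ⟨r, hr0, by linarith, ρ, hρ, fun s hs => hρs s (by linarith [hs.1])
    fun p hp => ?_⟩
  have h1 := hr1 p hp
  have h2 : |c.re - s.re| ≤ r := abs_le.mpr ⟨by linarith [hs.2], by linarith [hs.1]⟩
  have h3 := abs_sub_le c.re s.re p.re
  linarith

namespace MatsumotoZeta

variable (Φ : MatsumotoZeta)

lemma σ₀_pos : 0 < Φ.σ₀ := by linarith [Φ.half_le]

/-- Infinitely many poles would accumulate in the compact set, at a point of the closed half-plane.
There `φ` is meromorphic, hence analytic on a punctured neighbourhood. -/
lemma finite_polesIn : (polesIn Φ.φ Φ.σ₀).Finite := by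
  obtain ⟨K, hK, -, hKsub⟩ := Φ.poles_compact
  by_contra hinf
  have hclosed : IsClosed {s : ℂ | Φ.σ₀ ≤ s.re} := isClosed_le continuous_const Complex.continuous_re
  obtain ⟨x, hx, hacc⟩ := Set.Infinite.exists_accPt_of_subset_isCompact hinf
    (hK.inter_right hclosed) fun s hs => ⟨hKsub hs, hs.1⟩
  have han := (Φ.meromorphic x hx.2).eventually_analyticAt
  rw [accPt_iff_frequently_nhdsNE] at hacc
  obtain ⟨s, hs1, hs2⟩ := (hacc.and_eventually han).exists
  exact absurd hs1.2 (not_lt.mpr hs2.meromorphicOrderAt_nonneg)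

/-- The largest of the local exponents serves all of the finitely many points. -/
lemma exists_pow_mul_differentiable (P : Finset ℂ) (hP : ∀ p ∈ P, Φ.σ₀ ≤ p.re) :
    ∃ n : ℕ, ∀ p ∈ P, DifferentiableAt ℂ (fun z => (z - p) ^ n * Φ.φ z) p := by
  have h : ∀ p : ℂ, ∃ n : ℕ, p ∈ P → AnalyticAt ℂ (fun z => (z - p) ^ n * Φ.φ z) p := fun p => by
    by_cases hp : p ∈ P
    · obtain ⟨n, hn⟩ := Φ.meromorphic p (hP p hp)
      exact ⟨n, fun _ => hn⟩
    · exact ⟨0, fun h => absurd h hp⟩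
  choose N hN using h
  refine ⟨P.sup N, fun p hp => ?_⟩
  have hle : N p ≤ P.sup N := Finset.le_sup hp
  have heq : (fun z => (z - p) ^ P.sup N * Φ.φ z) =
      fun z => (z - p) ^ (P.sup N - N p) * ((z - p) ^ N p * Φ.φ z) := by
    funext z
    rw [← mul_assoc, ← pow_add, Nat.sub_add_cancel hle]
  rw [heq]
  exact DifferentiableAt.mul (by fun_prop) (hN p hp).differentiableAt

/-- The poles of `φ`. -/
def poles : Finset ℂ := Φ.finite_polesIn.toFinset

lemma mem_poles {p : ℂ} : p ∈ Φ.poles ↔ p ∈ polesIn Φ.φ Φ.σ₀ := Set.Finite.mem_toFinset _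

/-- The compact set containing the poles is disjoint from the line `Re s = σ₀`. -/
lemma continuous_vertical : Continuous fun t : ℝ => Φ.φ (Φ.σ₀ + t * Complex.I) := by
  obtain ⟨K, -, hK, hKsub⟩ := Φ.poles_compact
  refine continuous_iff_continuousAt.mpr fun t => ?_
  have hre : ((Φ.σ₀ : ℂ) + t * Complex.I).re = Φ.σ₀ := by simp
  have h1 : ContinuousAt Φ.φ (Φ.σ₀ + t * Complex.I) :=
    (Φ.analytic _ hre.ge fun hp => hK _ (hKsub hp) hre).continuousAt
  exact ContinuousAt.comp (f := fun t : ℝ => (Φ.σ₀ : ℂ) + t * Complex.I) h1 (by fun_prop)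

/-- Matsumoto zeta-functions fall under the general approximation theorem. -/
theorem exists_dirichletContinuation : ∃ n : ℕ,
    DirichletContinuation Φ.φ (fun k => Φ.c (k + 1)) 1 Φ.σ₀ (poleFactor Φ.poles n) := by
  obtain ⟨n, hn⟩ := Φ.exists_pow_mul_differentiable Φ.poles fun p hp => (Φ.mem_poles.mp hp).1
  obtain ⟨C, hC0, hC⟩ := exists_norm_poleFactor_le Φ.poles n
  have hdiff : ∀ s : ℂ, Φ.σ₀ ≤ s.re →
      DifferentiableAt ℂ (fun s => poleFactor Φ.poles n s * Φ.φ s) s := fun s hs =>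
    differentiableAt_poleFactor_mul _ hn (Φ.σ₀_pos.le.trans hs) fun hsP =>
      (Φ.analytic s hs fun h => hsP (Φ.mem_poles.mpr h)).differentiableAt
  refine ⟨n, one_pos, le_rfl, Φ.half_le, Φ.lt_one, fun ε hε => Φ.exists_norm_c_le hε,
    fun s hs => ?_, fun s hs => differentiableAt_poleFactor _ _ (Φ.σ₀_pos.le.trans hs),
    ⟨C, fun s hs => hC s (Φ.σ₀_pos.le.trans hs)⟩, hdiff, fun b => ?_, ?_⟩
  · rw [Φ.eq_euler s hs]
    exact Φ.hasSum_eulerProduct hs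
  · obtain ⟨C₂, -, M, t₀, hM⟩ := Φ.growth
    refine exists_growth_of_continuous (fun s hs => (hdiff s hs).continuousAt) (M := C * M)
      (t₀ := t₀) (c := C₂) fun s hs _ ht => ?_
    rw [norm_mul, mul_assoc]
    exact mul_le_mul (hC s (Φ.σ₀_pos.le.trans hs)) (hM s hs ht) (norm_nonneg _) hC0
  · obtain ⟨C₃, hC₃⟩ := Φ.mean_square.bound
    obtain ⟨T₀, hT₀⟩ := eventually_atTop.mp hC₃
    have hre : ∀ t : ℝ, ((Φ.σ₀ : ℂ) + t * Complex.I).re = Φ.σ₀ := fun t => by simp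
    have hcont : Continuous fun t : ℝ => poleFactor Φ.poles n (Φ.σ₀ + t * Complex.I) *
        Φ.φ (Φ.σ₀ + t * Complex.I) := continuous_iff_continuousAt.mpr fun t =>
      ContinuousAt.comp (f := fun t : ℝ => (Φ.σ₀ : ℂ) + t * Complex.I)
        (hdiff _ (hre t).ge).continuousAt (by fun_prop)
    refine exists_mean_sq_of_eventually hcont (C := C ^ 2 * C₃) (T₀ := max T₀ 0) fun T hT => ?_
    have hT0 : 0 ≤ T := (le_max_right _ _).trans hT
    have h1 := hT₀ T ((le_max_left _ _).trans hT)
    rw [Real.norm_of_nonneg hT0] at h1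
    calc _ ≤ ∫ t in (0 : ℝ)..T, C ^ 2 * ‖Φ.φ (Φ.σ₀ + t * Complex.I)‖ ^ 2 := by
          refine intervalIntegral.integral_mono_on hT0
            ((hcont.norm.pow 2).intervalIntegrable _ _)
            ((continuous_const.mul (Φ.continuous_vertical.norm.pow 2)).intervalIntegrable _ _)
            fun t _ => ?_
          rw [norm_mul, mul_pow]
          gcongr
          exact hC _ (by rw [hre]; exact Φ.σ₀_pos.le)
      _ = C ^ 2 * ∫ t in (0 : ℝ)..T, ‖Φ.φ (Φ.σ₀ + t * Complex.I)‖ ^ 2 :=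
          intervalIntegral.integral_const_mul _ _
      _ ≤ C ^ 2 * (C₃ * T) := by
          gcongr
          exact (le_abs_self _).trans h1
      _ = _ := by ring

/-- `φ` is approximated in measure by the partial sums of its Dirichlet series. -/
theorem approxInMeasure {τ : ℝ} (hτ : 0 < τ) {K : Set ℂ} (hK : IsCompact K)
    (hKD : K ⊆ Φ.domain) {δ ε : ℝ} (hδ : 0 < δ) (hε : 0 < ε) :
    ApproxInMeasure Φ.φ (fun k => Φ.c (k + 1)) 1 τ K δ ε := by
  obtain ⟨n, hn⟩ := Φ.exists_dirichletContinuation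
  exact hn.approxInMeasure hτ hK (fun c hc => (hKD hc).1)
    (fun c hc p hp => (hKD hc).2 p (Φ.mem_poles.mp hp)) hδ hε

end MatsumotoZeta

/-! ### The Hurwitz zeta-function to the right of the line `Re s = 0` -/

/-- The difference between `(m + x)^{-s}` and the integral of `u^{-s}` over
`[m + x, m + 1 + x]`. -/
def hurwitzTerm (x : ℝ) (m : ℕ) (s : ℂ) : ℂ :=
  1 / ((m + x : ℝ) : ℂ) ^ s -
    (((m + x : ℝ) : ℂ) ^ (1 - s) - (((m + 1 : ℕ) + x : ℝ) : ℂ) ^ (1 - s)) / (s - 1)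

/-- Integration by parts in Euler summation, as an explicit antiderivative; with `y = m + x` its
increment over `[0, 1]` is `hurwitzTerm`. -/
lemma hasDerivAt_hurwitzTerm_aux {y : ℝ} (hy : 0 < y) {s : ℂ} (hs : s ≠ 1) {v : ℝ} (hv : 0 ≤ v) :
    HasDerivAt (fun v : ℝ => -((1 - v : ℂ) * (y + v : ℂ) ^ (-s)) + (y + v : ℂ) ^ (1 - s) / (s - 1))
      (s * ((1 - v : ℂ) * (y + v : ℂ) ^ (-(s + 1)))) v := by
  have hs1 : s - 1 ≠ 0 := sub_ne_zero.mpr hs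
  have hslit : (y + v : ℂ) ∈ Complex.slitPlane := by
    rw [← Complex.ofReal_add]
    exact Complex.ofReal_mem_slitPlane.mpr (by linarith)
  have hne : (y + v : ℂ) ≠ 0 := Complex.slitPlane_ne_zero hslit
  have hadd : HasDerivAt (fun z : ℂ => (y : ℂ) + z) 1 v := (hasDerivAt_id _).const_add _
  have h1 := hadd.cpow_const (c := -s) hslit
  have h2 := hadd.cpow_const (c := 1 - s) hslit
  have h3 : HasDerivAt (fun z : ℂ => 1 - z) (-1) v := (hasDerivAt_id _).const_sub _
  have h4 := ((h3.mul h1).neg.add (h2.div_const (s - 1))).comp_ofReal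
  refine h4.congr_deriv ?_
  have e1 : (1 : ℂ) - s - 1 = -s := by ring
  have e2 : -s - 1 = -(s + 1) := by ring
  rw [e1, e2]
  field_simp
  ring

/-- The integral form gains a power of `m`: the terms are `O(|s| m ^ (-Re s - 1))`, summable in the
whole half-plane `Re s > 0`. -/
lemma hurwitzTerm_eq_integral {x : ℝ} (hx : 0 < x) (m : ℕ) {s : ℂ} (hs : s ≠ 1) :
    hurwitzTerm x m s =
      s * ∫ v in (0 : ℝ)..1, (1 - v : ℂ) * ((m + (x + v) : ℝ) : ℂ) ^ (-(s + 1)) := by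
  have hy : (0 : ℝ) < m + x := by positivity
  have hcont : ContinuousOn
      (fun v : ℝ => s * ((1 - v : ℂ) * (((m + x : ℝ) : ℂ) + v) ^ (-(s + 1)))) (Set.uIcc 0 1) := by
    refine continuousOn_const.mul (ContinuousOn.mul (by fun_prop) ?_)
    refine ContinuousOn.cpow_const (by fun_prop) fun v hv => ?_
    rw [Set.uIcc_of_le zero_le_one] at hv
    rw [← Complex.ofReal_add]
    exact Complex.ofReal_mem_slitPlane.mpr (by linarith [hv.1])
  have h := intervalIntegral.integral_eq_sub_of_hasDerivAt (fun v hv => by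
    rw [Set.uIcc_of_le zero_le_one] at hv
    exact hasDerivAt_hurwitzTerm_aux hy hs hv.1) hcont.intervalIntegrable
  rw [intervalIntegral.integral_const_mul] at h
  have e : ∀ v : ℝ, ((m + (x + v) : ℝ) : ℂ) = ((m + x : ℝ) : ℂ) + v := fun v => by
    push_cast
    ring
  simp only [e]
  rw [h, hurwitzTerm]
  have hs1 : s - 1 ≠ 0 := sub_ne_zero.mpr hs
  have e2 : (((m + 1 : ℕ) + x : ℝ) : ℂ) = ((m + x : ℝ) : ℂ) + 1 := by
    push_cast
    ring
  rw [e2]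
  simp only [Complex.ofReal_one, Complex.ofReal_zero, sub_self, zero_mul, neg_zero, zero_add,
    sub_zero, one_mul, add_zero]
  rw [Complex.cpow_neg _ s]
  ring

lemma norm_hurwitzTerm_le {x : ℝ} (hx : 0 < x) (m : ℕ) {s : ℂ} (hs : s ≠ 1) (hs0 : 0 ≤ s.re) :
    ‖hurwitzTerm x m s‖ ≤ ‖s‖ * (m + x : ℝ) ^ (-(s.re + 1)) := by
  have hy : (0 : ℝ) < m + x := by positivity
  rw [hurwitzTerm_eq_integral hx m hs, norm_mul]
  gcongr
  have h := intervalIntegral.norm_integral_le_of_norm_le_const (a := (0 : ℝ)) (b := 1)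
    (f := fun v : ℝ => (1 - v : ℂ) * ((m + (x + v) : ℝ) : ℂ) ^ (-(s + 1)))
    (C := (m + x : ℝ) ^ (-(s.re + 1))) fun v hv => by
      rw [Set.uIoc_of_le zero_le_one] at hv
      have hv0 := hv.1
      have hv1 := hv.2
      rw [norm_mul, Complex.norm_cpow_eq_rpow_re_of_pos (by linarith)]
      have h1 : ‖(1 - v : ℂ)‖ ≤ 1 := by
        rw [← Complex.ofReal_one, ← Complex.ofReal_sub, Complex.norm_real, Real.norm_eq_abs,
          abs_le]
        constructor <;> linarith
      refine (mul_le_of_le_one_left (by positivity) h1).trans ?_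
      simp only [Complex.neg_re, Complex.add_re, Complex.one_re]
      exact Real.rpow_le_rpow_of_nonpos hy (by linarith) (by linarith)
  simpa using h

lemma sum_range_hurwitzTerm (x : ℝ) (s : ℂ) (n : ℕ) :
    ∑ m ∈ Finset.range n, hurwitzTerm x m s = ∑ m ∈ Finset.range n, 1 / ((m + x : ℝ) : ℂ) ^ s -
      ((x : ℂ) ^ (1 - s) - ((n + x : ℝ) : ℂ) ^ (1 - s)) / (s - 1) := by
  induction n with
  | zero => simp
  | succ n ih =>
    rw [Finset.sum_range_succ, Finset.sum_range_succ, ih, hurwitzTerm]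
    ring

lemma summable_hurwitzTerm {x : ℝ} (hx : 0 < x) (hx1 : x ≤ 1) {s : ℂ} (hs : s ≠ 1)
    (hs0 : 0 < s.re) : Summable fun m => hurwitzTerm x m s := by
  refine Summable.of_norm_bounded
    ((summable_nat_add_one_rpow (x := s.re + 1) (by linarith)).mul_left
      (‖s‖ * x ^ (-(s.re + 1)))) fun m => ?_
  refine (norm_hurwitzTerm_le hx m hs hs0.le).trans ?_
  rw [mul_assoc]
  gcongr
  exact shift_rpow_neg_le hx hx1 (by linarith) m

/-- The integrals telescope, and for `Re s > 1` the upper boundary term `(n + x) ^ (1 - s)` tends to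
zero. -/
lemma tsum_hurwitzTerm_of_one_lt_re {x : ℝ} (hx : 0 < x) (hx1 : x ≤ 1) {s : ℂ} (hs : 1 < s.re) :
    ∑' m, hurwitzTerm x m s =
      HurwitzZeta.hurwitzZeta (x : UnitAddCircle) s - (x : ℂ) ^ (1 - s) / (s - 1) := by
  have hs1 : s ≠ 1 := fun h => by simp [h] at hs
  have h1 := (summable_hurwitzTerm hx hx1 hs1 (by linarith)).hasSum.tendsto_sum_nat
  refine tendsto_nhds_unique h1 ?_
  simp only [sum_range_hurwitzTerm]
  have h2 := (HurwitzZeta.hasSum_hurwitzZeta_of_one_lt_re ⟨hx.le, hx1⟩ hs).tendsto_sum_nat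
  have h3 : Tendsto (fun n : ℕ => ((n + x : ℝ) : ℂ) ^ (1 - s)) atTop (𝓝 0) := by
    rw [tendsto_zero_iff_norm_tendsto_zero]
    have : Tendsto (fun n : ℕ => (n + x : ℝ) ^ (-(s.re - 1))) atTop (𝓝 0) :=
      (tendsto_rpow_neg_atTop (by linarith)).comp
        (tendsto_atTop_add_const_right _ _ tendsto_natCast_atTop_atTop)
    refine this.congr fun n => ?_
    rw [Complex.norm_cpow_eq_rpow_re_of_pos (by positivity)]
    congr 1
    simp
  have h4 := h2.sub ((h3.const_sub ((x : ℂ) ^ (1 - s))).div_const (s - 1))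
  rw [sub_zero] at h4
  refine h4.congr fun n => ?_
  push_cast
  rfl

lemma differentiableAt_hurwitzTerm {x : ℝ} (hx : 0 < x) (m : ℕ) {s : ℂ} (hs : s ≠ 1) :
    DifferentiableAt ℂ (hurwitzTerm x m) s := by
  have hne : ∀ k : ℕ, ((k + x : ℝ) : ℂ) ≠ 0 := fun k => by
    have : (0 : ℝ) < k + x := by positivity
    exact_mod_cast this.ne'
  have hs1 : s - 1 ≠ 0 := sub_ne_zero.mpr hs
  have h1 : ∀ k : ℕ, DifferentiableAt ℂ (fun s : ℂ => ((k + x : ℝ) : ℂ) ^ (1 - s)) s := fun k =>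
    DifferentiableAt.const_cpow (by fun_prop) (Or.inl (hne k))
  refine DifferentiableAt.sub ?_ (((h1 m).sub (h1 (m + 1))).div (by fun_prop) hs1)
  refine DifferentiableAt.div (by fun_prop)
    (differentiableAt_id.const_cpow (Or.inl (hne m))) ?_
  simp only [ne_eq, Complex.cpow_eq_zero_iff, hne m, false_and, not_false_eq_true]

lemma differentiableAt_tsum_hurwitzTerm {x : ℝ} (hx : 0 < x) (hx1 : x ≤ 1) {s : ℂ} (hs : s ≠ 1)
    (hs0 : 0 < s.re) : DifferentiableAt ℂ (fun s => ∑' m, hurwitzTerm x m s) s := by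
  set δ := s.re / 2
  set B := ‖s‖ + 1
  set U : Set ℂ := {w | δ < w.re} ∩ Metric.ball 0 B ∩ {1}ᶜ
  have hU : IsOpen U := ((isOpen_lt continuous_const Complex.continuous_re).inter
    Metric.isOpen_ball).inter isOpen_compl_singleton
  have hsU : s ∈ U := ⟨⟨by simp only [Set.mem_ofPred_eq, δ]; linarith, by simp [B]⟩, hs⟩
  have hδ : 0 < δ := by simp only [δ]; linarith
  refine (Complex.differentiableOn_tsum_of_summable_norm
    ((summable_nat_add_one_rpow (x := δ + 1) (by linarith)).mul_left (B * x ^ (-(B + 1))))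
    (fun m w hw => (differentiableAt_hurwitzTerm hx m hw.2).differentiableWithinAt) hU
    fun m w hw => ?_).differentiableAt (hU.mem_nhds hsU)
  have hw1 : δ < w.re := hw.1.1
  have hwB : ‖w‖ < B := by simpa using hw.1.2
  have hwre : w.re ≤ B := (Complex.re_le_norm w).trans hwB.le
  refine (norm_hurwitzTerm_le hx m hw.2 (by linarith)).trans ?_
  rw [mul_assoc]
  refine mul_le_mul hwB.le ((shift_rpow_neg_le hx hx1 (by linarith) m).trans ?_) (by positivity)
    (by positivity)
  refine mul_le_mul ?_ ?_ (by positivity) (by positivity)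
  · exact Real.rpow_le_rpow_of_exponent_ge hx hx1 (by linarith)
  · exact Real.rpow_le_rpow_of_exponent_le (by linarith [(Nat.cast_nonneg m : (0 : ℝ) ≤ m)])
      (by linarith)

/-- The continuation of the Hurwitz zeta-function to `Re s > 0` by Euler summation. -/
theorem hasSum_hurwitzTerm {x : ℝ} (hx : 0 < x) (hx1 : x ≤ 1) {s : ℂ} (hs0 : 0 < s.re)
    (him : s.im ≠ 0) : HasSum (fun m => hurwitzTerm x m s)
      (HurwitzZeta.hurwitzZeta (x : UnitAddCircle) s - (x : ℂ) ^ (1 - s) / (s - 1)) := by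
  have hne : ∀ w : ℂ, w.im ≠ 0 → w ≠ 1 := fun w hw h => hw (by simp [h])
  have hx0 : (x : ℂ) ≠ 0 := by exact_mod_cast hx.ne'
  -- The quadrant of `Re w > 0` on the side of the real axis where `s` lies. It is convex, avoids
  -- the pole at `1` and meets `Re w > 1`, so the identity theorem carries the formula over to `s`.
  set U : Set ℂ := {w | 0 < w.re} ∩ {w | 0 < s.im * w.im}
  have hUo : IsOpen U := (isOpen_lt continuous_const Complex.continuous_re).inter
    (isOpen_lt continuous_const (by fun_prop))
  have hUc : Convex ℝ U := by
    refine (convex_halfSpace_re_gt 0).inter ?_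
    exact convex_halfSpace_gt (f := fun w : ℂ => s.im * w.im)
      ⟨fun z w => by simp [mul_add], fun c z => by simp; ring⟩ 0
  have hUim : ∀ w ∈ U, w.im ≠ 0 := fun w hw h => by
    have := hw.2
    simp [h] at this
  have hdiff₁ : DifferentiableOn ℂ (fun s => ∑' m, hurwitzTerm x m s) U := fun w hw =>
    (differentiableAt_tsum_hurwitzTerm hx hx1 (hne w (hUim w hw)) hw.1).differentiableWithinAt
  have hdiff₂ : DifferentiableOn ℂ (fun s => HurwitzZeta.hurwitzZeta (x : UnitAddCircle) s -
      (x : ℂ) ^ (1 - s) / (s - 1)) U := fun w hw => by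
    have hw1 := hne w (hUim w hw)
    refine DifferentiableAt.differentiableWithinAt ?_
    refine (HurwitzZeta.differentiableAt_hurwitzZeta _ hw1).sub (DifferentiableAt.div ?_
      (by fun_prop) (sub_ne_zero.mpr hw1))
    exact DifferentiableAt.const_cpow (by fun_prop) (Or.inl hx0)
  have hz₀ : (2 + s.im * Complex.I : ℂ) ∈ U := by
    constructor
    · simp
    · simpa using mul_self_pos.mpr him
  have hev : (fun s => ∑' m, hurwitzTerm x m s) =ᶠ[𝓝 (2 + s.im * Complex.I : ℂ)]
      fun s => HurwitzZeta.hurwitzZeta (x : UnitAddCircle) s - (x : ℂ) ^ (1 - s) / (s - 1) := by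
    have : {w : ℂ | 1 < w.re} ∈ 𝓝 (2 + s.im * Complex.I : ℂ) :=
      (isOpen_lt continuous_const Complex.continuous_re).mem_nhds (by simp)
    filter_upwards [this] with w hw
    exact tsum_hurwitzTerm_of_one_lt_re hx hx1 hw
  have hsU : s ∈ U := ⟨hs0, mul_self_pos.mpr him⟩
  have heq := (hdiff₁.analyticOnNhd hUo).eqOn_of_preconnected_of_eventuallyEq
    (hdiff₂.analyticOnNhd hUo) hUc.isPreconnected hz₀ hev hsU
  have := (summable_hurwitzTerm hx hx1 (hne s him) hs0).hasSum
  rwa [show ∑' m, hurwitzTerm x m s = _ from heq] at this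

/-- Polynomial growth of the Hurwitz zeta-function. -/
lemma norm_hurwitzZeta_le {x : ℝ} (hx : 0 < x) (hx1 : x ≤ 1) {l b : ℝ} (hl : 0 < l) :
    ∃ M : ℝ, 0 ≤ M ∧ ∀ s : ℂ, l ≤ s.re → s.re ≤ b → 1 ≤ |s.im| →
      ‖HurwitzZeta.hurwitzZeta (x : UnitAddCircle) s‖ ≤ M * |s.im| := by
  set Z := ∑' m : ℕ, (m + 1 : ℝ) ^ (-(l + 1)) with hZ
  have hZs := summable_nat_add_one_rpow (x := l + 1) (by linarith)
  have hZ0 : 0 ≤ Z := tsum_nonneg fun m => by positivity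
  refine ⟨max (x ^ (1 - l)) (x ^ (1 - b)) + (|b| + 1) * (x ^ (-(b + 1)) * Z), by positivity,
    fun s hs hsb ht => ?_⟩
  have him : s.im ≠ 0 := fun h => by simp [h] at ht; linarith
  have hne : s ≠ 1 := fun h => him (by simp [h])
  have hsum := hasSum_hurwitzTerm hx hx1 (hl.trans_le hs) him
  have h1 : ‖HurwitzZeta.hurwitzZeta (x : UnitAddCircle) s - (x : ℂ) ^ (1 - s) / (s - 1)‖ ≤
      ‖s‖ * (x ^ (-(b + 1)) * Z) := by
    rw [← hsum.tsum_eq, hZ, ← tsum_mul_left, ← tsum_mul_left]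
    refine tsum_of_norm_bounded ((hZs.mul_left _).mul_left _).hasSum fun m => ?_
    refine (norm_hurwitzTerm_le hx m hne (by linarith)).trans ?_
    gcongr
    refine (shift_rpow_neg_le hx hx1 (by linarith) m).trans ?_
    refine mul_le_mul ?_ ?_ (by positivity) (by positivity)
    · exact Real.rpow_le_rpow_of_exponent_ge hx hx1 (by linarith)
    · exact Real.rpow_le_rpow_of_exponent_le (by linarith [(Nat.cast_nonneg m : (0 : ℝ) ≤ m)])
        (by linarith)
  have h2 : ‖(x : ℂ) ^ (1 - s) / (s - 1)‖ ≤ max (x ^ (1 - l)) (x ^ (1 - b)) := by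
    rw [norm_div, Complex.norm_cpow_eq_rpow_re_of_pos hx]
    have h3 : 1 ≤ ‖s - 1‖ := by
      refine ht.trans ((le_of_eq ?_).trans (Complex.abs_im_le_norm (s - 1)))
      simp
    refine (div_le_self (by positivity) h3).trans ((?_ : _ ≤ x ^ (1 - b)).trans (le_max_right _ _))
    exact Real.rpow_le_rpow_of_exponent_ge hx hx1 (by simp; linarith)
  have h4 : ‖s‖ ≤ (|b| + 1) * |s.im| := by
    refine (Complex.norm_le_abs_re_add_abs_im s).trans ?_
    rw [abs_of_nonneg (by linarith : 0 ≤ s.re)]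
    nlinarith [le_abs_self b, abs_nonneg b]
  have h5 := norm_sub_norm_le (HurwitzZeta.hurwitzZeta (x : UnitAddCircle) s)
    ((x : ℂ) ^ (1 - s) / (s - 1))
  have h6 : ‖s‖ * (x ^ (-(b + 1)) * Z) ≤ (|b| + 1) * |s.im| * (x ^ (-(b + 1)) * Z) := by gcongr
  have h7 : max (x ^ (1 - l)) (x ^ (1 - b)) ≤ max (x ^ (1 - l)) (x ^ (1 - b)) * |s.im| :=
    le_mul_of_one_le_right (by positivity) ht
  nlinarith

/-! ### The mean square of the Hurwitz zeta-function -/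

lemma sum_erase_inv_dist_le {N k : ℕ} (hk : k < N) :
    ∑ j ∈ (Finset.range N).erase k, 1 / |(k : ℝ) - j| ≤
      2 * ∑ d ∈ Finset.range N, 1 / (d + 1 : ℝ) := by
  have hsub : (Finset.range N).erase k ⊆ Finset.range k ∪ Finset.Ico (k + 1) N := by
    intro j hj
    simp only [Finset.mem_erase, Finset.mem_range, Finset.mem_union, Finset.mem_Ico] at hj ⊢
    omega
  have hdisj : Disjoint (Finset.range k) (Finset.Ico (k + 1) N) := by
    rw [Finset.disjoint_left]
    intro j hj hj'
    simp only [Finset.mem_range, Finset.mem_Ico] at hj hj'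
    omega
  have hmono : ∀ n ≤ N, ∑ d ∈ Finset.range n, 1 / (d + 1 : ℝ) ≤
      ∑ d ∈ Finset.range N, 1 / (d + 1 : ℝ) := fun n hn =>
    Finset.sum_le_sum_of_subset_of_nonneg (Finset.range_subset_range.mpr hn) fun _ _ _ => by
      positivity
  have h1 : ∑ j ∈ Finset.range k, 1 / |(k : ℝ) - j| = ∑ d ∈ Finset.range k, 1 / (d + 1 : ℝ) := by
    rw [← Finset.sum_range_reflect]
    refine Finset.sum_congr rfl fun j hj => ?_
    have hjk : j < k := Finset.mem_range.mp hj
    have : ((k - 1 - j : ℕ) : ℝ) = k - 1 - j := by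
      rw [Nat.cast_sub (by omega), Nat.cast_sub (by omega), Nat.cast_one]
    rw [this, show (k : ℝ) - (k - 1 - j) = j + 1 by ring, abs_of_pos (by positivity)]
  have h2 : ∑ j ∈ Finset.Ico (k + 1) N, 1 / |(k : ℝ) - j| =
      ∑ d ∈ Finset.range (N - (k + 1)), 1 / (d + 1 : ℝ) := by
    rw [Finset.sum_Ico_eq_sum_range]
    refine Finset.sum_congr rfl fun d _ => ?_
    push_cast
    rw [show (k : ℝ) - (k + 1 + d) = -(d + 1) by ring, abs_neg, abs_of_pos (by positivity)]
  calc _ ≤ ∑ j ∈ Finset.range k ∪ Finset.Ico (k + 1) N, 1 / |(k : ℝ) - j| :=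
        Finset.sum_le_sum_of_subset_of_nonneg hsub fun _ _ _ => by positivity
    _ = _ := Finset.sum_union hdisj
    _ ≤ _ := by
        rw [h1, h2, two_mul]
        exact add_le_add (hmono _ hk.le) (hmono _ (Nat.sub_le _ _))

/-- The value at `1 + η` of the Riemann zeta-function. -/
def zetaSum (η : ℝ) : ℝ := ∑' d : ℕ, (d + 1 : ℝ) ^ (-(1 + η))

lemma zetaSum_nonneg (η : ℝ) : 0 ≤ zetaSum η := tsum_nonneg fun d => by positivity

lemma sum_range_le_zetaSum {η : ℝ} (hη : 0 < η) (n : ℕ) :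
    ∑ d ∈ Finset.range n, (d + 1 : ℝ) ^ (-(1 + η)) ≤ zetaSum η :=
  (summable_nat_add_one_rpow (by linarith)).sum_le_tsum _ fun d _ => by positivity

/-- Powers of exponent `-c ≥ -(1 + η)` over the integers up to `N`. -/
lemma sum_range_rpow_neg_le {η c : ℝ} (hη : 0 < η) (hc : c ≤ 1 + η) (N : ℕ) :
    ∑ d ∈ Finset.range N, (d + 1 : ℝ) ^ (-c) ≤ (N : ℝ) ^ (1 + η - c) * zetaSum η := by
  refine le_trans ?_ (mul_le_mul_of_nonneg_left (sum_range_le_zetaSum hη N) (by positivity))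
  rw [Finset.mul_sum]
  refine Finset.sum_le_sum fun d hd => ?_
  have hd0 : (0 : ℝ) < d + 1 := by positivity
  have hdN : (d + 1 : ℝ) ≤ N := by exact_mod_cast Finset.mem_range.mp hd
  rw [show -c = (1 + η - c) + -(1 + η) by ring, Real.rpow_add hd0]
  exact mul_le_mul_of_nonneg_right (Real.rpow_le_rpow hd0.le hdN (by linarith)) (by positivity)

/-- Powers of exponent `-c ≤ -(1 + η)` over the integers from `M` on. -/
lemma rpow_neg_le_of_one_le {η c y : ℝ} (hη : 0 < η) (hc : 1 + η ≤ c) (hy : 0 ≤ y) {M : ℕ}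
    (hM : 1 ≤ M) (j : ℕ) :
    ((M + j : ℕ) + y : ℝ) ^ (-c) ≤ (M : ℝ) ^ (1 + η - c) * (j + 1 : ℝ) ^ (-(1 + η)) := by
  have hM0 : (0 : ℝ) < M := by exact_mod_cast hM
  have hM1 : (1 : ℝ) ≤ M := by exact_mod_cast hM
  have hj : (0 : ℝ) ≤ j := Nat.cast_nonneg j
  have hp : (0 : ℝ) < (M + j : ℕ) + y := by push_cast; linarith
  rw [show -c = (1 + η - c) + -(1 + η) by ring, Real.rpow_add hp]
  refine mul_le_mul ?_ ?_ (by positivity) (by positivity)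
  · exact Real.rpow_le_rpow_of_nonpos hM0 (by push_cast; linarith) (by linarith)
  · exact Real.rpow_le_rpow_of_nonpos (by linarith) (by push_cast; linarith) (by linarith)

lemma sum_Ico_rpow_neg_le {η c y : ℝ} (hη : 0 < η) (hc : 1 + η ≤ c) (hy : 0 ≤ y) {M : ℕ}
    (hM : 1 ≤ M) (N : ℕ) :
    ∑ k ∈ Finset.Ico M N, (k + y : ℝ) ^ (-c) ≤ (M : ℝ) ^ (1 + η - c) * zetaSum η := by
  rw [Finset.sum_Ico_eq_sum_range]
  refine le_trans ?_ (mul_le_mul_of_nonneg_left (sum_range_le_zetaSum hη (N - M)) (by positivity))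
  rw [Finset.mul_sum]
  exact Finset.sum_le_sum fun j _ => rpow_neg_le_of_one_le hη hc hy hM j

/-- From `log (r / p) ≥ (r - p) / r` the spacing of the logarithms is replaced by that of the
points. The factor `r` gained turns `r ^ (-c)` into `r ^ (1 - c) ≤ W`. -/
lemma mul_div_abs_log_sub_le {c W : ℝ} {p r : ℝ} (hp : 0 < p) (hpr : p < r)
    (hW : r ^ (1 - c) ≤ W) :
    p ^ (-c) * r ^ (-c) * (2 / |-Real.log p - -Real.log r|) ≤ 2 * W * (p ^ (-c) / (r - p)) := by
  have hr : 0 < r := hp.trans hpr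
  have hlog : (r - p) / r ≤ |-Real.log p - -Real.log r| := by
    have h1 := Real.one_sub_inv_le_log_of_pos (div_pos hr hp)
    rw [Real.log_div hr.ne' hp.ne', inv_div] at h1
    calc (r - p) / r = 1 - p / r := by field_simp
      _ ≤ Real.log r - Real.log p := h1
      _ ≤ _ := by
        rw [show -Real.log p - -Real.log r = Real.log r - Real.log p by ring]
        exact le_abs_self _
  have hpos : 0 < (r - p) / r := div_pos (by linarith) hr
  calc _ ≤ p ^ (-c) * r ^ (-c) * (2 / ((r - p) / r)) := by gcongr
    _ = 2 * (r ^ (-c) * r) * (p ^ (-c) / (r - p)) := by field_simp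
    _ = 2 * r ^ (1 - c) * (p ^ (-c) / (r - p)) := by
        rw [← Real.rpow_add_one hr.ne']
        congr 3
        ring
    _ ≤ _ := by
        have : 0 ≤ p ^ (-c) / (r - p) := div_nonneg (by positivity) (by linarith)
        gcongr

/-- A mean value estimate for the sums `∑ (k + y)^{-s}`. -/
lemma integral_norm_sq_sum_cpow_le {y c W η : ℝ} (hy : 0 < y) (hη : 0 < η) {M N : ℕ}
    (hW : ∀ k ∈ Finset.Ico M N, (k + y : ℝ) ^ (1 - c) ≤ W) (hW0 : 0 ≤ W) {T : ℝ} (hT : 0 ≤ T) :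
    ∫ t in (0 : ℝ)..T, ‖∑ k ∈ Finset.Ico M N, ((k + y : ℝ) : ℂ) ^ (-(c + t * Complex.I))‖ ^ 2 ≤
      T * ∑ k ∈ Finset.Ico M N, (k + y : ℝ) ^ (-(2 * c)) +
        8 * W * ((N : ℝ) ^ η * zetaSum η) * ∑ k ∈ Finset.Ico M N, (k + y : ℝ) ^ (-c) := by
  have hpos : ∀ k : ℕ, (0 : ℝ) < k + y := fun k => by positivity
  have hexp : ∀ (k : ℕ) (t : ℝ), ((k + y : ℝ) : ℂ) ^ (-(c + t * Complex.I)) =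
      (((k + y : ℝ) ^ (-c) : ℝ) : ℂ) *
        Complex.exp ((-Real.log (k + y) : ℝ) * Complex.I * t) := fun k t => by
    have hk0 : ((k + y : ℝ) : ℂ) ≠ 0 := by exact_mod_cast (hpos k).ne'
    rw [neg_add, Complex.cpow_add _ _ hk0, Complex.ofReal_cpow (hpos k).le, Complex.ofReal_neg]
    congr 1
    rw [Complex.cpow_def_of_ne_zero hk0, ← Complex.ofReal_log (hpos k).le]
    congr 1
    push_cast
    ring
  have hmv := integral_norm_sq_sum_exp_le (Finset.Ico M N)
    (fun k : ℕ => (((k + y : ℝ) ^ (-c) : ℝ) : ℂ)) (fun k : ℕ => -Real.log (k + y))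
    (injOn_neg_log_add hy _) hT
  simp only [hexp]
  refine hmv.trans (add_le_add (le_of_eq ?_) ?_)
  · rw [sub_zero]
    congr 1
    refine Finset.sum_congr rfl fun k _ => ?_
    rw [Complex.norm_real, Real.norm_of_nonneg (Real.rpow_nonneg (hpos k).le _),
      ← Real.rpow_natCast, ← Real.rpow_mul (hpos k).le]
    congr 1
    push_cast
    ring
  set u : ℕ → ℝ := fun k => (k + y : ℝ) ^ (-c) with hu
  have hu0 : ∀ k, 0 ≤ u k := fun k => Real.rpow_nonneg (hpos k).le _
  have hnorm : ∀ k : ℕ, ‖(((k + y : ℝ) ^ (-c) : ℝ) : ℂ)‖ = u k := fun k => by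
    rw [Complex.norm_real, Real.norm_of_nonneg (hu0 k)]
  simp only [hnorm]
  -- The estimate carries the weight of the smaller index. Adding the terms for both makes the bound
  -- symmetric, and the two double sums are then equal.
  have hpair : ∀ k ∈ Finset.Ico M N, ∀ j ∈ (Finset.Ico M N).erase k,
      u k * u j * (2 / |-Real.log (k + y) - -Real.log (j + y)|) ≤
        2 * W * (u k * (1 / |(k : ℝ) - j|)) + 2 * W * (u j * (1 / |(k : ℝ) - j|)) := by
    intro k hk j hj
    obtain ⟨hjk, hj⟩ := Finset.mem_erase.mp hj
    have hx1 : 0 ≤ 2 * W * (u k * (1 / |(k : ℝ) - j|)) :=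
      mul_nonneg (by linarith) (mul_nonneg (hu0 k) (by positivity))
    have hx2 : 0 ≤ 2 * W * (u j * (1 / |(k : ℝ) - j|)) :=
      mul_nonneg (by linarith) (mul_nonneg (hu0 j) (by positivity))
    rcases lt_or_gt_of_ne hjk with h | h
    · have hlt : (j : ℝ) < k := by exact_mod_cast h
      have := mul_div_abs_log_sub_le (hpos j) (by linarith : (j + y : ℝ) < k + y) (hW k hk)
      rw [abs_sub_comm, mul_comm (u k)]
      refine this.trans (le_trans (le_of_eq ?_) (le_add_of_nonneg_left hx1))
      rw [abs_of_pos (by linarith), add_sub_add_right_eq_sub, mul_one_div]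
    · have hlt : (k : ℝ) < j := by exact_mod_cast h
      have := mul_div_abs_log_sub_le (hpos k) (by linarith : (k + y : ℝ) < j + y) (hW j hj)
      refine this.trans (le_trans (le_of_eq ?_) (le_add_of_nonneg_right hx2))
      rw [abs_sub_comm, abs_of_pos (by linarith), add_sub_add_right_eq_sub, mul_one_div]
  set H := (N : ℝ) ^ η * zetaSum η with hH
  have hHle : ∀ k ∈ Finset.Ico M N,
      ∑ j ∈ (Finset.Ico M N).erase k, 1 / |(k : ℝ) - j| ≤ 2 * H := by
    intro k hk
    have h1 : ∑ d ∈ Finset.range N, 1 / (d + 1 : ℝ) ≤ H := by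
      have := sum_range_rpow_neg_le hη (c := 1) (by linarith) N
      rw [add_sub_cancel_left] at this
      refine le_trans (le_of_eq (Finset.sum_congr rfl fun d _ => ?_)) this
      rw [Real.rpow_neg_one, one_div]
    refine (Finset.sum_le_sum_of_subset_of_nonneg (Finset.erase_subset_erase k fun j hj =>
      Finset.mem_range.mpr (Finset.mem_Ico.mp hj).2) fun _ _ _ => by positivity).trans
      ((sum_erase_inv_dist_le (Finset.mem_Ico.mp hk).2).trans (by linarith))
  have hfirst : ∑ k ∈ Finset.Ico M N, ∑ j ∈ (Finset.Ico M N).erase k,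
      2 * W * (u k * (1 / |(k : ℝ) - j|)) ≤ 4 * W * H * ∑ k ∈ Finset.Ico M N, u k := by
    rw [Finset.mul_sum]
    refine Finset.sum_le_sum fun k hk => ?_
    rw [← Finset.mul_sum, ← Finset.mul_sum]
    calc _ ≤ 2 * W * (u k * (2 * H)) := by
          have := hHle k hk
          have := hu0 k
          gcongr
      _ = _ := by ring
  have hswap : ∑ k ∈ Finset.Ico M N, ∑ j ∈ (Finset.Ico M N).erase k,
      2 * W * (u j * (1 / |(k : ℝ) - j|)) = ∑ k ∈ Finset.Ico M N,
        ∑ j ∈ (Finset.Ico M N).erase k, 2 * W * (u k * (1 / |(k : ℝ) - j|)) := by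
    rw [Finset.sum_comm' (t' := Finset.Ico M N) (s' := fun j => (Finset.Ico M N).erase j)
      fun k j => by simp only [Finset.mem_erase]; tauto]
    refine Finset.sum_congr rfl fun k _ => Finset.sum_congr rfl fun j _ => ?_
    rw [abs_sub_comm]
  calc _ ≤ ∑ k ∈ Finset.Ico M N, ∑ j ∈ (Finset.Ico M N).erase k,
        (2 * W * (u k * (1 / |(k : ℝ) - j|)) + 2 * W * (u j * (1 / |(k : ℝ) - j|))) :=
        Finset.sum_le_sum fun k hk => Finset.sum_le_sum fun j hj => hpair k hk j hj
    _ = _ := by simp only [Finset.sum_add_distrib]; rw [hswap]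
    _ ≤ _ := by linarith

/-- The approximation of the Hurwitz zeta-function by a sum of length `M`, with a remainder
that is an integral of sums over `[M, N)` and an error that is small for large `N`. -/
lemma norm_hurwitzZeta_sub_le {x : ℝ} (hx : 0 < x) (hx1 : x ≤ 1) {s : ℂ} {η : ℝ} (hη : 0 < η)
    (hs0 : η ≤ s.re) (him : s.im ≠ 0) {M N : ℕ} (hM : 1 ≤ M) (hMN : M ≤ N) :
    ‖HurwitzZeta.hurwitzZeta (x : UnitAddCircle) s -
      (∑ k ∈ Finset.Ico 0 M, ((k + x : ℝ) : ℂ) ^ (-s) + ((M + x : ℝ) : ℂ) ^ (1 - s) / (s - 1) +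
        s * ∫ v in (0 : ℝ)..1, (1 - v : ℂ) *
          ∑ k ∈ Finset.Ico M N, ((k + (x + |v|) : ℝ) : ℂ) ^ (-(s + 1)))‖ ≤
      ‖s‖ * ((N : ℝ) ^ (η - s.re) * zetaSum η) := by
  have hre : 0 < s.re := hη.trans_le hs0
  have hne : s ≠ 1 := fun h => him (by simp [h])
  have hsum := hasSum_hurwitzTerm hx hx1 hre him
  have htail := (hasSum_nat_add_iff' N).mpr hsum
  -- On `[0, 1]` the absolute value `|v|` is `v`; it keeps the base positive, hence the integrand
  -- continuous, for all real `v`.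
  have hint : ∑ k ∈ Finset.Ico M N, hurwitzTerm x k s = s * ∫ v in (0 : ℝ)..1, (1 - v : ℂ) *
      ∑ k ∈ Finset.Ico M N, ((k + (x + |v|) : ℝ) : ℂ) ^ (-(s + 1)) := by
    simp only [Finset.mul_sum]
    rw [intervalIntegral.integral_finsetSum, Finset.mul_sum]
    · refine Finset.sum_congr rfl fun k _ => ?_
      rw [hurwitzTerm_eq_integral hx k hne]
      congr 1
      refine intervalIntegral.integral_congr fun v hv => ?_
      rw [Set.uIcc_of_le zero_le_one] at hv
      simp only [abs_of_nonneg hv.1]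
    · intro k _
      refine Continuous.intervalIntegrable ?_ _ _
      refine Continuous.mul (by fun_prop) 
        (Continuous.cpow (by fun_prop) continuous_const fun v => ?_)
      exact Complex.ofReal_mem_slitPlane.mpr (by positivity)
  have hsplit : ∑ k ∈ Finset.range N, hurwitzTerm x k s =
      ∑ k ∈ Finset.range M, hurwitzTerm x k s + ∑ k ∈ Finset.Ico M N, hurwitzTerm x k s :=
    (Finset.sum_range_add_sum_Ico _ hMN).symm
  have heq : HurwitzZeta.hurwitzZeta (x : UnitAddCircle) s -
      (∑ k ∈ Finset.Ico 0 M, ((k + x : ℝ) : ℂ) ^ (-s) + ((M + x : ℝ) : ℂ) ^ (1 - s) / (s - 1) +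
        s * ∫ v in (0 : ℝ)..1, (1 - v : ℂ) *
          ∑ k ∈ Finset.Ico M N, ((k + (x + |v|) : ℝ) : ℂ) ^ (-(s + 1))) =
      ∑' k, hurwitzTerm x (k + N) s := by
    rw [htail.tsum_eq, hsplit, hint, sum_range_hurwitzTerm, Nat.Ico_zero_eq_range]
    have : ∑ k ∈ Finset.range M, 1 / ((k + x : ℝ) : ℂ) ^ s =
        ∑ k ∈ Finset.range M, ((k + x : ℝ) : ℂ) ^ (-s) :=
      Finset.sum_congr rfl fun k _ => by rw [Complex.cpow_neg, one_div]
    rw [this]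
    ring
  rw [heq, zetaSum, ← tsum_mul_left, ← tsum_mul_left]
  refine tsum_of_norm_bounded
    (((summable_nat_add_one_rpow (by linarith)).mul_left _).mul_left _).hasSum fun k => ?_
  refine (norm_hurwitzTerm_le hx _ hne hre.le).trans ?_
  gcongr
  have := rpow_neg_le_of_one_le (c := s.re + 1) hη (by linarith) hx.le (hM.trans hMN) k
  rw [add_comm k N]
  refine this.trans (le_of_eq ?_)
  congr 2
  ring

/-- On the line `|s - 1|² = (1 - l)² + t² ≥ (1 - l)² (1 + t²)`, as `1 - l < 1`, and the integral of
`1 / (1 + t²)` is an arctangent, below `2`. -/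
lemma integral_one_div_norm_sq_le {l : ℝ} (hl0 : 0 < l) (hl1 : l < 1) {T : ℝ} (hT : 0 ≤ T) :
    ∫ t in (0 : ℝ)..T, (1 / ‖(l + t * Complex.I : ℂ) - 1‖) ^ 2 ≤ 2 / (1 - l) ^ 2 := by
  have hl2 : 0 < 1 - l := by linarith
  have hsq : ∀ t : ℝ, ‖(l + t * Complex.I : ℂ) - 1‖ ^ 2 = (1 - l) ^ 2 + t ^ 2 := fun t => by
    rw [Complex.sq_norm, Complex.normSq_apply]
    simp
    ring
  have h1 : ∀ t : ℝ, (1 / ‖(l + t * Complex.I : ℂ) - 1‖) ^ 2 ≤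
      1 / (1 - l) ^ 2 * (1 + t ^ 2)⁻¹ := fun t => by
    rw [div_pow, one_pow, hsq, ← one_div (1 + t ^ 2), div_mul_div_comm, one_mul]
    refine one_div_le_one_div_of_le (by positivity) ?_
    have : (1 - l) ^ 2 ≤ 1 := by nlinarith
    nlinarith [sq_nonneg t]
  have hne : ∀ t : ℝ, ‖(l + t * Complex.I : ℂ) - 1‖ ≠ 0 := fun t h => by
    have := hsq t
    rw [h] at this
    nlinarith [sq_nonneg t]
  calc _ ≤ ∫ t in (0 : ℝ)..T, 1 / (1 - l) ^ 2 * (1 + t ^ 2)⁻¹ := by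
        refine intervalIntegral.integral_mono_on hT ?_ ?_ fun t _ => h1 t
        · exact (Continuous.pow (Continuous.div continuous_const (by fun_prop) hne)
            2).intervalIntegrable _ _
        · exact (continuous_const.mul (Continuous.inv₀ (by fun_prop) fun t => by
            positivity)).intervalIntegrable _ _
    _ = 1 / (1 - l) ^ 2 * Real.arctan T := by
        rw [intervalIntegral.integral_const_mul, integral_inv_one_add_sq]
        simp
    _ ≤ 1 / (1 - l) ^ 2 * 2 := by
        gcongr
        linarith [Real.arctan_lt_pi_div_two T, Real.pi_le_four]
    _ = _ := by ring

lemma norm_sq_add_le_four (z₁ z₂ z₃ z₄ : ℂ) :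
    ‖z₁ + z₂ + z₃ + z₄‖ ^ 2 ≤ 4 * (‖z₁‖ ^ 2 + ‖z₂‖ ^ 2 + ‖z₃‖ ^ 2 + ‖z₄‖ ^ 2) := by
  have h : ‖z₁ + z₂ + z₃ + z₄‖ ≤ ‖z₁‖ + ‖z₂‖ + ‖z₃‖ + ‖z₄‖ :=
    (norm_add_le _ _).trans (by gcongr; exact norm_add₃_le)
  have h2 : ‖z₁ + z₂ + z₃ + z₄‖ ^ 2 ≤ (‖z₁‖ + ‖z₂‖ + ‖z₃‖ + ‖z₄‖) ^ 2 := by gcongr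
  nlinarith [sq_nonneg (‖z₁‖ - ‖z₂‖), sq_nonneg (‖z₁‖ - ‖z₃‖), sq_nonneg (‖z₁‖ - ‖z₄‖),
    sq_nonneg (‖z₂‖ - ‖z₃‖), sq_nonneg (‖z₂‖ - ‖z₄‖), sq_nonneg (‖z₃‖ - ‖z₄‖)]

lemma norm_sq_integral_one_sub_mul_le {g : ℝ → ℂ} (hg : Continuous g) :
    ‖∫ v in (0 : ℝ)..1, (1 - v : ℂ) * g v‖ ^ 2 ≤ ∫ v in (0 : ℝ)..1, ‖g v‖ ^ 2 := by
  have h := norm_intervalIntegral_mul_le (f := fun v : ℝ => (1 - v : ℂ)) zero_le_one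
    (by fun_prop) hg
  have hg0 : 0 ≤ ∫ v in (0 : ℝ)..1, ‖g v‖ ^ 2 :=
    intervalIntegral.integral_nonneg zero_le_one fun _ _ => by positivity
  have h1 : ∫ v in (0 : ℝ)..1, ‖(1 - v : ℂ)‖ ^ 2 ≤ 1 := by
    calc _ ≤ ∫ v in (0 : ℝ)..1, (1 : ℝ) := by
          refine intervalIntegral.integral_mono_on zero_le_one
            (Continuous.intervalIntegrable (by fun_prop) _ _)
            (Continuous.intervalIntegrable (by fun_prop) _ _) fun v hv => ?_
          rw [← Complex.ofReal_one, ← Complex.ofReal_sub, Complex.norm_real, Real.norm_eq_abs,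
            sq_abs]
          nlinarith [hv.1, hv.2]
      _ = 1 := by simp
  have h2 : ‖∫ v in (0 : ℝ)..1, (1 - v : ℂ) * g v‖ ≤ √(∫ v in (0 : ℝ)..1, ‖g v‖ ^ 2) :=
    h.trans (mul_le_of_le_one_left (Real.sqrt_nonneg _) (Real.sqrt_le_one.mpr h1))
  calc _ ≤ √(∫ v in (0 : ℝ)..1, ‖g v‖ ^ 2) ^ 2 := by gcongr
    _ = _ := Real.sq_sqrt hg0

lemma continuous_hurwitzZeta_vertical (a : UnitAddCircle) {l : ℝ} (hl : l ≠ 1) :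
    Continuous fun t : ℝ => HurwitzZeta.hurwitzZeta a (l + t * Complex.I) :=
  continuous_iff_continuousAt.mpr fun t => ContinuousAt.comp
    (f := fun t : ℝ => (l + t * Complex.I : ℂ))
    (HurwitzZeta.differentiableAt_hurwitzZeta _ fun h => hl (by
      simpa using congrArg Complex.re h)).continuousAt (by fun_prop)

section MeanSquare

variable {x l : ℝ}

/-- The mean square of the sum of length `M` up to `M`. -/
lemma integral_norm_sq_initial_le (hx : 0 < x) (hx1 : x ≤ 1) (hl : 1 / 2 < l) (hl1 : l < 1)
    {M : ℕ} (hM : 1 ≤ M) :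
    ∫ t in (0 : ℝ)..M, ‖∑ k ∈ Finset.Ico 0 M, ((k + x : ℝ) : ℂ) ^ (-(l + t * Complex.I))‖ ^ 2 ≤
      (x ^ (-(2 * l)) * zetaSum ((2 * l - 1) / 4) +
        8 * x ^ (-l) * zetaSum ((2 * l - 1) / 4) ^ 2) * M := by
  set η := (2 * l - 1) / 4 with hη
  have hη0 : 0 < η := by rw [hη]; linarith
  set Z := zetaSum η
  have hZ0 : 0 ≤ Z := zetaSum_nonneg η
  have hM0 : (0 : ℝ) < M := by exact_mod_cast hM
  have hM1 : (1 : ℝ) ≤ M := by exact_mod_cast hM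
  have hW : ∀ k ∈ Finset.Ico 0 M, (k + x : ℝ) ^ (1 - l) ≤ (M : ℝ) ^ (1 - l) := fun k hk => by
    have : (k + 1 : ℝ) ≤ M := by exact_mod_cast (Finset.mem_Ico.mp hk).2
    exact Real.rpow_le_rpow (by positivity) (by linarith) (by linarith)
  refine (integral_norm_sq_sum_cpow_le hx hη0 hW (by positivity) hM0.le).trans ?_
  have h1 : ∑ k ∈ Finset.Ico 0 M, (k + x : ℝ) ^ (-(2 * l)) ≤ x ^ (-(2 * l)) * Z := by
    rw [Nat.Ico_zero_eq_range]
    refine le_trans ?_ (mul_le_mul_of_nonneg_left (sum_range_le_zetaSum hη0 M) (by positivity))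
    rw [Finset.mul_sum]
    refine Finset.sum_le_sum fun k _ => (shift_rpow_neg_le hx hx1 (by linarith) k).trans ?_
    gcongr
    · linarith [(Nat.cast_nonneg k : (0 : ℝ) ≤ k)]
    · rw [hη]; linarith
  have h2 : ∑ k ∈ Finset.Ico 0 M, (k + x : ℝ) ^ (-l) ≤
      x ^ (-l) * ((M : ℝ) ^ (1 + η - l) * Z) := by
    rw [Nat.Ico_zero_eq_range]
    refine le_trans ?_ (mul_le_mul_of_nonneg_left
      (sum_range_rpow_neg_le hη0 (c := l) (by linarith) M) (by positivity))
    rw [Finset.mul_sum]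
    exact Finset.sum_le_sum fun k _ => shift_rpow_neg_le hx hx1 (by linarith) k
  -- As `2l = 1 + 4η`, the exponents add up to `2 - 2l + 2η = 1 - 2η`.
  have h3 : (M : ℝ) ^ (1 - l) * (M : ℝ) ^ η * (M : ℝ) ^ (1 + η - l) ≤ M := by
    rw [← Real.rpow_add hM0, ← Real.rpow_add hM0]
    conv_rhs => rw [← Real.rpow_one (M : ℝ)]
    exact Real.rpow_le_rpow_of_exponent_le hM1 (by rw [hη]; linarith)
  calc _ ≤ M * (x ^ (-(2 * l)) * Z) + 8 * (M : ℝ) ^ (1 - l) * ((M : ℝ) ^ η * Z) *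
        (x ^ (-l) * ((M : ℝ) ^ (1 + η - l) * Z)) := by gcongr
    _ = M * (x ^ (-(2 * l)) * Z) + 8 * x ^ (-l) * Z ^ 2 *
        ((M : ℝ) ^ (1 - l) * (M : ℝ) ^ η * (M : ℝ) ^ (1 + η - l)) := by ring
    _ ≤ M * (x ^ (-(2 * l)) * Z) + 8 * x ^ (-l) * Z ^ 2 * M := by gcongr
    _ = _ := by ring

/-- The mean square up to `M` of the sums over `[M, M²)` that make up the remainder. -/
lemma integral_norm_sq_remainder_le {y : ℝ} (hy : 0 < y) (hl : 1 / 2 < l) (hl1 : l < 1)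
    {M : ℕ} (hM : 1 ≤ M) :
    (M : ℝ) ^ 2 * ∫ t in (0 : ℝ)..M, ‖∑ k ∈ Finset.Ico M (M ^ 2),
      ((k + y : ℝ) : ℂ) ^ (-((l + 1 : ℝ) + t * Complex.I))‖ ^ 2 ≤
      (zetaSum ((2 * l - 1) / 4) + 8 * zetaSum ((2 * l - 1) / 4) ^ 2) * M := by
  set η := (2 * l - 1) / 4 with hη
  have hη0 : 0 < η := by rw [hη]; linarith
  set Z := zetaSum η
  have hZ0 : 0 ≤ Z := zetaSum_nonneg η
  have hM0 : (0 : ℝ) < M := by exact_mod_cast hM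
  have hM1 : (1 : ℝ) ≤ M := by exact_mod_cast hM
  have hW : ∀ k ∈ Finset.Ico M (M ^ 2), (k + y : ℝ) ^ (1 - (l + 1)) ≤ (M : ℝ) ^ (-l) :=
    fun k hk => by
      have : (M : ℝ) ≤ k := by exact_mod_cast (Finset.mem_Ico.mp hk).1
      rw [show 1 - (l + 1) = -l by ring]
      exact Real.rpow_le_rpow_of_nonpos hM0 (by linarith) (by linarith)
  have h0 := integral_norm_sq_sum_cpow_le hy hη0 hW (by positivity) hM0.le
  have h1 := sum_Ico_rpow_neg_le hη0 (c := 2 * (l + 1)) (by rw [hη]; linarith) hy.le hM (M ^ 2)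
  have h2 := sum_Ico_rpow_neg_le hη0 (c := l + 1) (by rw [hη]; linarith) hy.le hM (M ^ 2)
  have hsq : (M : ℝ) ^ 2 = (M : ℝ) ^ (2 : ℝ) := by norm_cast
  have hN : (((M ^ 2 : ℕ) : ℝ)) ^ η = (M : ℝ) ^ (2 * η) := by
    rw [Nat.cast_pow, hsq, ← Real.rpow_mul hM0.le]
  have h3 : (M : ℝ) ^ 2 * (M : ℝ) ^ (1 + η - 2 * (l + 1)) ≤ 1 := by
    rw [hsq, ← Real.rpow_add hM0]
    exact Real.rpow_le_one_of_one_le_of_nonpos hM1 (by rw [hη]; linarith)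
  -- As `2l = 1 + 4η`, the exponents add up to `2 - 2l + 3η = 1 - η`.
  have h4 : (M : ℝ) ^ 2 * ((M : ℝ) ^ (-l) * (M : ℝ) ^ (2 * η) * (M : ℝ) ^ (1 + η - (l + 1))) ≤
      M := by
    rw [hsq, ← Real.rpow_add hM0, ← Real.rpow_add hM0, ← Real.rpow_add hM0]
    conv_rhs => rw [← Real.rpow_one (M : ℝ)]
    exact Real.rpow_le_rpow_of_exponent_le hM1 (by rw [hη]; linarith)
  calc _ ≤ (M : ℝ) ^ 2 * (M * ((M : ℝ) ^ (1 + η - 2 * (l + 1)) * Z) +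
        8 * (M : ℝ) ^ (-l) * ((((M ^ 2 : ℕ) : ℝ)) ^ η * Z) * ((M : ℝ) ^ (1 + η - (l + 1)) * Z)) := by
        refine mul_le_mul_of_nonneg_left (h0.trans ?_) (by positivity)
        gcongr
    _ = M * Z * ((M : ℝ) ^ 2 * (M : ℝ) ^ (1 + η - 2 * (l + 1))) + 8 * Z ^ 2 * ((M : ℝ) ^ 2 *
        ((M : ℝ) ^ (-l) * (M : ℝ) ^ (2 * η) * (M : ℝ) ^ (1 + η - (l + 1)))) := by
        rw [hN]
        ring
    _ ≤ M * Z * 1 + 8 * Z ^ 2 * M := by gcongr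
    _ = _ := by ring

/-- The mean square of the Hurwitz zeta-function to the right of the critical line. -/
theorem exists_integral_norm_sq_hurwitzZeta_le (hx : 0 < x) (hx1 : x ≤ 1) (hl : 1 / 2 < l)
    (hl1 : l < 1) : ∃ C : ℝ, ∀ T : ℝ, 1 ≤ T →
      ∫ t in (0 : ℝ)..T, ‖HurwitzZeta.hurwitzZeta (x : UnitAddCircle) (l + t * Complex.I)‖ ^ 2 ≤
        C * T := by
  set η := (2 * l - 1) / 4 with hη
  have hη0 : 0 < η := by rw [hη]; linarith
  set Z := zetaSum η with hZ
  have hZ0 : 0 ≤ Z := zetaSum_nonneg η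
  set C₁ := x ^ (-(2 * l)) * Z + 8 * x ^ (-l) * Z ^ 2 with hC₁
  set C₂ := 2 * (2 / (1 - l) ^ 2) with hC₂
  set C₃ := 4 * (Z + 8 * Z ^ 2) with hC₃
  set C₄ := (2 * Z) ^ 2 with hC₄
  set C := 4 * (C₁ + C₂ + C₃ + C₄) with hC
  have hC0 : 0 ≤ C := by positivity
  have hcontζ : Continuous fun t : ℝ =>
      HurwitzZeta.hurwitzZeta (x : UnitAddCircle) (l + t * Complex.I) :=
    continuous_hurwitzZeta_vertical _ hl1.ne
  -- The initial sum has length `M` equal to the length of the interval of integration. For `0 < t <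
  -- M` this gives `‖s‖ ≤ 2M`, which the remainder over `[M, M²)` can afford.
  have key : ∀ M : ℕ, 1 ≤ M →
      ∫ t in (0 : ℝ)..M, ‖HurwitzZeta.hurwitzZeta (x : UnitAddCircle) (l + t * Complex.I)‖ ^ 2 ≤
        C * M := by
    intro M hM
    have hM0 : (0 : ℝ) < M := by exact_mod_cast hM
    have hM1 : (1 : ℝ) ≤ M := by exact_mod_cast hM
    set G : ℝ → ℝ → ℂ := fun v t => ∑ k ∈ Finset.Ico M (M ^ 2),
      ((k + (x + |v|) : ℝ) : ℂ) ^ (-((l + 1 : ℝ) + t * Complex.I)) with hG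
    have hGc : Continuous (Function.uncurry G) := by
      refine continuous_finsetSum _ fun k _ => ?_
      refine Continuous.cpow (by fun_prop) (by fun_prop) fun q => ?_
      exact Complex.ofReal_mem_slitPlane.mpr (by positivity)
    have hGv : ∀ t, Continuous fun v => G v t := fun t =>
      hGc.comp (continuous_id.prodMk continuous_const)
    set S : ℝ → ℂ := fun t => ∑ k ∈ Finset.Ico 0 M, ((k + x : ℝ) : ℂ) ^ (-(l + t * Complex.I))
      with hS
    have hSc : Continuous S := by
      refine continuous_finsetSum _ fun k _ => ?_
      refine Continuous.const_cpow (by fun_prop) (Or.inl ?_)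
      have : (0 : ℝ) < k + x := by positivity
      exact_mod_cast this.ne'
    set p : ℝ → ℝ := fun t => 1 / ‖(l + t * Complex.I : ℂ) - 1‖ with hp
    have hpc : Continuous p := by
      refine Continuous.div continuous_const (by fun_prop) fun t h => ?_
      have := congrArg Complex.re (norm_eq_zero.mp h)
      simp at this
      linarith
    set J : ℝ → ℝ := fun t => ∫ v in (0 : ℝ)..1, ‖G v t‖ ^ 2 with hJ
    have hJc : Continuous J := by
      refine intervalIntegral.continuous_parametric_intervalIntegral_of_continuous' ?_ 0 1
      exact ((hGc.comp continuous_swap).norm.pow 2)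
    have hpt : ∀ t ∈ Set.Ioo (0 : ℝ) M,
        ‖HurwitzZeta.hurwitzZeta (x : UnitAddCircle) (l + t * Complex.I)‖ ^ 2 ≤
          4 * (‖S t‖ ^ 2 + 2 * M * p t ^ 2 + 4 * M ^ 2 * J t + C₄) := by
      intro t ht
      set s : ℂ := l + t * Complex.I with hs
      have hsre : s.re = l := by simp [hs]
      have hsim : s.im = t := by simp [hs]
      have hsnorm : ‖s‖ ≤ 2 * M := by
        refine (Complex.norm_le_abs_re_add_abs_im s).trans ?_
        rw [hsre, hsim, abs_of_pos (by linarith), abs_of_pos ht.1]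
        linarith [ht.2]
      have happ := norm_hurwitzZeta_sub_le hx hx1 (s := s) hη0
        (by rw [hsre, hη]; linarith) (by rw [hsim]; exact ht.1.ne') hM
        (by nlinarith : M ≤ M ^ 2)
      set I₃ := s * ∫ v in (0 : ℝ)..1, (1 - v : ℂ) *
          ∑ k ∈ Finset.Ico M (M ^ 2), ((k + (x + |v|) : ℝ) : ℂ) ^ (-(s + 1)) with hI₃
      set I₂ := ((M + x : ℝ) : ℂ) ^ (1 - s) / (s - 1) with hI₂
      set E := HurwitzZeta.hurwitzZeta (x : UnitAddCircle) s - (S t + I₂ + I₃) with hE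
      have hEle : ‖E‖ ^ 2 ≤ C₄ := by
        have h1 : ‖E‖ ≤ 2 * Z := by
          refine happ.trans ?_
          -- The cut-off `N = M²` is large enough: the exponent is `2(η - l) + 1 = -2η`.
          have h2 : (((M ^ 2 : ℕ) : ℝ)) ^ (η - s.re) * M ≤ 1 := by
            rw [Nat.cast_pow, ← Real.rpow_natCast, ← Real.rpow_mul hM0.le,
              ← Real.rpow_add_one hM0.ne']
            exact Real.rpow_le_one_of_one_le_of_nonpos hM1 (by
              rw [hsre, hη]; push_cast; linarith)
          calc _ ≤ 2 * M * ((((M ^ 2 : ℕ) : ℝ)) ^ (η - s.re) * Z) := by gcongr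
            _ = 2 * Z * ((((M ^ 2 : ℕ) : ℝ)) ^ (η - s.re) * M) := by ring
            _ ≤ 2 * Z * 1 := by gcongr
            _ = _ := mul_one _
        rw [hC₄]
        gcongr
      have hI₂le : ‖I₂‖ ^ 2 ≤ 2 * M * p t ^ 2 := by
        have hpos : (0 : ℝ) < M + x := by positivity
        have h1 : ((M + x : ℝ) ^ (1 - l)) ^ 2 ≤ 2 * M := by
          rw [← Real.rpow_natCast, ← Real.rpow_mul hpos.le]
          calc _ ≤ (M + x : ℝ) ^ (1 : ℝ) :=
                Real.rpow_le_rpow_of_exponent_le (by linarith) (by push_cast; linarith)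
            _ ≤ _ := by rw [Real.rpow_one]; linarith
        rw [hI₂, norm_div, Complex.norm_cpow_eq_rpow_re_of_pos hpos, div_eq_mul_one_div, mul_pow]
        have h2 : (1 - s).re = 1 - l := by simp [hsre]
        rw [h2]
        exact mul_le_mul_of_nonneg_right h1 (by positivity)
      have hI₃le : ‖I₃‖ ^ 2 ≤ 4 * M ^ 2 * J t := by
        have h1 : ∀ v : ℝ, ∑ k ∈ Finset.Ico M (M ^ 2),
            ((k + (x + |v|) : ℝ) : ℂ) ^ (-(s + 1)) = G v t := fun v => by
          refine Finset.sum_congr rfl fun k _ => ?_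
          congr 2
          rw [hs]
          push_cast
          ring
        simp only [h1] at hI₃
        rw [hI₃, norm_mul, mul_pow]
        have h2 := norm_sq_integral_one_sub_mul_le (hGv t)
        have h3 : ‖s‖ ^ 2 ≤ 4 * M ^ 2 := by
          calc ‖s‖ ^ 2 ≤ (2 * M) ^ 2 := by gcongr
            _ = _ := by ring
        exact mul_le_mul h3 h2 (by positivity) (by positivity)
      have hdec : HurwitzZeta.hurwitzZeta (x : UnitAddCircle) s = S t + I₂ + I₃ + E := by
        rw [hE]; ring
      rw [hdec]
      refine (norm_sq_add_le_four _ _ _ _).trans ?_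
      gcongr
    have hint : ∫ t in (0 : ℝ)..M, 4 * (‖S t‖ ^ 2 + 2 * M * p t ^ 2 + 4 * M ^ 2 * J t + C₄) =
        4 * ((∫ t in (0 : ℝ)..M, ‖S t‖ ^ 2) + 2 * M * (∫ t in (0 : ℝ)..M, p t ^ 2) +
          4 * M ^ 2 * (∫ t in (0 : ℝ)..M, J t) + M * C₄) := by
      have i1 : IntervalIntegrable (fun t => ‖S t‖ ^ 2) volume 0 M :=
        (hSc.norm.pow 2).intervalIntegrable _ _
      have i2 : IntervalIntegrable (fun t => 2 * M * p t ^ 2) volume 0 M :=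
        (continuous_const.mul (hpc.pow 2)).intervalIntegrable _ _
      have i3 : IntervalIntegrable (fun t => 4 * M ^ 2 * J t) volume 0 M :=
        (continuous_const.mul hJc).intervalIntegrable _ _
      have i4 : IntervalIntegrable (fun _ => C₄) volume 0 M := intervalIntegrable_const
      rw [intervalIntegral.integral_const_mul, intervalIntegral.integral_add ((i1.add i2).add i3) i4,
        intervalIntegral.integral_add (i1.add i2) i3, intervalIntegral.integral_add i1 i2,
        intervalIntegral.integral_const_mul, intervalIntegral.integral_const_mul,
        intervalIntegral.integral_const, sub_zero, smul_eq_mul]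
    have hJint : 4 * (M : ℝ) ^ 2 * (∫ t in (0 : ℝ)..M, J t) ≤ C₃ * M := by
      have hswap : ∫ t in (0 : ℝ)..M, J t =
          ∫ v in (0 : ℝ)..1, ∫ t in (0 : ℝ)..M, ‖G v t‖ ^ 2 := by
        refine MeasureTheory.intervalIntegral_intervalIntegral_swap ?_
        have hc : Continuous (Function.uncurry fun t v : ℝ => ‖G v t‖ ^ 2) :=
          (hGc.comp continuous_swap).norm.pow 2
        refine (hc.continuousOn.integrableOn_compact
          ((isCompact_uIcc (a := (0 : ℝ)) (b := M)).prod
            (isCompact_uIcc (a := (0 : ℝ)) (b := 1)))).mono_set ?_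
        exact Set.prod_mono Set.uIoc_subset_uIcc Set.uIoc_subset_uIcc
      have hinner : ∀ v ∈ Set.Icc (0 : ℝ) 1, (M : ℝ) ^ 2 * ∫ t in (0 : ℝ)..M, ‖G v t‖ ^ 2 ≤
          (Z + 8 * Z ^ 2) * M := fun v _ =>
        integral_norm_sq_remainder_le (by positivity) hl hl1 hM
      have hcv : Continuous fun v => ∫ t in (0 : ℝ)..M, ‖G v t‖ ^ 2 :=
        intervalIntegral.continuous_parametric_intervalIntegral_of_continuous'
          (hGc.norm.pow 2) 0 M
      rw [hswap, mul_assoc, ← intervalIntegral.integral_const_mul]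
      calc _ ≤ 4 * ∫ v in (0 : ℝ)..1, (Z + 8 * Z ^ 2) * M := by
            refine mul_le_mul_of_nonneg_left ?_ (by norm_num)
            exact intervalIntegral.integral_mono_on zero_le_one
              ((continuous_const.mul hcv).intervalIntegrable _ _) intervalIntegrable_const hinner
        _ = C₃ * M := by
            rw [intervalIntegral.integral_const, hC₃]
            simp
            ring
    have hSint := integral_norm_sq_initial_le hx hx1 hl hl1 hM
    have hpint := integral_one_div_norm_sq_le (by linarith : 0 < l) hl1 hM0.le
    refine (intervalIntegral.integral_mono_on_of_le_Ioo hM0.le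
      ((hcontζ.norm.pow 2).intervalIntegrable _ _) ?_ hpt).trans ?_
    · exact (continuous_const.mul ((((hSc.norm.pow 2).add (continuous_const.mul (hpc.pow 2))).add
        (continuous_const.mul hJc)).add continuous_const)).intervalIntegrable _ _
    · rw [hint]
      have h2 : 2 * M * (∫ t in (0 : ℝ)..M, p t ^ 2) ≤ C₂ * M := by
        calc _ ≤ 2 * M * (2 / (1 - l) ^ 2) := by gcongr
          _ = _ := by rw [hC₂]; ring
      have h1 : (∫ t in (0 : ℝ)..M, ‖S t‖ ^ 2) ≤ C₁ * M := hSint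
      rw [hC]
      linarith
  refine ⟨2 * C, fun T hT => ?_⟩
  have hceil : T ≤ ⌈T⌉₊ := Nat.le_ceil T
  have hceil' : (⌈T⌉₊ : ℝ) < T + 1 := Nat.ceil_lt_add_one (by linarith)
  have h1 := key ⌈T⌉₊ (Nat.one_le_ceil_iff.mpr (by linarith))
  have hmono : ∫ t in (0 : ℝ)..T,
      ‖HurwitzZeta.hurwitzZeta (x : UnitAddCircle) (l + t * Complex.I)‖ ^ 2 ≤
      ∫ t in (0 : ℝ)..⌈T⌉₊,
        ‖HurwitzZeta.hurwitzZeta (x : UnitAddCircle) (l + t * Complex.I)‖ ^ 2 :=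
    intervalIntegral.integral_mono_interval le_rfl (by linarith) hceil
      (Eventually.of_forall fun t => by positivity) ((hcontζ.norm.pow 2).intervalIntegrable _ _)
  nlinarith

end MeanSquare

/-! ### Periodic Hurwitz zeta-functions -/

/-- The pole is simple, but differentiability is asked at the point `1` itself. The product `(z - 1)
ζ(z)` is `0` at `1` while its limit there is `1`; the square makes value and limit agree. -/
lemma differentiableAt_sub_one_sq_mul_hurwitzZeta (a : UnitAddCircle) :
    DifferentiableAt ℂ (fun z => (z - 1) ^ 2 * HurwitzZeta.hurwitzZeta a z) 1 := by
  have heq : (fun z => (z - 1) ^ 2 * HurwitzZeta.hurwitzZeta a z) =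
      fun z => (z - 1) ^ 2 * (HurwitzZeta.hurwitzZeta a z - 1 / (z - 1) / Complex.Gammaℝ z) +
        (z - 1) * (Complex.Gammaℝ z)⁻¹ := by
    funext z
    rcases eq_or_ne z 1 with rfl | hz
    · simp
    · have : z - 1 ≠ 0 := sub_ne_zero.mpr hz
      have h2 : (z - 1) ^ 2 * (1 / (z - 1) / Complex.Gammaℝ z) =
          (z - 1) * (Complex.Gammaℝ z)⁻¹ := by
        rw [div_eq_mul_inv, ← mul_assoc]
        congr 1
        field_simp
      rw [mul_sub, h2, sub_add_cancel]
  rw [heq]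
  exact (DifferentiableAt.mul (by fun_prop)
    (HurwitzZeta.differentiableAt_hurwitzZeta_sub_one_div a)).add
    (DifferentiableAt.mul (by fun_prop) (Complex.differentiable_Gammaℝ_inv 1))

section

variable {α : ℝ} {q : ℕ} {b : ℕ → ℂ}

lemma differentiableAt_natCast_inv_cpow (hq : 0 < q) (s : ℂ) :
    DifferentiableAt ℂ (fun s : ℂ => 1 / (q : ℂ) ^ s) s := by
  have hq0 : (q : ℂ) ≠ 0 := by exact_mod_cast hq.ne'
  refine DifferentiableAt.div (differentiableAt_const _)
    (differentiableAt_id.const_cpow (Or.inl hq0)) ?_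
  simp [Complex.cpow_eq_zero_iff, hq0]

lemma differentiableAt_sub_one_sq_mul_periodicHurwitz (hq : 0 < q) :
    DifferentiableAt ℂ (fun z => (z - 1) ^ 2 * periodicHurwitz α q b z) 1 := by
  have heq : (fun z => (z - 1) ^ 2 * periodicHurwitz α q b z) = fun z => 1 / (q : ℂ) ^ z *
      ∑ l ∈ Finset.range q, b l * ((z - 1) ^ 2 *
        HurwitzZeta.hurwitzZeta (((l + α) / q : ℝ) : UnitAddCircle) z) := by
    funext z
    rw [periodicHurwitz, mul_left_comm, Finset.mul_sum]
    congr 1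
    exact Finset.sum_congr rfl fun l _ => by ring
  rw [heq]
  refine (differentiableAt_natCast_inv_cpow hq 1).mul (DifferentiableAt.fun_sum fun l _ => ?_)
  exact (differentiableAt_sub_one_sq_mul_hurwitzZeta _).const_mul _

lemma exists_norm_le_of_periodic (hq : 0 < q) (hb : Function.Periodic b q) :
    ∃ C : ℝ, 0 ≤ C ∧ ∀ k, ‖b k‖ ≤ C := by
  refine ⟨∑ l ∈ Finset.range q, ‖b l‖, by positivity, fun k => ?_⟩
  rw [← hb.map_mod_nat k]
  exact Finset.single_le_sum (f := fun l => ‖b l‖) (fun l _ => norm_nonneg _)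
    (Finset.mem_range.mpr (Nat.mod_lt k hq))

lemma exists_norm_le_rpow_of_periodic (hq : 0 < q) (hb : Function.Periodic b q) (ε : ℝ)
    (hε : 0 < ε) : ∃ C : ℝ, ∀ k : ℕ, ‖b k‖ ≤ C * (k + 1 : ℝ) ^ ε := by
  obtain ⟨C, hC0, hC⟩ := exists_norm_le_of_periodic hq hb
  refine ⟨C, fun k => (hC k).trans (le_mul_of_one_le_right hC0 (Real.one_le_rpow ?_ hε.le))⟩
  linarith [(Nat.cast_nonneg k : (0 : ℝ) ≤ k)]

lemma add_div_mem_Ioc (hα₀ : 0 < α) (hα₁ : α ≤ 1) (hq : 0 < q) {j : ℕ}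
    (hj : j ∈ Finset.range q) : (j + α) / q ∈ Set.Ioc (0 : ℝ) 1 := by
  have hq0 : (0 : ℝ) < q := by exact_mod_cast hq
  have hjq : (j : ℝ) + 1 ≤ q := by exact_mod_cast Finset.mem_range.mp hj
  exact ⟨by positivity, (div_le_one hq0).mpr (by linarith)⟩

lemma norm_natCast_inv_cpow_le_one (hq : 0 < q) {s : ℂ} (hs : 0 ≤ s.re) :
    ‖1 / (q : ℂ) ^ s‖ ≤ 1 := by
  rw [norm_div, norm_one, Complex.norm_natCast_cpow_of_pos hq]
  exact div_le_one_of_le₀ (Real.one_le_rpow (by exact_mod_cast hq) hs) (by positivity)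

lemma norm_periodicHurwitz_le_sum (hq : 0 < q) {s : ℂ} (hs : 0 ≤ s.re) :
    ‖periodicHurwitz α q b s‖ ≤ ∑ j ∈ Finset.range q, ‖b j‖ *
      ‖HurwitzZeta.hurwitzZeta (((j + α) / q : ℝ) : UnitAddCircle) s‖ := by
  rw [periodicHurwitz, norm_mul]
  refine (mul_le_of_le_one_left (norm_nonneg _) (norm_natCast_inv_cpow_le_one hq hs)).trans ?_
  refine (norm_sum_le _ _).trans (le_of_eq ?_)
  simp only [norm_mul]

lemma exists_norm_periodicHurwitz_le (hα₀ : 0 < α) (hα₁ : α ≤ 1) (hq : 0 < q) {l : ℝ}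
    (hl : 0 < l) (c : ℝ) : ∃ M : ℝ, ∀ s : ℂ, l ≤ s.re → s.re ≤ c → 1 ≤ |s.im| →
      ‖periodicHurwitz α q b s‖ ≤ M * |s.im| := by
  have h : ∀ j : ℕ, ∃ M : ℝ, j ∈ Finset.range q → ∀ s : ℂ, l ≤ s.re → s.re ≤ c → 1 ≤ |s.im| →
      ‖HurwitzZeta.hurwitzZeta (((j + α) / q : ℝ) : UnitAddCircle) s‖ ≤ M * |s.im| := fun j => by
    by_cases hj : j ∈ Finset.range q
    · have hmem := add_div_mem_Ioc hα₀ hα₁ hq hj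
      obtain ⟨M, -, hM⟩ := norm_hurwitzZeta_le (b := c) hmem.1 hmem.2 hl
      exact ⟨M, fun _ => hM⟩
    · exact ⟨0, fun h => absurd h hj⟩
  choose M hM using h
  refine ⟨∑ j ∈ Finset.range q, ‖b j‖ * M j, fun s hs hsc ht => ?_⟩
  refine (norm_periodicHurwitz_le_sum hq (hl.le.trans hs)).trans ?_
  rw [Finset.sum_mul]
  refine Finset.sum_le_sum fun j hj => ?_
  rw [mul_assoc]
  exact mul_le_mul_of_nonneg_left (hM j hj s hs hsc ht) (norm_nonneg _)

lemma continuous_periodicHurwitz_vertical (hq : 0 < q) {l : ℝ} (hl : l ≠ 1) :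
    Continuous fun t : ℝ => periodicHurwitz α q b (l + t * Complex.I) :=
  continuous_iff_continuousAt.mpr fun t => ContinuousAt.comp
    (f := fun t : ℝ => (l + t * Complex.I : ℂ))
    (differentiableAt_periodicHurwitz α hq b fun h => hl (by
      simpa using congrArg Complex.re h)).continuousAt (by fun_prop)

/-- Cauchy–Schwarz over the `q` residue classes reduces this to the single Hurwitz zeta-functions.
-/
lemma exists_integral_norm_sq_periodicHurwitz_le (hα₀ : 0 < α) (hα₁ : α ≤ 1) (hq : 0 < q) {l : ℝ}
    (hl : 1 / 2 < l) (hl1 : l < 1) : ∃ C : ℝ, ∀ T : ℝ, 1 ≤ T →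
      ∫ t in (0 : ℝ)..T, ‖periodicHurwitz α q b (l + t * Complex.I)‖ ^ 2 ≤ C * T := by
  have h : ∀ j : ℕ, ∃ C : ℝ, j ∈ Finset.range q → ∀ T : ℝ, 1 ≤ T → ∫ t in (0 : ℝ)..T,
      ‖HurwitzZeta.hurwitzZeta (((j + α) / q : ℝ) : UnitAddCircle) (l + t * Complex.I)‖ ^ 2 ≤
        C * T := fun j => by
    by_cases hj : j ∈ Finset.range q
    · have hmem := add_div_mem_Ioc hα₀ hα₁ hq hj
      obtain ⟨C, hC⟩ := exists_integral_norm_sq_hurwitzZeta_le hmem.1 hmem.2 hl hl1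
      exact ⟨C, fun _ => hC⟩
    · exact ⟨0, fun h => absurd h hj⟩
  choose C hC using h
  refine ⟨q * ∑ j ∈ Finset.range q, ‖b j‖ ^ 2 * C j, fun T hT => ?_⟩
  have hcont : ∀ j : ℕ, Continuous fun t : ℝ => ‖b j‖ ^ 2 *
      ‖HurwitzZeta.hurwitzZeta (((j + α) / q : ℝ) : UnitAddCircle) (l + t * Complex.I)‖ ^ 2 :=
    fun j => continuous_const.mul ((continuous_hurwitzZeta_vertical _ hl1.ne).norm.pow 2)
  calc _ ≤ ∫ t in (0 : ℝ)..T, (q : ℝ) * ∑ j ∈ Finset.range q, ‖b j‖ ^ 2 *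
        ‖HurwitzZeta.hurwitzZeta (((j + α) / q : ℝ) : UnitAddCircle)
          (l + t * Complex.I)‖ ^ 2 := by
        refine intervalIntegral.integral_mono_on (by linarith)
          (((continuous_periodicHurwitz_vertical hq hl1.ne).norm.pow 2).intervalIntegrable _ _)
          ((continuous_const.mul (continuous_finsetSum _ fun j _ =>
            hcont j)).intervalIntegrable _ _) fun t _ => ?_
        have h1 := norm_periodicHurwitz_le_sum (α := α) (b := b) hq
          (s := l + t * Complex.I) (by simp; linarith)
        have h2 := sq_sum_le_card_mul_sum_sq (s := Finset.range q) (f := fun j => ‖b j‖ *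
          ‖HurwitzZeta.hurwitzZeta (((j + α) / q : ℝ) : UnitAddCircle) (l + t * Complex.I)‖)
        rw [Finset.card_range] at h2
        simp only [mul_pow] at h2
        exact (pow_le_pow_left₀ (norm_nonneg _) h1 2).trans h2
    _ = (q : ℝ) * ∑ j ∈ Finset.range q, ‖b j‖ ^ 2 * ∫ t in (0 : ℝ)..T,
        ‖HurwitzZeta.hurwitzZeta (((j + α) / q : ℝ) : UnitAddCircle)
          (l + t * Complex.I)‖ ^ 2 := by
        rw [intervalIntegral.integral_const_mul, intervalIntegral.integral_finsetSum fun j _ =>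
          (hcont j).intervalIntegrable _ _]
        simp only [intervalIntegral.integral_const_mul]
    _ ≤ (q : ℝ) * ∑ j ∈ Finset.range q, ‖b j‖ ^ 2 * (C j * T) := by
        gcongr with j hj
        exact hC j hj T hT
    _ = _ := by
        rw [mul_assoc, Finset.sum_mul]
        simp only [mul_assoc]

/-- Periodic Hurwitz zeta-functions fall under the general approximation theorem. -/
theorem dirichletContinuation_periodicHurwitz (hα₀ : 0 < α) (hα₁ : α ≤ 1) (hq : 0 < q)
    (hb : Function.Periodic b q) {l : ℝ} (hl : 1 / 2 < l) (hl1 : l < 1) (P : Finset ℂ)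
    (hP : ∀ p ∈ P, p = 1) (hP1 : 1 ∉ P → Differentiable ℂ (periodicHurwitz α q b)) :
    DirichletContinuation (periodicHurwitz α q b) b α l (poleFactor P 2) := by
  have hl0 : 0 < l := by linarith
  obtain ⟨C, hC0, hC⟩ := exists_norm_poleFactor_le P 2
  have hdiff : ∀ s : ℂ, l ≤ s.re →
      DifferentiableAt ℂ (fun s => poleFactor P 2 s * periodicHurwitz α q b s) s := by
    refine fun s hs => differentiableAt_poleFactor_mul P (fun p hp => ?_) (hl0.le.trans hs)
      fun hsP => ?_
    · rw [hP p hp]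
      exact differentiableAt_sub_one_sq_mul_periodicHurwitz hq
    · rcases eq_or_ne s 1 with rfl | hs1
      · exact hP1 hsP 1
      · exact differentiableAt_periodicHurwitz α hq b hs1
  have hre : ∀ t : ℝ, ((l : ℂ) + t * Complex.I).re = l := fun t => by simp
  refine ⟨hα₀, hα₁, hl.le, hl1, exists_norm_le_rpow_of_periodic hq hb,
    fun s hs => hasSum_periodicHurwitz hα₀ hα₁ hq hb hs,
    fun s hs => differentiableAt_poleFactor _ _ (hl0.le.trans hs),
    ⟨C, fun s hs => hC s (hl0.le.trans hs)⟩, hdiff, fun c => ?_, ?_⟩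
  · obtain ⟨M, hM⟩ := exists_norm_periodicHurwitz_le (b := b) hα₀ hα₁ hq hl0 c
    refine exists_growth_of_continuous (fun s hs => (hdiff s hs).continuousAt) (M := C * M)
      (t₀ := 1) (c := 1) fun s hs hsc ht => ?_
    rw [norm_mul, mul_assoc, Real.rpow_one]
    exact mul_le_mul (hC s (hl0.le.trans hs)) (hM s hs hsc ht) (norm_nonneg _) hC0
  · obtain ⟨C', hC'⟩ := exists_integral_norm_sq_periodicHurwitz_le (b := b) hα₀ hα₁ hq hl hl1
    have hcont := continuous_periodicHurwitz_vertical (α := α) (b := b) hq hl1.ne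
    have hcont' : Continuous fun t : ℝ => poleFactor P 2 (l + t * Complex.I) *
        periodicHurwitz α q b (l + t * Complex.I) := continuous_iff_continuousAt.mpr fun t =>
      ContinuousAt.comp (f := fun t : ℝ => (l : ℂ) + t * Complex.I)
        (hdiff _ (hre t).ge).continuousAt (by fun_prop)
    refine ⟨C ^ 2 * C', fun T hT => ?_⟩
    calc _ ≤ ∫ t in (0 : ℝ)..T, C ^ 2 * ‖periodicHurwitz α q b (l + t * Complex.I)‖ ^ 2 := by
          refine intervalIntegral.integral_mono_on (by linarith)
            ((hcont'.norm.pow 2).intervalIntegrable _ _)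
            ((continuous_const.mul (hcont.norm.pow 2)).intervalIntegrable _ _) fun t _ => ?_
          rw [norm_mul, mul_pow]
          gcongr
          exact hC _ (by rw [hre]; exact hl0.le)
      _ = C ^ 2 * ∫ t in (0 : ℝ)..T, ‖periodicHurwitz α q b (l + t * Complex.I)‖ ^ 2 :=
          intervalIntegral.integral_const_mul _ _
      _ ≤ C ^ 2 * (C' * T) := by
          gcongr
          exact hC' T hT
      _ = _ := by ring

/-- A periodic Hurwitz zeta-function is approximated in measure by the partial sums of its
Dirichlet series. -/
theorem approxInMeasure_periodicHurwitz (hα₀ : 0 < α) (hα₁ : α ≤ 1) (hq : 0 < q)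
    (hb : Function.Periodic b q) {τ : ℝ} (hτ : 0 < τ) {K : Set ℂ} (hK : IsCompact K)
    (hKD : K ⊆ hurwitzDomain α q b) {δ ε : ℝ} (hδ : 0 < δ) (hε : 0 < ε) :
    ApproxInMeasure (periodicHurwitz α q b) b α τ K δ ε := by
  -- The mean square bound holds strictly to the right of `1/2`, so the left edge is placed between
  -- `1/2` and the compact set, and below `1`.
  obtain ⟨l, hl, hl1, hKl⟩ : ∃ l : ℝ, 1 / 2 < l ∧ l < 1 ∧ ∀ c ∈ K, l < c.re := by
    rcases K.eq_empty_or_nonempty with rfl | hne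
    · exact ⟨3 / 4, by norm_num, by norm_num, fun c hc => absurd hc (Set.notMem_empty c)⟩
    · obtain ⟨c₀, hc₀, hmin⟩ := hK.exists_isMinOn hne Complex.continuous_re.continuousOn
      have h0 := half_lt_re_of_mem_hurwitzDomain (hKD hc₀)
      refine ⟨min ((1 / 2 + c₀.re) / 2) (3 / 4), lt_min (by linarith) (by norm_num),
        (min_le_right _ _).trans_lt (by norm_num), fun c hc => ?_⟩
      have : c₀.re ≤ c.re := hmin hc
      exact (min_le_left _ _).trans_lt (by linarith)
  by_cases hE : Differentiable ℂ (periodicHurwitz α q b)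
  · exact (dirichletContinuation_periodicHurwitz hα₀ hα₁ hq hb hl hl1 ∅ (by simp)
      fun _ => hE).approxInMeasure hτ hK hKl (by simp) hδ hε
  · refine (dirichletContinuation_periodicHurwitz hα₀ hα₁ hq hb hl hl1 {1} (by simp)
      (by simp)).approxInMeasure hτ hK hKl (fun c hc p hp => ?_) hδ hε
    have hc' := hKD hc
    rw [hurwitzDomain, if_neg hE] at hc'
    rw [Finset.mem_singleton.mp hp]
    exact hc'.2

end

end MixedZeta

end

/-! ### The limit theorem. -/

open MixedZeta in
theorem theorem3 (Φ : MatsumotoZeta)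
    (α : ℝ) (hα₀ : 0 < α) (hα₁ : α ≤ 1)
    (q : ℕ) (hq : 0 < q) (b : ℕ → ℂ) (hb : Function.Periodic b q) (hb₀ : ∃ m, b m ≠ 0)
    (h : ℝ) (hh : 0 < h) (hL : LinearIndependent ℚ (familyL α h))
    (D₁ D₂ : Opens ℂ) (hD₁ : (D₁ : Set ℂ) ⊆ Φ.domain)
    (hD₂ : (D₂ : Set ℂ) ⊆ hurwitzDomain α q b) :
    (∀ᵐ ω ∂haarOmega,
      Tendsto (Φ.partialSum D₁ ω.1) atTop (𝓝 (randomZ Φ hα₀ b D₁ D₂ ω).1) ∧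
      Tendsto (hurwitzPartialSum hα₀ b D₂ ω.2) atTop (𝓝 (randomZ Φ hα₀ b D₁ D₂ ω).2)) ∧
    ∃ hZ : AEMeasurable (randomZ Φ hα₀ b D₁ D₂) haarOmega,
      Tendsto (fun N : ℕ => empirical (fun k : ℕ => shiftZ Φ hq hD₁ hD₂ (k * h)) N) atTop
        (𝓝 (⟨haarOmega.map (randomZ Φ hα₀ b D₁ D₂), Measure.isProbabilityMeasure_map hZ⟩ :
          ProbabilityMeasure (Hol D₁ × Hol D₂))) := by
  exact limit_theorem_of_approx Φ hα₀ hα₁ hq hh hL hD₁ hD₂ (fun ε hε => Φ.exists_norm_c_le hε)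
    (exists_norm_le_rpow_of_periodic hq hb)
    (fun K hK hKD δ ε hδ hε => Φ.approxInMeasure hh hK (hKD.trans hD₁) hδ hε)
    (fun K hK hKD δ ε hδ hε =>
      approxInMeasure_periodicHurwitz hα₀ hα₁ hq hb hh hK (hKD.trans hD₂) hδ hε)
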